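/- Work with the two-sorted language of second-order arithmetic. $\mathrm{RCA}_0$ consists of the basic axioms of arithmetic, $\Sigma^0_1$ induction and $\Delta^0_1$ comprehension; $\mathrm{WKL}_0$ is $\mathrm{RCA}_0$ together with the statement that every infinite tree $T\subseteq 2^{<\omega}$ has an infinite path. A set $A$ of reals is cofinal if every real is Turing reducible to an element of $A$. A tree $T\subseteq\omega^{<\omega}$ is perfect if it is nonempty and every $\sigma\in T$ has two incompatible extensions in $T$; it is pointed if it is perfect and $T\le_T x$ for every infinite path $x\in[T]$. Martin's pointed tree theorem, $\mathrm{MPT}$, is the statement of second-order arithmetic that every tree $T\subseteq\omega^{<\omega}$ such that $[T]$ is cofinal has a pointed subtree. **Theorem.** Over $\mathrm{RCA}_0$, $\mathrm{MPT}$ does not imply $\mathrm{WKL}_0$; that is, $\mathrm{WKL}_0$ is not a logical consequence of $\mathrm{RCA}_0+\mathrm{MPT}$. This is witnessed by $\omega$-models as follows. Call $x\in 2^\omega$ arithmetically generic relative to $Y\subseteq\omega$ if for every set $D\subseteq 2^{<\omega}$ that is arithmetical in $Y$ there is an $n$ such that $x\upharpoonright n\in D$ or no extension of $x\upharpoonright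 n$ is in $D$. There is a sequence $g_0,g_1,\dots$ in $2^\omega$ such that $g_0$ is arithmetically generic (relative to $\emptyset$) and, for each $n$, $g_{n+1}$ is arithmetically generic relative to $g_0\oplus\dots\oplus g_n$. For every such sequence, let $M$ be the collection of all reals that are Turing reducible to $g_0\oplus\dots\oplus g_n$ for some $n$, and let $\mathcal M$ be the $\omega$-model whose sets are the elements of $M$. Then: 1. $\mathcal M\models\mathrm{RCA}_0$, $\mathcal M\models\mathrm{MPT}$ and $\mathcal M\not\models\mathrm{WKL}_0$. 2. No $x\in M$ has PA degree, i.e. no $x\in M$ computes a function $z:\omega\to\{0,1\}$ such that $z(e)\ne\Phi_e(e)$ for every $e$ for which $\Phi_e(e)$ is defined. 3. If $T\subseteq\omega^{<\omega}$ is a tree in $M$ and for every $x\in M$ there is $y\in[T]\cap M$ with $x\le_T y$, then there is a pointed tree $S\subseteq T$ in $M$ (with $S\le_T x$ for every $x\in[S]$, whether or not $x\in M$). -/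

import Mathlib

/-! ## The language of second-order arithmetic -/

namespace SOA

/-- Number terms; `var i` is the `i`-th number variable. -/
inductive Tm : Type
  | var (i : ℕ)
  | zero
  | one
  | add (s t : Tm)
  | mul (s t : Tm)

instance : Zero Tm := ⟨Tm.zero⟩
instance : One Tm := ⟨Tm.one⟩
instance : Add Tm := ⟨Tm.add⟩
instance : Mul Tm := ⟨Tm.mul⟩

/-- Formulas of the two-sorted language with symbols `0, 1, +, ·, <, =, ∈`. Number variables and set
variables are two separate families, each indexed by `ℕ`; `mem t X` says that the value of `t`
belongs to the `X`-th set variable. -/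
inductive Fml : Type
  | eq (s t : Tm)
  | lt (s t : Tm)
  | mem (t : Tm) (X : ℕ)
  | not (φ : Fml)
  | and (φ ψ : Fml)
  | or (φ ψ : Fml)
  | imp (φ ψ : Fml)
  | allN (i : ℕ) (φ : Fml)
  | exN (i : ℕ) (φ : Fml)
  | allS (X : ℕ) (φ : Fml)
  | exS (X : ℕ) (φ : Fml)

/-- The number variable `i` occurs in a term. -/
def Tm.Occurs (i : ℕ) : Tm → Prop
  | .var j => i = j
  | .zero => False
  | .one => False
  | .add s t => s.Occurs i ∨ t.Occurs i
  | .mul s t => s.Occurs i ∨ t.Occurs i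

/-- The number variable `i` occurs (free or bound) in a formula. -/
def Fml.OccursN (i : ℕ) : Fml → Prop
  | .eq s t => s.Occurs i ∨ t.Occurs i
  | .lt s t => s.Occurs i ∨ t.Occurs i
  | .mem t _ => t.Occurs i
  | .not φ => φ.OccursN i
  | .and φ ψ => φ.OccursN i ∨ ψ.OccursN i
  | .or φ ψ => φ.OccursN i ∨ ψ.OccursN i
  | .imp φ ψ => φ.OccursN i ∨ ψ.OccursN i
  | .allN j φ => i = j ∨ φ.OccursN i
  | .exN j φ => i = j ∨ φ.OccursN i
  | .allS _ φ => φ.OccursN i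
  | .exS _ φ => φ.OccursN i

/-- The set variable `X` occurs (free or bound) in a formula. -/
def Fml.OccursS (X : ℕ) : Fml → Prop
  | .eq _ _ => False
  | .lt _ _ => False
  | .mem _ Y => X = Y
  | .not φ => φ.OccursS X
  | .and φ ψ => φ.OccursS X ∨ ψ.OccursS X
  | .or φ ψ => φ.OccursS X ∨ ψ.OccursS X
  | .imp φ ψ => φ.OccursS X ∨ ψ.OccursS X
  | .allN _ φ => φ.OccursS X
  | .exN _ φ => φ.OccursS X
  | .allS Y φ => X = Y ∨ φ.OccursS X
  | .exS Y φ => X = Y ∨ φ.OccursS X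

/-- Structures for second-order arithmetic: the set quantifiers range over `S`. -/
structure Str where
  N : Type
  zero : N
  one : N
  add : N → N → N
  mul : N → N → N
  lt : N → N → Prop
  S : Set (Set N)
  S_nonempty : S.Nonempty

/-- The value of a term. -/
def Tm.val (M : Str) (v : ℕ → M.N) : Tm → M.N
  | .var i => v i
  | .zero => M.zero
  | .one => M.one
  | .add s t => M.add (s.val M v) (t.val M v)
  | .mul s t => M.mul (s.val M v) (t.val M v)

/-- Tarskian satisfaction. -/
def Fml.Sat (M : Str) : Fml → (ℕ → M.N) → (ℕ → Set M.N) → Prop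
  | .eq s t, v, _ => s.val M v = t.val M v
  | .lt s t, v, _ => M.lt (s.val M v) (t.val M v)
  | .mem t X, v, V => t.val M v ∈ V X
  | .not φ, v, V => ¬ φ.Sat M v V
  | .and φ ψ, v, V => φ.Sat M v V ∧ ψ.Sat M v V
  | .or φ ψ, v, V => φ.Sat M v V ∨ ψ.Sat M v V
  | .imp φ ψ, v, V => φ.Sat M v V → ψ.Sat M v V
  | .allN i φ, v, V => ∀ a : M.N, φ.Sat M (Function.update v i a) V
  | .exN i φ, v, V => ∃ a : M.N, φ.Sat M (Function.update v i a) V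
  | .allS X φ, v, V => ∀ A ∈ M.S, φ.Sat M v (Function.update V X A)
  | .exS X φ, v, V => ∃ A ∈ M.S, φ.Sat M v (Function.update V X A)

/-- `M ⊨ φ`: the universal closure of `φ` is true in `M`. -/
def Str.Models (M : Str) (φ : Fml) : Prop :=
  ∀ (v : ℕ → M.N) (V : ℕ → Set M.N), (∀ X, V X ∈ M.S) → φ.Sat M v V

/-- `M` is a model of the theory `Γ`. -/
def Str.ModelsTheory (M : Str) (Γ : Set Fml) : Prop := ∀ φ ∈ Γ, M.Models φ

/-- Logical consequence: every structure (not only every `ω`-model) that satisfies `Γ`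
satisfies `φ`. -/
def Entails (Γ : Set Fml) (φ : Fml) : Prop := ∀ M : Str, M.ModelsTheory Γ → M.Models φ

/-! ## Writing formulas

A `Bld` is a formula that still waits for a number `k` such that all variables with index at least
`k` are fresh; a quantifier binds the variable with index `k`. A sentence is obtained at `k = 0`. -/

/-- Formulas with fresh variables to be supplied. -/
abbrev Bld := ℕ → Fml

def beq (s t : Tm) : Bld := fun _ => .eq s t
def blt (s t : Tm) : Bld := fun _ => .lt s t
def bmem (t : Tm) (X : ℕ) : Bld := fun _ => .mem t X
def bnot (φ : Bld) : Bld := fun k => .not (φ k)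
def band (φ ψ : Bld) : Bld := fun k => .and (φ k) (ψ k)
def bor (φ ψ : Bld) : Bld := fun k => .or (φ k) (ψ k)
def bimp (φ ψ : Bld) : Bld := fun k => .imp (φ k) (ψ k)
def biff (φ ψ : Bld) : Bld := band (bimp φ ψ) (bimp ψ φ)
def allN (f : Tm → Bld) : Bld := fun k => .allN k (f (.var k) (k + 1))
def exN (f : Tm → Bld) : Bld := fun k => .exN k (f (.var k) (k + 1))
def allS (f : ℕ → Bld) : Bld := fun k => .allS k (f k (k + 1))
def exS (f : ℕ → Bld) : Bld := fun k => .exS k (f k (k + 1))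

infix:50 " =ᵇ " => beq
infix:50 " <ᵇ " => blt
infix:50 " ∈ᵇ " => bmem
prefix:max "¬ᵇ" => bnot
infixr:35 " ∧ᵇ " => band
infixr:30 " ∨ᵇ " => bor
infixr:25 " →ᵇ " => bimp
infix:20 " ↔ᵇ " => biff

/-! ## The systems `RCA₀` and `WKL₀` -/

/-- The basic axioms of arithmetic. -/
def basicAxioms : Set Fml :=
  { (allN fun m => ¬ᵇ(m + 1 =ᵇ 0)) 0,
    (allN fun m => allN fun n => m + 1 =ᵇ n + 1 →ᵇ m =ᵇ n) 0,
    (allN fun m => m + 0 =ᵇ m) 0,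
    (allN fun m => allN fun n => m + (n + 1) =ᵇ (m + n) + 1) 0,
    (allN fun m => m * 0 =ᵇ 0) 0,
    (allN fun m => allN fun n => m * (n + 1) =ᵇ m * n + m) 0,
    (allN fun m => ¬ᵇ(m <ᵇ 0)) 0,
    (allN fun m => allN fun n => m <ᵇ n + 1 ↔ᵇ (m <ᵇ n ∨ᵇ m =ᵇ n)) 0 }

/-- Bounded (`Σ⁰₀`) formulas: all quantifiers are bounded number quantifiers. Set variables may
occur free. -/
inductive Fml.Bounded : Fml → Prop
  | eq (s t) : Bounded (.eq s t)
  | lt (s t) : Bounded (.lt s t)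
  | mem (t X) : Bounded (.mem t X)
  | not {φ} : Bounded φ → Bounded (.not φ)
  | and {φ ψ} : Bounded φ → Bounded ψ → Bounded (.and φ ψ)
  | or {φ ψ} : Bounded φ → Bounded ψ → Bounded (.or φ ψ)
  | imp {φ ψ} : Bounded φ → Bounded ψ → Bounded (.imp φ ψ)
  | ball {i t φ} : ¬ t.Occurs i → Bounded φ → Bounded (.allN i (.imp (.lt (.var i) t) φ))
  | bex {i t φ} : ¬ t.Occurs i → Bounded φ → Bounded (.exN i (.and (.lt (.var i) t) φ))

/-- `Σ⁰₁` formulas. -/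
def Fml.Sigma01 (φ : Fml) : Prop := ∃ i θ, θ.Bounded ∧ φ = .exN i θ

/-- `Π⁰₁` formulas. -/
def Fml.Pi01 (φ : Fml) : Prop := ∃ i θ, θ.Bounded ∧ φ = .allN i θ

/-- Induction for `φ` with respect to the variable `i`:
`(φ(0) ∧ ∀ i (φ(i) → φ(i+1))) → ∀ i φ(i)`. The substitution instances are written with the help of
a fresh variable `j`: `φ(0)` as `∀ i (i = 0 → φ)` and `φ(i+1)` as `∀ j (j = i+1 → ∀ i (i = j → φ))`. -/
def indFml (φ : Fml) (i j : ℕ) : Fml :=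
  .imp
    (.and (.allN i (.imp (.eq (.var i) 0) φ))
      (.allN i (.imp φ (.allN j (.imp (.eq (.var j) (.var i + 1))
        (.allN i (.imp (.eq (.var i) (.var j)) φ)))))))
    (.allN i φ)

/-- Comprehension for `φ` under the assumption that `φ` and `ψ` are equivalent:
`∀ i (φ(i) ↔ ψ(i)) → ∃ X ∀ i (i ∈ X ↔ φ(i))`. -/
def compFml (φ ψ : Fml) (i X : ℕ) : Fml :=
  .imp (.allN i (.and (.imp φ ψ) (.imp ψ φ)))
    (.exS X (.allN i (.and (.imp (.mem (.var i) X) φ) (.imp φ (.mem (.var i) X)))))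

/-- `RCA₀`: the basic axioms, `Σ⁰₁` induction and `Δ⁰₁` comprehension (with number and set
parameters). -/
def RCA0 : Set Fml :=
  basicAxioms
    ∪ {χ | ∃ φ i j, φ.Sigma01 ∧ j ≠ i ∧ ¬ φ.OccursN j ∧ χ = indFml φ i j}
    ∪ {χ | ∃ φ ψ i X, φ.Sigma01 ∧ ψ.Pi01 ∧ ¬ φ.OccursS X ∧ χ = compFml φ ψ i X}

/-! Pairs and finite sequences. The pairing function is `Nat.pair`. A finite sequence is a number:
the empty sequence is `0`, and `σ` followed by the entry `a` is `⟨a, σ⟩ + 1`; every natural number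
is the code of exactly one sequence. -/

/-- `z = ⟨a, b⟩`. -/
def isPair (a b z : Tm) : Bld :=
  (a <ᵇ b ∧ᵇ z =ᵇ b * b + a) ∨ᵇ (¬ᵇ(a <ᵇ b) ∧ᵇ z =ᵇ a * a + a + b)

/-- `τ` is the sequence `σ` followed by the entry `a`. -/
def isSnoc (σ a τ : Tm) : Bld := exN fun z => isPair a σ z ∧ᵇ τ =ᵇ z + 1

/-- `i` belongs to the finite set `{i < k : m (i + 1) + 1 divides n}` coded by `k, m, n`. Every
finite set has such a code. -/
def inFin (k m n i : Tm) : Bld := i <ᵇ k ∧ᵇ exN fun q => q * (m * (i + 1) + 1) =ᵇ n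

/-- The sequence `τ` extends the sequence `σ` (or is equal to it): there is a finite set that
contains `τ` and that contains with every element other than `σ` its immediate predecessor. -/
def isExt (σ τ : Tm) : Bld :=
  exN fun k => exN fun m => exN fun n => inFin k m n τ ∧ᵇ
    allN fun ρ => inFin k m n ρ →ᵇ (ρ =ᵇ σ ∨ᵇ
      exN fun ρ' => exN fun a => isSnoc ρ' a ρ ∧ᵇ inFin k m n ρ')

/-- `T` is a tree of finite sequences of numbers. -/
def isTree (T : ℕ) : Bld :=
  allN fun σ => allN fun a => allN fun τ => isSnoc σ a τ →ᵇ τ ∈ᵇ T →ᵇ σ ∈ᵇ T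

def isSubset (S T : ℕ) : Bld := allN fun σ => σ ∈ᵇ S →ᵇ σ ∈ᵇ T

/-- `P` is an infinite path through `T`. An element of Baire space is given by the set `P` of its
finite initial segments. -/
def isPath (P T : ℕ) : Bld :=
  isSubset P T ∧ᵇ isTree P ∧ᵇ (exN fun σ => σ ∈ᵇ P) ∧ᵇ
    allN fun σ => σ ∈ᵇ P →ᵇ exN fun a => (exN fun τ => isSnoc σ a τ ∧ᵇ τ ∈ᵇ P) ∧ᵇ
      allN fun b => allN fun τ => isSnoc σ b τ →ᵇ τ ∈ᵇ P →ᵇ b =ᵇ a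

/-- Weak König's lemma: every infinite tree of finite `0`-`1`-sequences has an infinite path. -/
def WKL : Fml :=
  (allS fun T => isTree T →ᵇ
    (allN fun σ => allN fun a => allN fun τ => isSnoc σ a τ →ᵇ τ ∈ᵇ T →ᵇ (a =ᵇ 0 ∨ᵇ a =ᵇ 1)) →ᵇ
    (allN fun n => exN fun σ => n <ᵇ σ ∧ᵇ σ ∈ᵇ T) →ᵇ
    exS fun P => isPath P T) 0

/-- `WKL₀`. -/
def WKL0 : Set Fml := RCA0 ∪ {WKL}

/-! ## Turing reducibility in the language of second-order arithmetic

Programs are numbers `⟨tag, ⟨c₁, c₂⟩⟩`; the tags `0, …, 8` stand for the constant zero, the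
successor, the two projections of pairs, the oracle, and for pairing, composition, primitive
recursion and minimization, as in `Nat.RecursiveIn`. The triple `⟨c, ⟨x, y⟩⟩` says that the program
`c` on the input `x` has the output `y`. -/

/-- The numerals. -/
def num : ℕ → Tm
  | 0 => 0
  | n + 1 => num n + 1

/-- The triple `⟨c, ⟨x, y⟩⟩` belongs to the finite set coded by `k, m, n`. -/
def inRec (k m n c x y : Tm) : Bld :=
  exN fun z => exN fun t => isPair x y z ∧ᵇ isPair c z t ∧ᵇ inFin k m n t

/-- The claim that the program `c` with oracle `Y` on the input `x` has the output `y` follows by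
one step from the claims in the finite set coded by `k, m, n`. -/
def isStep (Y : ℕ) (k m n c x y : Tm) : Bld :=
  exN fun tag => exN fun d => exN fun c₁ => exN fun c₂ =>
    isPair tag d c ∧ᵇ isPair c₁ c₂ d ∧ᵇ
    ((tag =ᵇ num 0 ∧ᵇ y =ᵇ 0) ∨ᵇ
     (tag =ᵇ num 1 ∧ᵇ y =ᵇ x + 1) ∨ᵇ
     (tag =ᵇ num 2 ∧ᵇ exN fun b => isPair y b x) ∨ᵇ
     (tag =ᵇ num 3 ∧ᵇ exN fun a => isPair a y x) ∨ᵇ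
     (tag =ᵇ num 4 ∧ᵇ ((x ∈ᵇ Y ∧ᵇ y =ᵇ 1) ∨ᵇ (¬ᵇ(x ∈ᵇ Y) ∧ᵇ y =ᵇ 0))) ∨ᵇ
     (tag =ᵇ num 5 ∧ᵇ exN fun y₁ => exN fun y₂ =>
        inRec k m n c₁ x y₁ ∧ᵇ inRec k m n c₂ x y₂ ∧ᵇ isPair y₁ y₂ y) ∨ᵇ
     (tag =ᵇ num 6 ∧ᵇ exN fun z => inRec k m n c₂ x z ∧ᵇ inRec k m n c₁ z y) ∨ᵇ
     (tag =ᵇ num 7 ∧ᵇ exN fun a => exN fun l => isPair a l x ∧ᵇ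
        ((l =ᵇ 0 ∧ᵇ inRec k m n c₁ a y) ∨ᵇ
         (exN fun l' => exN fun w => exN fun i => exN fun u => exN fun z =>
            l =ᵇ l' + 1 ∧ᵇ isPair a l' w ∧ᵇ inRec k m n c w i ∧ᵇ
            isPair l' i u ∧ᵇ isPair a u z ∧ᵇ inRec k m n c₂ z y))) ∨ᵇ
     (tag =ᵇ num 8 ∧ᵇ (exN fun w => isPair x y w ∧ᵇ inRec k m n c₁ w 0) ∧ᵇ
        allN fun l => l <ᵇ y →ᵇ exN fun w => exN fun j =>
          isPair x l w ∧ᵇ ¬ᵇ(j =ᵇ 0) ∧ᵇ inRec k m n c₁ w j))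

/-- The program `e` with oracle `Y` on the input `x` has the output `y`: there is a finite set of
claims, this one among them, each of which follows from others in the set by one step. -/
def computes (Y : ℕ) (e x y : Tm) : Bld :=
  exN fun k => exN fun m => exN fun n => inRec k m n e x y ∧ᵇ
    allN fun c => allN fun x' => allN fun y' =>
      inRec k m n c x' y' →ᵇ isStep Y k m n c x' y'

/-- `X ≤_T Y`: some program with oracle `Y` computes the characteristic function of `X`. -/
def isTuringRed (X Y : ℕ) : Bld :=
  exN fun e => allN fun x =>
    (x ∈ᵇ X →ᵇ computes Y e x 1) ∧ᵇ (¬ᵇ(x ∈ᵇ X) →ᵇ computes Y e x 0)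

/-! ## Martin's pointed tree theorem in the language of second-order arithmetic -/

/-- The set of infinite paths through `T` is cofinal. -/
def isCofinal (T : ℕ) : Bld := allS fun X => exS fun P => isPath P T ∧ᵇ isTuringRed X P

/-- `S` is perfect: it is nonempty, and every element has two incompatible extensions in it. -/
def isPerfect (S : ℕ) : Bld :=
  (exN fun σ => σ ∈ᵇ S) ∧ᵇ
    allN fun σ => σ ∈ᵇ S →ᵇ exN fun τ₀ => exN fun τ₁ =>
      τ₀ ∈ᵇ S ∧ᵇ τ₁ ∈ᵇ S ∧ᵇ isExt σ τ₀ ∧ᵇ isExt σ τ₁ ∧ᵇ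
      ¬ᵇ(isExt τ₀ τ₁) ∧ᵇ ¬ᵇ(isExt τ₁ τ₀)

/-- `S` is a pointed tree: a perfect tree that is Turing reducible to each of its paths. -/
def isPointed (S : ℕ) : Bld :=
  isTree S ∧ᵇ isPerfect S ∧ᵇ allS fun P => isPath P S →ᵇ isTuringRed S P

/-- Martin's pointed tree theorem: every tree with cofinally many paths has a pointed subtree. -/
def MPT : Fml :=
  (allS fun T => isTree T →ᵇ isCofinal T →ᵇ exS fun S => isSubset S T ∧ᵇ isPointed S) 0

end SOA

/-! ## Trees, pointed trees, `PA` degrees, arithmetical genericity -/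

namespace Pointed

open scoped Computability

/-- The characteristic function of a set of natural numbers. -/
noncomputable def char (A : Set ℕ) : ℕ →. ℕ :=
  fun n => Part.some (open Classical in if n ∈ A then 1 else 0)

/-- The characteristic function of a set of finite sequences, via their codes. -/
noncomputable def charSeq {α : Type} [Encodable α] (T : Set (List α)) : ℕ →. ℕ :=
  char (Encodable.encode '' T)

/-- The initial segment of length `n` of an infinite sequence. -/
def initSeg {α : Type} (x : ℕ → α) (n : ℕ) : List α := (List.range n).map x

def IsTree (T : Set (List ℕ)) : Prop := ∀ σ τ, σ <+: τ → τ ∈ T → σ ∈ T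

/-- The infinite paths through `T`. -/
def paths (T : Set (List ℕ)) : Set (ℕ → ℕ) := {x | ∀ n, initSeg x n ∈ T}

def IsPerfect (T : Set (List ℕ)) : Prop :=
  T.Nonempty ∧ ∀ σ ∈ T, ∃ τ₀ ∈ T, ∃ τ₁ ∈ T, σ <+: τ₀ ∧ σ <+: τ₁ ∧ ¬ τ₀ <+: τ₁ ∧ ¬ τ₁ <+: τ₀

/-- A pointed tree is a perfect tree that is Turing reducible to each of its infinite paths. -/
def IsPointed (T : Set (List ℕ)) : Prop :=
  IsTree T ∧ IsPerfect T ∧ ∀ x ∈ paths T, charSeq T ≤ᵀ (x : ℕ →. ℕ)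

/-- `x` has `PA` degree: it computes a `0`-`1`-valued function `z` with `z(e) ≠ Φₑ(e)` for
all `e`. -/
def IsPA (x : ℕ → ℕ) : Prop :=
  ∃ z : ℕ → ℕ, (∀ e, z e = 0 ∨ z e = 1) ∧ (z : ℕ →. ℕ) ≤ᵀ (x : ℕ →. ℕ) ∧
    ∀ e, z e ∉ (Denumerable.ofNat Nat.Partrec.Code e).eval e

/-- The sets arithmetical in `Y`: the smallest class of sets of natural numbers that contains the
sets recursive in `Y` and is closed under complement, intersection and projection. -/
inductive ArithIn (Y : Set ℕ) : Set ℕ → Prop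
  | of_recursive {A : Set ℕ} : char A ≤ᵀ char Y → ArithIn Y A
  | compl {A : Set ℕ} : ArithIn Y A → ArithIn Y Aᶜ
  | inter {A B : Set ℕ} : ArithIn Y A → ArithIn Y B → ArithIn Y (A ∩ B)
  | proj {A : Set ℕ} : ArithIn Y A → ArithIn Y {x | ∃ y, Nat.pair x y ∈ A}

/-- `x` is arithmetically generic relative to `Y`: for every set `D` of finite `0`-`1`-sequences
that is arithmetical in `Y`, some initial segment of `x` is in `D` or has no extension in `D`. -/
def IsArithGeneric (Y : Set ℕ) (x : ℕ → Bool) : Prop :=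
  ∀ D : Set (List Bool), ArithIn Y (Encodable.encode '' D) →
    ∃ n, initSeg x n ∈ D ∨ ∀ σ, initSeg x n <+: σ → σ ∉ D

/-- The join `g₀ ⊕ g₁ ⊕ ⋯ ⊕ gₙ`. -/
def join (g : ℕ → ℕ → Bool) (n : ℕ) : Set ℕ :=
  {p | ∃ i m, i ≤ n ∧ g i m = true ∧ p = Nat.pair i m}

/-- `g₀` is arithmetically generic, and each `gₙ₊₁` is arithmetically generic relative to
`g₀ ⊕ ⋯ ⊕ gₙ`. -/
def IsGenericSeq (g : ℕ → ℕ → Bool) : Prop :=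
  IsArithGeneric ∅ (g 0) ∧ ∀ n, IsArithGeneric (join g n) (g (n + 1))

/-- The reals that are Turing reducible to some finite join `g₀ ⊕ ⋯ ⊕ gₙ`. -/
def Below (g : ℕ → ℕ → Bool) (f : ℕ →. ℕ) : Prop := ∃ n, f ≤ᵀ char (join g n)

/-- The `ω`-model whose sets are those Turing reducible to some finite join `g₀ ⊕ ⋯ ⊕ gₙ`. -/
abbrev model (g : ℕ → ℕ → Bool) : SOA.Str where
  N := ℕ
  zero := 0
  one := 1
  add := (· + ·)
  mul := (· * ·)
  lt := (· < ·)
  S := {A | Below g (char A)}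
  S_nonempty := ⟨join g 0, 0, TuringReducible.refl _⟩

end Pointed

/-! ## Relative computability -/

section RelativeComputability

open Encodable

variable {α β γ σ : Type*} [Primcodable α] [Primcodable β] [Primcodable γ] [Primcodable σ]
  {O : Set (ℕ →. ℕ)}

/-! Write J_k for the join of g_0, …, g_{k-1} (`joinBelow g k`). Each g_k is arithmetically generic
relative to J_k, and M consists of what the J_k compute.

M has no PA degree because a 0-1-valued diagonally noncomputable function can be pulled down from
J_{k+1} to J_k (`not_diagonally_noncomputable`). Genericity gives an initial segment of g_k none of
whose extensions makes the reduction produce a forbidden value, and a search through these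
extensions yields such a function recursive in J_k. At J_0 = ∅ this is absurd, since a recursive
function cannot differ from itself at its own index. The tree of attempts at such a function is
recursive and infinite, so WKL fails in the model.

For MPT, let T be recursive in J_k. Cofinality is used once: it gives a path y of T in M that
computes J_{k+1}, one generic more than T needs. So y = F(J_k, g_k, …, g_{k+r}) and J_{k+1} = H(y)
for partial recursive functionals F and H. By product genericity (`IsArithGeneric.prod`) a finite
condition p on g_k, …, g_{k+r} forces that the values of F stay in T, that H applied to them never
errs about J_k or about the first coordinate, and that they can always be prolonged until H is
defined on any given finite domain. The strings that F produces below p form a set that is r.e. in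
J_k. They split: lengthening the first coordinate by 0 and by 1 leads to strings that H tells apart.
So `exists_perfect_subtree` thins them out to a perfect tree recursive in J_k, along every path of
which H still returns J_k. Every path, inside M or not, computes J_k and hence the tree
(`exists_pointed_subtree`).

RCA₀ holds since M is closed under finite joins and Turing reducibility; Δ⁰₁ comprehension is Post's
theorem. To pass from these facts to the formal sentences, the arithmetized computation relation
must be matched with Turing reducibility (`sat_isTuringRed`). Generic sequences exist because only
countably many sets are arithmetical in a given one. -/

theorem Nat.RecursiveIn.some' : Nat.RecursiveIn O Part.some :=
  Nat.Partrec.recursiveIn Nat.Partrec.some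

namespace ComputableIn

theorem of_eq {f g : α → β} (hf : ComputableIn O f) (h : ∀ a, f a = g a) : ComputableIn O g :=
  (funext h : f = g) ▸ hf

theorem comp {f : β → γ} {g : α → β} (hf : ComputableIn O f) (hg : ComputableIn O g) :
    ComputableIn O fun a => f (g a) :=
  (Nat.RecursiveIn.comp hf hg).of_eq fun n => by
    rcases e : decode (α := α) n <;> simp

theorem pair {f : α → β} {g : α → γ} (hf : ComputableIn O f) (hg : ComputableIn O g) :
    ComputableIn O fun a => (f a, g a) :=
  (Nat.RecursiveIn.pair hf hg).of_eq fun n => by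
    rcases e : decode (α := α) n <;> simp [Seq.seq]

theorem comp₂ {f : β → γ → σ} {g : α → β} {h : α → γ} (hf : ComputableIn₂ O f)
    (hg : ComputableIn O g) (hh : ComputableIn O h) : ComputableIn O fun a => f (g a) (h a) :=
  comp (f := fun p : β × γ => f p.1 p.2) hf (hg.pair hh)

theorem nat_rec {f : α → ℕ} {g : α → σ} {h : α → ℕ → σ → σ} (hf : ComputableIn O f)
    (hg : ComputableIn O g) (hh : ComputableIn O fun x : α × ℕ × σ => h x.1 x.2.1 x.2.2) :
    ComputableIn O fun a => (Nat.rec (g a) (h a) (f a) : σ) := by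
  have := Nat.RecursiveIn.comp (Nat.RecursiveIn.prec hg hh) (Nat.RecursiveIn.pair
    Nat.RecursiveIn.some' hf)
  refine Nat.RecursiveIn.of_eq this fun n => ?_
  rcases e : decode (α := α) n with - | a
  · simp [Seq.seq]
  · simp only [Seq.seq]
    simp
    induction f a <;> simp_all

theorem bool_cond {c : α → Bool} {f g : α → σ} (hc : ComputableIn O c)
    (hf : ComputableIn O f) (hg : ComputableIn O g) :
    ComputableIn O fun a => bif c a then f a else g a :=
  comp (f := fun x : Bool × σ × σ => bif x.1 then x.2.1 else x.2.2)
    (Primrec.cond .fst (Primrec.fst.comp .snd) (Primrec.snd.comp .snd)).computableIn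
    (hc.pair (hf.pair hg))

end ComputableIn

attribute [fun_prop] ComputableIn ComputableIn.id ComputableIn.const ComputableIn.comp
  ComputableIn.pair ComputableIn.fst ComputableIn.snd

theorem ComputableIn.partrec_of_forall_mem {f : α → σ} (hf : ComputableIn O f)
    (hO : ∀ g ∈ O, Partrec g) : Computable f :=
  RecursiveIn.partrec_of_oracle hO hf

/-- Propositions are coded as truth values, so that a predicate is decidable relative to `O`
iff it is computable in `O` as a function to `Prop`. -/
noncomputable instance : Primcodable Prop := Primcodable.ofEquiv Bool Equiv.propEquivBool

namespace ComputableIn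

open Classical in
theorem primrec_decide_prop : Primrec fun p : Prop => decide p :=
  (Primrec.of_equiv (e := Equiv.propEquivBool)).of_eq fun p => by
    simp [Equiv.propEquivBool]

theorem primrec_coe_bool : Primrec fun b : Bool => (b = true : Prop) :=
  (Primrec.of_equiv_symm (e := Equiv.propEquivBool)).of_eq fun p => by
    simp [Equiv.propEquivBool]

open Classical in
@[fun_prop]
theorem decide_prop {p : α → Prop} (hp : ComputableIn O p) :
    ComputableIn O fun a => decide (p a) :=
  primrec_decide_prop.computableIn.comp hp

theorem of_decide {p : α → Prop} [DecidablePred p] (hp : ComputableIn O fun a => decide (p a)) :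
    ComputableIn O p :=
  (primrec_coe_bool.computableIn.comp hp).of_eq fun a => by simp

theorem of_primrecPred {p : α → Prop} (hp : PrimrecPred p) : ComputableIn O p := by
  classical exact of_decide hp.decide.computableIn

theorem eq_true {b : α → Bool} (hb : ComputableIn O b) : ComputableIn O fun a => b a = true :=
  primrec_coe_bool.computableIn.comp hb

@[fun_prop]
theorem not {p : α → Prop} (hp : ComputableIn O p) : ComputableIn O fun a => ¬ p a := by
  classical
  exact of_decide ((Primrec.not.computableIn.comp hp.decide_prop).of_eq fun a => by simp)

@[fun_prop]
theorem and {p q : α → Prop} (hp : ComputableIn O p) (hq : ComputableIn O q) :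
    ComputableIn O fun a => p a ∧ q a := by
  classical
  exact of_decide ((comp₂ Primrec.and.computableIn₂ hp.decide_prop hq.decide_prop).of_eq
    fun a => by simp)

@[fun_prop]
theorem or {p q : α → Prop} (hp : ComputableIn O p) (hq : ComputableIn O q) :
    ComputableIn O fun a => p a ∨ q a := by
  classical
  exact of_decide ((comp₂ Primrec.or.computableIn₂ hp.decide_prop hq.decide_prop).of_eq
    fun a => by simp)

theorem imp {p q : α → Prop} (hp : ComputableIn O p) (hq : ComputableIn O q) :
    ComputableIn O fun a => p a → q a :=
  (hp.not.or hq).of_eq fun a => by simp only [imp_iff_not_or]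

@[fun_prop]
theorem iff {p q : α → Prop} (hp : ComputableIn O p) (hq : ComputableIn O q) :
    ComputableIn O fun a => p a ↔ q a :=
  ((hp.imp hq).and (hq.imp hp)).of_eq fun _ => propext iff_iff_implies_and_implies.symm

theorem comp_primrecRel {r : β → γ → Prop} (hr : PrimrecRel r) {f : α → β} {g : α → γ}
    (hf : ComputableIn O f) (hg : ComputableIn O g) : ComputableIn O fun a => r (f a) (g a) :=
  comp (f := fun x : β × γ => r x.1 x.2) (of_primrecPred hr) (hf.pair hg)

@[fun_prop]
theorem eq {f g : α → β} (hf : ComputableIn O f) (hg : ComputableIn O g) :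
    ComputableIn O fun a => f a = g a :=
  comp_primrecRel Primrec.eq hf hg

@[fun_prop]
theorem nat_lt {f g : α → ℕ} (hf : ComputableIn O f) (hg : ComputableIn O g) :
    ComputableIn O fun a => f a < g a :=
  comp_primrecRel Primrec.nat_lt hf hg

@[fun_prop]
theorem nat_le {f g : α → ℕ} (hf : ComputableIn O f) (hg : ComputableIn O g) :
    ComputableIn O fun a => f a ≤ g a :=
  comp_primrecRel Primrec.nat_le hf hg

@[fun_prop]
theorem nat_add {f g : α → ℕ} (hf : ComputableIn O f) (hg : ComputableIn O g) :
    ComputableIn O fun a => f a + g a :=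
  comp₂ Primrec.nat_add.computableIn₂ hf hg

@[fun_prop]
theorem nat_mul {f g : α → ℕ} (hf : ComputableIn O f) (hg : ComputableIn O g) :
    ComputableIn O fun a => f a * g a :=
  comp₂ Primrec.nat_mul.computableIn₂ hf hg

@[fun_prop]
theorem nat_pair {f g : α → ℕ} (hf : ComputableIn O f) (hg : ComputableIn O g) :
    ComputableIn O fun a => Nat.pair (f a) (g a) :=
  comp₂ Primrec₂.natPair.computableIn₂ hf hg

@[fun_prop]
theorem nat_unpair {f : α → ℕ} (hf : ComputableIn O f) : ComputableIn O fun a => (f a).unpair :=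
  ComputableIn.unpair.comp hf

@[fun_prop]
theorem list_length {f : α → List β} (hf : ComputableIn O f) :
    ComputableIn O fun a => (f a).length :=
  Primrec.list_length.computableIn.comp hf

@[fun_prop]
theorem list_append {f g : α → List β} (hf : ComputableIn O f) (hg : ComputableIn O g) :
    ComputableIn O fun a => f a ++ g a :=
  comp₂ Primrec.list_append.computableIn₂ hf hg

@[fun_prop]
theorem list_cons {f : α → β} {g : α → List β} (hf : ComputableIn O f) (hg : ComputableIn O g) :
    ComputableIn O fun a => f a :: g a :=
  comp₂ Primrec.list_cons.computableIn₂ hf hg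

@[fun_prop]
theorem list_reverse {f : α → List β} (hf : ComputableIn O f) :
    ComputableIn O fun a => (f a).reverse :=
  Primrec.list_reverse.computableIn.comp hf

@[fun_prop]
theorem list_take {f : α → ℕ} {g : α → List β} (hf : ComputableIn O f) (hg : ComputableIn O g) :
    ComputableIn O fun a => (g a).take (f a) :=
  comp₂ Primrec.list_take.computableIn₂ hf hg

@[fun_prop]
theorem list_getElem? {f : α → ℕ} {g : α → List β} (hf : ComputableIn O f)
    (hg : ComputableIn O g) : ComputableIn O fun a => (g a)[f a]? :=
  comp₂ Primrec.list_getElem?.computableIn₂ hg hf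

@[fun_prop]
theorem list_isPrefix {f g : α → List β} (hf : ComputableIn O f) (hg : ComputableIn O g) :
    ComputableIn O fun a => f a <+: g a :=
  of_eq (f := fun a => f a = (g a).take (f a).length) (by fun_prop)
    fun _ => propext List.prefix_iff_eq_take.symm

@[fun_prop]
theorem option_some {f : α → β} (hf : ComputableIn O f) : ComputableIn O fun a => some (f a) :=
  Primrec.option_some.computableIn.comp hf

@[fun_prop]
theorem option_getD {f : α → Option β} {g : α → β} (hf : ComputableIn O f)
    (hg : ComputableIn O g) : ComputableIn O fun a => (f a).getD (g a) :=
  comp₂ Primrec.option_getD.computableIn₂ hf hg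

@[fun_prop]
theorem encode {f : α → β} (hf : ComputableIn O f) : ComputableIn O fun a => encode (f a) :=
  Primrec.encode.computableIn.comp hf

@[fun_prop]
theorem decode {f : α → ℕ} (hf : ComputableIn O f) :
    ComputableIn O fun a => (decode (f a) : Option β) :=
  Primrec.decode.computableIn.comp hf

open Classical in
@[fun_prop]
theorem ite {c : α → Prop} {f g : α → σ} (hc : ComputableIn O c)
    (hf : ComputableIn O f) (hg : ComputableIn O g) :
    ComputableIn O fun a => if c a then f a else g a :=
  (hc.decide_prop.bool_cond hf hg).of_eq fun a => by
    by_cases h : c a <;> simp [h]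

theorem forall_lt {p : α → ℕ → Prop} (hp : ComputableIn O fun x : α × ℕ => p x.1 x.2) :
    ComputableIn O fun x : α × ℕ => ∀ n < x.2, p x.1 n := by
  have := nat_rec (α := α × ℕ) (σ := Prop) (f := fun x => x.2) (g := fun _ => True)
    (h := fun x n s => s ∧ p x.1 n) (O := O) (by fun_prop) (by fun_prop)
    (.and (by fun_prop) (.comp hp (by fun_prop : ComputableIn O
      fun x : (α × ℕ) × ℕ × Prop => (x.1.1, x.2.1))))
  refine this.of_eq fun x => ?_
  rcases x with ⟨a, n⟩
  induction n with
  | zero => simp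
  | succ n ih => simp only [ih, Nat.lt_succ_iff_lt_or_eq, or_imp, forall_and, forall_eq]

theorem exists_lt {p : α → ℕ → Prop} (hp : ComputableIn O fun x : α × ℕ => p x.1 x.2) :
    ComputableIn O fun x : α × ℕ => ∃ n < x.2, p x.1 n :=
  (forall_lt (p := fun a n => ¬ p a n) hp.not).not.of_eq fun x => by simp

/-- Unbounded search. -/
theorem exists_find {p : α → ℕ → Prop} (hp : ComputableIn O fun x : α × ℕ => p x.1 x.2)
    (h : ∀ a, ∃ n, p a n) : ∃ f : α → ℕ, ComputableIn O f ∧ ∀ a, p a (f a) := by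
  classical
  refine ⟨fun a => Nat.find (h a), ?_, fun a => Nat.find_spec (h a)⟩
  have h1 : ComputableIn O fun x : α × ℕ => if p x.1 x.2 then 0 else 1 := by fun_prop
  refine (Nat.RecursiveIn.rfind h1).of_eq fun n => ?_
  rcases e : Encodable.decode (α := α) n with - | a
  · simpa [e] using Nat.rfind_zero_none _ rfl
  · simp only [Part.coe_some, Part.bind_some, Part.map_some, encode_nat]
    refine Part.eq_some_iff.2 (Nat.mem_rfind.2 ⟨?_, fun {m} hm => ?_⟩)
    · simp [e, Nat.find_spec (h a)]
    · simp [e, Nat.find_min (h a) hm]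

end ComputableIn

/-- The predicate `p` is recursively enumerable relative to `O`. -/
def REIn (O : Set (ℕ →. ℕ)) (p : α → Prop) : Prop :=
  ∃ q : α → ℕ → Prop, ComputableIn O (fun x : α × ℕ => q x.1 x.2) ∧ ∀ a, p a ↔ ∃ n, q a n

/-! ### Relatively recursively enumerable predicates -/

namespace REIn

theorem of_iff {p q : α → Prop} (hp : REIn O p) (h : ∀ a, q a ↔ p a) : REIn O q :=
  (funext fun a => propext (h a) : q = p) ▸ hp

theorem of_computableIn {p : α → Prop} (hp : ComputableIn O p) : REIn O p :=
  ⟨fun a _ => p a, by fun_prop, fun a => by simp⟩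

theorem comp {p : β → Prop} {f : α → β} (hp : REIn O p) (hf : ComputableIn O f) :
    REIn O fun a => p (f a) := by
  obtain ⟨q, hq, h⟩ := hp
  refine ⟨fun a n => q (f a) n, ?_, fun a => h _⟩
  exact .comp hq (by fun_prop : ComputableIn O fun x : α × ℕ => (f x.1, x.2))

theorem exists_nat {p : α → ℕ → Prop} (hp : REIn O fun x : α × ℕ => p x.1 x.2) :
    REIn O fun a => ∃ n, p a n := by
  obtain ⟨q, hq, h⟩ := hp
  refine ⟨fun a n => q (a, n.unpair.1) n.unpair.2, ?_, fun a => ?_⟩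
  · exact .comp hq (by fun_prop : ComputableIn O
      fun x : α × ℕ => ((x.1, x.2.unpair.1), x.2.unpair.2))
  · constructor
    · rintro ⟨n, hn⟩
      obtain ⟨k, hk⟩ := (h (a, n)).1 hn
      exact ⟨Nat.pair n k, by simpa using hk⟩
    · rintro ⟨n, hn⟩
      exact ⟨_, (h (a, n.unpair.1)).2 ⟨_, hn⟩⟩

theorem exists_decode_getD (b₀ b : β) : ∃ n, ((decode n : Option β).getD b₀) = b :=
  ⟨encode b, by simp⟩

theorem exists_of {p : α → β → Prop} (hp : REIn O fun x : α × β => p x.1 x.2) :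
    REIn O fun a => ∃ b, p a b := by
  rcases isEmpty_or_nonempty β with hβ | ⟨⟨b₀⟩⟩
  · exact (of_computableIn (ComputableIn.const False)).of_iff fun a => by simp
  · refine (exists_nat (p := fun a n => p a ((decode n : Option β).getD b₀)) ?_).of_iff ?_
    · exact hp.comp (by fun_prop : ComputableIn O
        fun x : α × ℕ => (x.1, (decode x.2 : Option β).getD b₀))
    · refine fun a => ⟨fun ⟨b, hb⟩ => ?_, fun ⟨n, hn⟩ => ⟨_, hn⟩⟩
      obtain ⟨n, rfl⟩ := exists_decode_getD b₀ b
      exact ⟨n, hb⟩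

theorem and {p q : α → Prop} (hp : REIn O p) (hq : REIn O q) : REIn O fun a => p a ∧ q a := by
  obtain ⟨p', hp', h₁⟩ := hp
  obtain ⟨q', hq', h₂⟩ := hq
  refine of_iff (exists_nat (p := fun a n => ∃ m, p' a n ∧ q' a m) (exists_nat
    (p := fun (x : α × ℕ) m => p' x.1 x.2 ∧ q' x.1 m) (of_computableIn ?_)))
    (fun a => by simp [h₁, h₂])
  exact .and (.comp hp' .fst) (.comp hq' (by fun_prop : ComputableIn O
      fun x : (α × ℕ) × ℕ => (x.1.1, x.2)))

theorem or {p q : α → Prop} (hp : REIn O p) (hq : REIn O q) : REIn O fun a => p a ∨ q a := by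
  obtain ⟨p', hp', h₁⟩ := hp
  obtain ⟨q', hq', h₂⟩ := hq
  exact ⟨fun a n => p' a n ∨ q' a n, hp'.or hq', fun a => by simp [h₁, h₂, exists_or]⟩

/-- Σ₁ bounding: finitely many witnesses have a common bound B, so the bounded universal quantifier
can be moved inside the existential one. -/
theorem forall_lt {p : α → ℕ → Prop} (hp : REIn O fun x : α × ℕ => p x.1 x.2) :
    REIn O fun x : α × ℕ => ∀ n < x.2, p x.1 n := by
  obtain ⟨q, hq, h⟩ := hp
  refine ⟨fun x B => ∀ n < x.2, ∃ w < B, q (x.1, n) w, ?_, fun x => ?_⟩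
  · have h₁ : ComputableIn O fun y : (α × ℕ) × ℕ => ((y.1.1, y.2), y.1.2) := by fun_prop
    have h₂ := (ComputableIn.exists_lt (p := q) hq).comp h₁
    have h₃ := (ComputableIn.forall_lt (p := fun (y : α × ℕ) n => ∃ w < y.2, q (y.1, n) w) h₂).comp h₁
    exact h₃
  · have h' : ∀ n, p x.1 n ↔ ∃ w, q (x.1, n) w := fun n => h (x.1, n)
    simp only [h']
    refine ⟨fun H => ?_, fun ⟨B, H⟩ n hn => (H n hn).imp fun _ hw => hw.2⟩
    choose! f hf using H
    refine ⟨(Finset.range x.2).sup f + 1, fun n hn => ⟨f n, ?_, hf n hn⟩⟩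
    exact Nat.lt_succ_of_le (Finset.le_sup (Finset.mem_range.2 hn))

/-- Uniformization of a total recursively enumerable relation. -/
theorem exists_computableIn [hβ : Nonempty β] {p : α → β → Prop}
    (hp : REIn O fun x : α × β => p x.1 x.2) (h : ∀ a, ∃ b, p a b) :
    ∃ f : α → β, ComputableIn O f ∧ ∀ a, p a (f a) := by
  obtain ⟨q, hq, hpq⟩ := hp
  obtain ⟨b₀⟩ := hβ
  let r : ℕ → β := fun n => (Encodable.decode n.unpair.1 : Option β).getD b₀
  obtain ⟨f, hf, hf'⟩ := ComputableIn.exists_find (O := O)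
    (p := fun a n => q (a, r n) n.unpair.2)
    (.comp hq (by fun_prop : ComputableIn O
      fun x : α × ℕ => ((x.1, r x.2), x.2.unpair.2))) fun a => by
    obtain ⟨b, hb⟩ := h a
    obtain ⟨k, hk⟩ := (hpq (a, b)).1 hb
    exact ⟨Nat.pair (Encodable.encode b) k, by simpa [r] using hk⟩
  exact ⟨fun a => r (f a), by fun_prop, fun a => (hpq (a, _)).2 ⟨_, hf' a⟩⟩

/-- Post's theorem. -/
theorem computableIn {p : α → Prop} (hp : REIn O p) (hn : REIn O fun a => ¬ p a) :
    ComputableIn O p := by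
  obtain ⟨f, hf, hf'⟩ := exists_computableIn (O := O)
    (p := fun a (b : Bool) => (p a ∧ b = true) ∨ (¬ p a ∧ b = false))
    (.or (.and (hp.comp .fst) (of_computableIn (by fun_prop)))
      (.and (hn.comp .fst) (of_computableIn (by fun_prop))))
    fun a => by by_cases h : p a <;> simp [h]
  refine (ComputableIn.eq_true hf).of_eq fun a => ?_
  rcases hf' a with ⟨h₁, h₂⟩ | ⟨h₁, h₂⟩ <;> simp [h₁, h₂]

/-- A nonempty recursively enumerable set is the range of a computable function. -/
theorem exists_range_eq {p : α → Prop} (hp : REIn O p) (h : ∃ a, p a) :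
    ∃ f : ℕ → α, ComputableIn O f ∧ (∀ n, p (f n)) ∧ ∀ a, p a → ∃ n, f n = a := by
  classical
  obtain ⟨q, hq, hpq⟩ := hp
  obtain ⟨a₀, ha₀⟩ := h
  let r : ℕ → α := fun n => (Encodable.decode n.unpair.1 : Option α).getD a₀
  refine ⟨fun n => if q (r n) n.unpair.2 then r n else a₀, ?_, fun n => ?_, fun a ha => ?_⟩
  · refine .ite (.comp hq (by fun_prop : ComputableIn O
      fun n : ℕ => (r n, n.unpair.2))) (by fun_prop) (by fun_prop)
  · dsimp only
    split_ifs with h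
    · exact (hpq _).2 ⟨_, h⟩
    · exact ha₀
  · obtain ⟨k, hk⟩ := (hpq a).1 ha
    exact ⟨Nat.pair (Encodable.encode a) k, by simp [r, hk]⟩

/-- The witness is a number of steps: bounded evaluation `evaln` is primitive recursive. -/
theorem mem_of_partrec {f : α →. β} (hf : Partrec f) :
    REIn O fun x : α × β => x.2 ∈ f x.1 := by
  obtain ⟨c, hc⟩ := Nat.Partrec.Code.exists_code.1 hf
  refine ⟨fun x k => Nat.Partrec.Code.evaln k c (Encodable.encode x.1) =
    some (Encodable.encode x.2), ?_, fun x => ?_⟩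
  · refine .eq (Primrec.computableIn ?_) (by fun_prop)
    exact Nat.Partrec.Code.primrec_evaln.comp (((Primrec.snd).pair (.const c)).pair
      (Primrec.encode.comp (.comp .fst .fst)))
  · have := Nat.Partrec.Code.evaln_complete (c := c) (n := Encodable.encode x.1)
      (x := Encodable.encode x.2)
    simp only [Option.mem_def] at this
    rw [← this, hc]
    simp [Encodable.encode_inj]

end REIn

end RelativeComputability

/-! ### The use principle -/

section Functionals

open Encodable
open scoped Computability

/-- The use principle: a function recursive in `g` is given by a partial recursive functional on
finite approximations of `g`. -/
theorem TuringReducible.exists_functional {α : Type*} [Primcodable α] {le : α → α → Prop}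
    {query : α → ℕ → Option ℕ} (hq : Computable₂ query)
    (hmono : ∀ c d, le c d → ∀ x y, query c x = some y → query d x = some y)
    {G : Set α} (hG : DirectedOn le G) (hne : G.Nonempty) {f g : ℕ →. ℕ}
    (hg : ∀ x y, y ∈ g x ↔ ∃ c ∈ G, query c x = some y) (hf : f ≤ᵀ g) :
    ∃ F : α → ℕ →. ℕ, Partrec₂ F ∧ (∀ c d, le c d → ∀ x y, y ∈ F c x → y ∈ F d x) ∧
      ∀ x y, y ∈ f x ↔ ∃ c ∈ G, y ∈ F c x := by
  have key : ∀ h : ℕ → ℕ, Primrec h → ∃ F : α → ℕ →. ℕ, Partrec₂ F ∧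
      (∀ c d, le c d → ∀ x y, y ∈ F c x → y ∈ F d x) ∧
      ∀ x y, y ∈ (h : ℕ →. ℕ) x ↔ ∃ c ∈ G, y ∈ F c x := by
    refine fun h hh => ⟨fun _ => h, (hh.to_comp.comp .snd).partrec, fun _ _ _ _ _ h => h, ?_⟩
    exact fun x y => ⟨fun h => hne.imp fun c hc => ⟨hc, h⟩, fun ⟨_, _, h⟩ => h⟩
  -- Directedness of `G` lets two computations with different finite uses be run on a single
  -- approximation.
  have both : ∀ {P Q : α → Prop}, (∀ c d, le c d → P c → P d) → (∀ c d, le c d → Q c → Q d) →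
      (∃ c ∈ G, P c) → (∃ c ∈ G, Q c) → ∃ c ∈ G, P c ∧ Q c := by
    rintro P Q hP hQ ⟨c, hc, hPc⟩ ⟨d, hd, hQd⟩
    obtain ⟨e, he, h₁, h₂⟩ := hG c hc d hd
    exact ⟨e, he, hP _ _ h₁ hPc, hQ _ _ h₂ hQd⟩
  rw [TuringReducible, RecursiveIn.iff_nat] at hf
  induction hf with
  | zero => exact key _ (Primrec.const 0)
  | succ => exact key _ Primrec.succ
  | left => exact key _ (Primrec.fst.comp .unpair)
  | right => exact key _ (Primrec.snd.comp .unpair)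
  | oracle g' hg' =>
    obtain rfl : g' = g := hg'
    exact ⟨fun c x => query c x, hq.ofOption, fun c d h x y => by simpa using hmono c d h x y,
      fun x y => by simpa using hg x y⟩
  | @pair f h _ _ ihf ihh =>
    obtain ⟨F, hF, mF, eF⟩ := ihf
    obtain ⟨H, hH, mH, eH⟩ := ihh
    refine ⟨fun c x => (F c x).bind fun a => (H c x).map (Nat.pair a), ?_, ?_, ?_⟩
    · refine Partrec.bind hF (Partrec.map (hH.comp (.comp .fst .fst) (.comp .snd .fst)) ?_)
      exact Primrec₂.natPair.to_comp.comp (.comp .snd .fst) .snd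
    · intro c d hcd x y
      simp only [Part.mem_bind_iff, Part.mem_map_iff]
      rintro ⟨a, ha, b, hb, rfl⟩
      exact ⟨a, mF _ _ hcd _ _ ha, b, mH _ _ hcd _ _ hb, rfl⟩
    · intro x y
      simp only [Seq.seq, Part.map_eq_map, Part.mem_bind_iff, Part.mem_map_iff,
        exists_exists_and_eq_and, eF, eH]
      constructor
      · rintro ⟨a, ha, b, hb, rfl⟩
        obtain ⟨c, hc, h₁, h₂⟩ := both (fun c d h => mF c d h x a) (fun c d h => mH c d h x b) ha hb
        exact ⟨c, hc, a, h₁, b, h₂, rfl⟩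
      · rintro ⟨c, hc, a, ha, b, hb, rfl⟩
        exact ⟨a, ⟨c, hc, ha⟩, b, ⟨c, hc, hb⟩, rfl⟩
  | @comp f h _ _ ihf ihh =>
    obtain ⟨F, hF, mF, eF⟩ := ihf
    obtain ⟨H, hH, mH, eH⟩ := ihh
    refine ⟨fun c x => (H c x).bind fun a => F c a, ?_, ?_, ?_⟩
    · exact Partrec.bind hH (hF.comp (.comp .fst .fst) .snd)
    · intro c d hcd x y
      simp only [Part.mem_bind_iff]
      rintro ⟨a, ha, hb⟩
      exact ⟨a, mH _ _ hcd _ _ ha, mF _ _ hcd _ _ hb⟩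
    · intro x y
      change (y ∈ (h x).bind fun a => f a) ↔ _
      simp only [Part.mem_bind_iff, eF, eH]
      constructor
      · rintro ⟨a, ha, hb⟩
        obtain ⟨c, hc, h₁, h₂⟩ := both (fun c d h => mH c d h x a) (fun c d h => mF c d h a y) ha hb
        exact ⟨c, hc, a, h₁, h₂⟩
      · rintro ⟨c, hc, a, ha, hb⟩
        exact ⟨a, ⟨c, hc, ha⟩, ⟨c, hc, hb⟩⟩
  | @prec f h _ _ ihf ihh =>
    obtain ⟨F, hF, mF, eF⟩ := ihf
    obtain ⟨H, hH, mH, eH⟩ := ihh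
    let R : α → ℕ → ℕ →. ℕ := fun c a n =>
      Nat.rec (F c a) (fun y IH => IH.bind fun i => H c (Nat.pair a (Nat.pair y i))) n
    have mR : ∀ c d, le c d → ∀ a n y, y ∈ R c a n → y ∈ R d a n := by
      intro c d hcd a n
      induction n with
      | zero => exact mF c d hcd a
      | succ n ih =>
        intro y
        simp only [R, Part.mem_bind_iff]
        exact fun ⟨i, hi, hy⟩ => ⟨i, ih i hi, mH c d hcd _ _ hy⟩
    refine ⟨fun c x => R c x.unpair.1 x.unpair.2, ?_, fun c d h x y => mR c d h _ _ y, ?_⟩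
    · have hu₁ : Computable fun x : α × ℕ => x.2.unpair.1 :=
        (Primrec.fst.comp (Primrec.unpair.comp .snd)).to_comp
      have hu₂ : Computable fun x : α × ℕ => x.2.unpair.2 :=
        (Primrec.snd.comp (Primrec.unpair.comp .snd)).to_comp
      refine Partrec.nat_rec (h := fun x s => H x.1 (Nat.pair x.2.unpair.1 (Nat.pair s.1 s.2)))
        hu₂ (hF.comp .fst hu₁) (hH.comp (.comp .fst .fst) ?_)
      exact Primrec₂.natPair.to_comp.comp (hu₁.comp .fst)
        (Primrec₂.natPair.to_comp.comp (.comp .fst .snd) (.comp .snd .snd))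
    · intro x y
      simp only
      generalize x.unpair.1 = a
      generalize x.unpair.2 = n
      induction n generalizing y with
      | zero => exact eF a y
      | succ n ih =>
        simp only [R, Part.bind_eq_bind, Part.mem_bind_iff] at ih ⊢
        constructor
        · rintro ⟨i, hi, hy⟩
          obtain ⟨c, hc, h₁, h₂⟩ := both (fun c d h => mR c d h a n i)
            (fun c d h => mH c d h _ y) ((ih i).1 hi) ((eH _ _).1 hy)
          exact ⟨c, hc, i, h₁, h₂⟩
        · rintro ⟨c, hc, i, hi, hy⟩
          exact ⟨i, (ih i).2 ⟨c, hc, hi⟩, (eH _ _).2 ⟨c, hc, hy⟩⟩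
  | @rfind f _ ihf =>
    obtain ⟨F, hF, mF, eF⟩ := ihf
    have mr : ∀ (f : ℕ →. ℕ) (x y : ℕ),
        (y ∈ Nat.rfind fun n => (f (Nat.pair x n)).map fun m => decide (m = 0)) ↔
        (∃ b ∈ f (Nat.pair x y), decide (b = 0) = true) ∧
          ∀ m < y, ∃ b ∈ f (Nat.pair x m), decide (b = 0) = false := fun f x y => by
      refine Nat.mem_rfind.trans (and_congr (Part.mem_map_iff _) ?_)
      exact forall₂_congr fun m _ => Part.mem_map_iff _
    refine ⟨fun c x => Nat.rfind fun n => (F c (Nat.pair x n)).map fun m => decide (m = 0),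
      ?_, ?_, ?_⟩
    · refine Partrec.rfind (Partrec.map (hF.comp (.comp .fst .fst) ?_) ?_)
      · exact Primrec₂.natPair.to_comp.comp (.comp .snd .fst) .snd
      · exact (Primrec.eq.comp Primrec.id (Primrec.const 0)).decide.to_comp.comp .snd
    · intro c d hcd x y
      rw [mr (F c), mr (F d)]
      exact fun ⟨⟨a, ha, ha'⟩, h⟩ => ⟨⟨a, mF _ _ hcd _ _ ha, ha'⟩, fun m hm =>
        (h m hm).imp fun b hb => ⟨mF _ _ hcd _ _ hb.1, hb.2⟩⟩
    · intro x y
      -- Minimization looks at all arguments below the result; their finitely many uses are merged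
      -- one by one.
      have fin : ∀ n, (∀ m < n, ∃ c ∈ G, ∃ b ∈ F c (Nat.pair x m), decide (b = 0) = false) →
          ∃ c ∈ G, ∀ m < n, ∃ b ∈ F c (Nat.pair x m), decide (b = 0) = false := by
        intro n
        induction n with
        | zero => exact fun _ => hne.imp fun c hc => ⟨hc, by simp⟩
        | succ n ih =>
          intro h
          obtain ⟨c, hc, h₁, h₂⟩ := both (fun c d h h' m hm =>
            (h' m hm).imp fun b hb => ⟨mF c d h _ _ hb.1, hb.2⟩)
            (fun c d h h' => h'.imp fun b hb => ⟨mF c d h _ _ hb.1, hb.2⟩)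
            (ih fun m hm => h m (by omega)) (h n (by omega))
          refine ⟨c, hc, fun m hm => ?_⟩
          rcases Nat.lt_succ_iff_lt_or_eq.1 hm with hm | rfl
          exacts [h₁ m hm, h₂]
      refine (mr f x y).trans ?_
      simp only [mr (F _), eF]
      constructor
      · rintro ⟨⟨a, ⟨c₀, hc₀, ha⟩, ha'⟩, h⟩
        obtain ⟨c, hc, h₁, h₂⟩ := both (P := fun c => ∃ a ∈ F c (Nat.pair x y), decide (a = 0) = true)
          (fun c d h h' => h'.imp fun b hb => ⟨mF c d h _ _ hb.1, hb.2⟩)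
          (fun c d h h' m hm => (h' m hm).imp fun b hb => ⟨mF c d h _ _ hb.1, hb.2⟩)
          ⟨c₀, hc₀, a, ha, ha'⟩ (fin y fun m hm => by
            obtain ⟨b, ⟨c, hc, hb⟩, hb'⟩ := h m hm
            exact ⟨c, hc, b, hb, hb'⟩)
        exact ⟨c, hc, h₁, h₂⟩
      · rintro ⟨c, hc, ⟨a, ha, ha'⟩, h⟩
        exact ⟨⟨a, ⟨c, hc, ha⟩, ha'⟩, fun m hm => (h m hm).imp fun b hb => ⟨⟨c, hc, hb.1⟩, hb.2⟩⟩

end Functionals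

namespace Pointed

open Encodable
open scoped Computability

/-! ## Characteristic functions -/

theorem char_reducible_iff {A : Set ℕ} {g : ℕ →. ℕ} :
    char A ≤ᵀ g ↔ ComputableIn {g} fun n => n ∈ A := by
  classical
  have h₁ : char A ≤ᵀ g ↔ ComputableIn {g} fun n => if n ∈ A then 1 else 0 := by
    unfold char ComputableIn TuringReducible
    refine iff_of_eq (congrArg _ (funext fun n => ?_))
    congr
  rw [h₁]
  refine ⟨fun h => ?_, fun h => .ite h (by fun_prop) (by fun_prop)⟩
  refine ComputableIn.of_eq (f := fun n => (if n ∈ A then 1 else 0) = 1) (.eq h (by fun_prop))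
    fun n => ?_
  by_cases hn : n ∈ A <;> simp [hn]

theorem computableIn_mem (Y : Set ℕ) : ComputableIn {char Y} fun n => n ∈ Y :=
  char_reducible_iff.1 (.refl _)

theorem fun_reducible_iff {x : ℕ → ℕ} {g : ℕ →. ℕ} :
    (x : ℕ →. ℕ) ≤ᵀ g ↔ ComputableIn {g} x := Iff.rfl

theorem _root_.ComputableIn.trans {α β : Type*} [Primcodable α] [Primcodable β] {f : α → β}
    {g h : ℕ →. ℕ} (hf : ComputableIn {g} f) (hg : g ≤ᵀ h) : ComputableIn {h} f :=
  RecursiveIn.subst hf (by simpa using hg)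

/-! ## Arithmetical predicates -/

/-- For a projection, `f` is applied to the first component only, the second one being the witness;
hence the induction is over all `f`. -/
theorem ArithIn.preimage {Y A : Set ℕ} (hA : ArithIn Y A) {f : ℕ → ℕ}
    (hf : ComputableIn {char Y} f) : ArithIn Y {n | f n ∈ A} := by
  induction hA generalizing f with
  | of_recursive h =>
    exact .of_recursive (char_reducible_iff.2 ((char_reducible_iff.1 h).comp hf))
  | compl _ ih => exact .compl (ih hf)
  | inter _ _ ih₁ ih₂ => exact .inter (ih₁ hf) (ih₂ hf)
  | proj _ ih =>
    have := (ih (f := fun n => Nat.pair (f n.unpair.1) n.unpair.2) (by fun_prop)).proj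
    simpa using this

theorem ArithIn.mono {Y Z A : Set ℕ} (hA : ArithIn Y A) (h : char Y ≤ᵀ char Z) : ArithIn Z A := by
  induction hA with
  | of_recursive h' => exact .of_recursive (h'.trans h)
  | compl _ ih => exact .compl ih
  | inter _ _ ih₁ ih₂ => exact .inter ih₁ ih₂
  | proj _ ih => exact .proj ih

section ArithPred

variable {α β : Type*} [Primcodable α] [Primcodable β] {Y : Set ℕ}

/-- The predicate `p` is arithmetical in `Y`. -/
def ArithPred (Y : Set ℕ) (p : α → Prop) : Prop :=
  ∃ A, ArithIn Y A ∧ ∀ a, p a ↔ encode a ∈ A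

namespace ArithPred

theorem mono {Z : Set ℕ} {p : α → Prop} (hp : ArithPred Y p) (h : char Y ≤ᵀ char Z) :
    ArithPred Z p := by
  obtain ⟨A, hA, h'⟩ := hp
  exact ⟨A, hA.mono h, h'⟩

theorem of_iff {p q : α → Prop} (hp : ArithPred Y p) (h : ∀ a, q a ↔ p a) : ArithPred Y q :=
  (funext fun a => propext (h a) : q = p) ▸ hp

theorem not {p : α → Prop} (hp : ArithPred Y p) : ArithPred Y fun a => ¬ p a := by
  obtain ⟨A, hA, h⟩ := hp
  exact ⟨Aᶜ, hA.compl, fun a => by simp [h]⟩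

theorem and {p q : α → Prop} (hp : ArithPred Y p) (hq : ArithPred Y q) :
    ArithPred Y fun a => p a ∧ q a := by
  obtain ⟨A, hA, h⟩ := hp
  obtain ⟨B, hB, h'⟩ := hq
  exact ⟨A ∩ B, hA.inter hB, fun a => by simp [h, h']⟩

theorem or {p q : α → Prop} (hp : ArithPred Y p) (hq : ArithPred Y q) :
    ArithPred Y fun a => p a ∨ q a :=
  (hp.not.and hq.not).not.of_iff fun a => by tauto

theorem comp {p : β → Prop} {f : α → β} (hp : ArithPred Y p)
    (hf : ComputableIn {char Y} f) : ArithPred Y fun a => p (f a) := by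
  rcases isEmpty_or_nonempty α with hα | ⟨⟨a₀⟩⟩
  · exact ⟨∅, .of_recursive (char_reducible_iff.2 (.const False)), fun a => hα.elim a⟩
  obtain ⟨A, hA, h⟩ := hp
  refine ⟨_, hA.preimage (f := fun n => encode (f ((decode n : Option α).getD a₀))) (by fun_prop),
    fun a => ?_⟩
  simp [h]

theorem of_computableIn {p : α → Prop} (hp : ComputableIn {char Y} p) : ArithPred Y p := by
  rcases isEmpty_or_nonempty α with hα | ⟨⟨a₀⟩⟩
  · exact ⟨∅, .of_recursive (char_reducible_iff.2 (.const False)), fun a => hα.elim a⟩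
  refine ⟨{n | p ((decode n : Option α).getD a₀)}, .of_recursive (char_reducible_iff.2 ?_), ?_⟩
  · exact hp.comp (g := fun n => (decode n : Option α).getD a₀) (by fun_prop)
  · simp

theorem exists_of {p : α → β → Prop} (hp : ArithPred Y fun x : α × β => p x.1 x.2) :
    ArithPred Y fun a => ∃ b, p a b := by
  rcases isEmpty_or_nonempty β with hβ | ⟨⟨b₀⟩⟩
  · exact (of_computableIn (ComputableIn.const False)).of_iff fun a => by simp
  obtain ⟨A, hA, h⟩ := hp.comp (f := fun x : α × ℕ => (x.1, (decode x.2 : Option β).getD b₀))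
    (by fun_prop)
  refine ⟨_, hA.proj, fun a => ?_⟩
  have : ∀ n, p a ((decode n : Option β).getD b₀) ↔ Nat.pair (encode a) n ∈ A := fun n => h (a, n)
  simp only [Set.mem_ofPred_eq, ← this]
  refine ⟨fun ⟨b, hb⟩ => ?_, fun ⟨n, hn⟩ => ⟨_, hn⟩⟩
  obtain ⟨n, rfl⟩ := REIn.exists_decode_getD b₀ b
  exact ⟨n, hb⟩

theorem of_reIn {p : α → Prop} (hp : REIn {char Y} p) : ArithPred Y p := by
  obtain ⟨q, hq, h⟩ := hp
  exact (exists_of (of_computableIn hq)).of_iff h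

theorem arithIn {p : α → Prop} (hp : ArithPred Y p) : ArithIn Y (encode '' {a | p a}) := by
  obtain ⟨A, hA, h⟩ := hp
  -- `A` is arbitrary away from codes, so it has to be cut down to them.
  have : ArithIn Y (Set.range (encode : α → ℕ)) :=
    .of_recursive (char_reducible_iff.2 (.of_primrecPred Primcodable.mem_range_encode))
  convert! hA.inter this using 1
  ext n
  simp only [Set.mem_image, Set.mem_ofPred_eq, h, Set.mem_inter_iff, Set.mem_range]
  constructor
  · rintro ⟨a, ha, rfl⟩
    exact ⟨ha, a, rfl⟩
  · rintro ⟨ha, a, rfl⟩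
    exact ⟨a, ha, rfl⟩

end ArithPred

end ArithPred

/-! ## Initial segments -/

section InitSeg

variable {α : Type} {x : ℕ → α}

@[simp] theorem length_initSeg (x : ℕ → α) (n : ℕ) : (initSeg x n).length = n := by
  simp [initSeg]

theorem getElem?_initSeg (x : ℕ → α) (n i : ℕ) :
    (initSeg x n)[i]? = if i < n then some (x i) else none := by
  simp only [initSeg, List.getElem?_map]
  split_ifs with h <;> simp [h]

theorem initSeg_succ (x : ℕ → α) (n : ℕ) : initSeg x (n + 1) = initSeg x n ++ [x n] := by
  simp [initSeg, List.range_succ]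

theorem initSeg_prefix (x : ℕ → α) {m n : ℕ} (h : m ≤ n) : initSeg x m <+: initSeg x n := by
  induction n, h using Nat.le_induction with
  | base => exact List.prefix_rfl
  | succ n _ ih => exact ih.trans (initSeg_succ x n ▸ List.prefix_append _ _)

/-- `σ` is an initial segment of `x`. -/
def IsInit (x : ℕ → α) (σ : List α) : Prop := ∀ i v, σ[i]? = some v → x i = v

theorem isInit_initSeg (x : ℕ → α) (n : ℕ) : IsInit x (initSeg x n) := by
  intro i v h
  rw [getElem?_initSeg] at h
  split_ifs at h
  simpa using h

theorem IsInit.eq_initSeg {σ : List α} (h : IsInit x σ) : σ = initSeg x σ.length := by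
  refine List.ext_getElem? fun i => ?_
  rw [getElem?_initSeg]
  split_ifs with hi
  · rw [List.getElem?_eq_getElem hi, h i _ (List.getElem?_eq_getElem hi)]
  · simpa using hi

theorem IsInit.prefix_of_le {σ τ : List α} (hσ : IsInit x σ) (hτ : IsInit x τ)
    (h : σ.length ≤ τ.length) : σ <+: τ := by
  rw [hσ.eq_initSeg, hτ.eq_initSeg]
  exact initSeg_prefix x h

theorem IsInit.of_prefix {σ τ : List α} (hτ : IsInit x τ) (h : σ <+: τ) : IsInit x σ := by
  obtain ⟨ρ, rfl⟩ := h
  intro i v hv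
  refine hτ i v ?_
  rw [List.getElem?_append_left (List.getElem?_eq_some_iff.1 hv).1, hv]

theorem isInit_nil : IsInit x [] := by simp [IsInit]

theorem getElem?_of_prefix {σ τ : List α} (h : σ <+: τ) {i : ℕ} {v : α} (hv : σ[i]? = some v) :
    τ[i]? = some v := by
  obtain ⟨ρ, rfl⟩ := h
  rw [List.getElem?_append_left (List.getElem?_eq_some_iff.1 hv).1, hv]

end InitSeg

/-! ## Conditions -/

/-- The `i`-th coordinate of a tuple of finite sequences. -/
def coord (l : List (List Bool)) (i : ℕ) : List Bool := l[i]?.getD []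

/-- The tuple `d` extends the tuple `c`. -/
def Extends (c d : List (List Bool)) : Prop :=
  c.length = d.length ∧ ∀ i < c.length, coord c i <+: coord d i

/-- The coordinates of `c` are initial segments of `g 0, g 1, …`. -/
def Approx (g : ℕ → ℕ → Bool) (c : List (List Bool)) : Prop := ∀ i, IsInit (g i) (coord c i)

theorem coord_of_length_le {c : List (List Bool)} {i : ℕ} (h : c.length ≤ i) : coord c i = [] := by
  simp [coord, h]

theorem coord_append_left {c d : List (List Bool)} {i : ℕ} (h : i < c.length) :
    coord (c ++ d) i = coord c i := by
  simp [coord, List.getElem?_append_left h]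

theorem coord_append_right (c d : List (List Bool)) (i : ℕ) :
    coord (c ++ d) (c.length + i) = coord d i := by
  simp [coord, List.getElem?_append_right]

theorem Extends.prefix {c d : List (List Bool)} (h : Extends c d) (i : ℕ) :
    coord c i <+: coord d i := by
  rcases lt_or_ge i c.length with hi | hi
  · exact h.2 i hi
  · rw [coord_of_length_le hi]
    exact List.nil_prefix

theorem Extends.refl (c : List (List Bool)) : Extends c c := ⟨rfl, fun _ _ => List.prefix_rfl⟩

theorem Extends.trans {c d e : List (List Bool)} (h : Extends c d) (h' : Extends d e) :
    Extends c e :=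
  ⟨h.1.trans h'.1, fun i _ => (h.prefix i).trans (h'.prefix i)⟩

theorem Extends.append {a a' c c' : List (List Bool)} (h : Extends a a') (h' : Extends c c') :
    Extends (a ++ c) (a' ++ c') := by
  refine ⟨by simp [h.1, h'.1], fun i _ => ?_⟩
  rcases lt_or_ge i a.length with hi | hi
  · rw [coord_append_left hi, coord_append_left (h.1 ▸ hi)]
    exact h.prefix i
  · obtain ⟨j, rfl⟩ := Nat.exists_eq_add_of_le hi
    rw [coord_append_right, h.1, coord_append_right]
    exact h'.prefix j

theorem approx_append {g : ℕ → ℕ → Bool} {a c : List (List Bool)} :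
    Approx g (a ++ c) ↔ Approx g a ∧ Approx (fun i => g (a.length + i)) c := by
  constructor
  · refine fun h => ⟨fun i => ?_, fun i => coord_append_right a c i ▸ h (a.length + i)⟩
    rcases lt_or_ge i a.length with hi | hi
    · exact coord_append_left hi ▸ h i
    · exact coord_of_length_le hi ▸ isInit_nil
  · rintro ⟨h, h'⟩ i
    rcases lt_or_ge i a.length with hi | hi
    · rw [coord_append_left hi]
      exact h i
    · obtain ⟨j, rfl⟩ := Nat.exists_eq_add_of_le hi
      rw [coord_append_right]
      exact h' j

/-- The tuple of the initial segments of length `n` of `g 0, …, g (k - 1)`. -/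
def approxSeg (g : ℕ → ℕ → Bool) (k n : ℕ) : List (List Bool) :=
  (List.range k).map fun i => initSeg (g i) n

theorem coord_approxSeg {g : ℕ → ℕ → Bool} {k n i : ℕ} (hi : i < k) :
    coord (approxSeg g k n) i = initSeg (g i) n := by
  simp [coord, approxSeg, hi]

@[simp] theorem length_approxSeg (g : ℕ → ℕ → Bool) (k n : ℕ) :
    (approxSeg g k n).length = k := by simp [approxSeg]

theorem approx_approxSeg (g : ℕ → ℕ → Bool) (k n : ℕ) : Approx g (approxSeg g k n) := by
  intro i
  rcases lt_or_ge i k with hi | hi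
  · exact coord_approxSeg hi ▸ isInit_initSeg _ _
  · rw [coord_of_length_le (by simpa using hi)]
    exact isInit_nil

/-- This is the directedness needed for the use principle: a tuple of sufficiently long initial
segments extends both. -/
theorem Approx.exists_extends {g : ℕ → ℕ → Bool} {c d : List (List Bool)} (hc : Approx g c)
    (hd : Approx g d) (h : c.length = d.length) :
    ∃ e, Approx g e ∧ Extends c e ∧ Extends d e := by
  obtain ⟨n, hn⟩ : ∃ n, ∀ i < c.length, (coord c i).length ≤ n ∧ (coord d i).length ≤ n := by
    refine ⟨(Finset.range c.length).sup fun i => (coord c i).length + (coord d i).length,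
      fun i hi => ?_⟩
    have := Finset.le_sup (f := fun i => (coord c i).length + (coord d i).length)
      (Finset.mem_range.2 hi)
    omega
  refine ⟨approxSeg g c.length n, approx_approxSeg _ _ _, ⟨by simp, fun i hi => ?_⟩,
    ⟨by simp [h], fun i hi => ?_⟩⟩
  · rw [coord_approxSeg hi]
    exact (hc i).prefix_of_le (isInit_initSeg _ _) (by simpa using (hn i hi).1)
  · rw [coord_approxSeg (h ▸ hi)]
    exact (hd i).prefix_of_le (isInit_initSeg _ _) (by simpa using (hn i (h ▸ hi)).2)

/-! ## Finite joins -/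

/-- The join `g 0 ⊕ ⋯ ⊕ g (k - 1)`. -/
def joinBelow (g : ℕ → ℕ → Bool) (k : ℕ) : Set ℕ :=
  {p | p.unpair.1 < k ∧ g p.unpair.1 p.unpair.2 = true}

theorem join_eq_joinBelow (g : ℕ → ℕ → Bool) (n : ℕ) : join g n = joinBelow g (n + 1) := by
  ext p
  constructor
  · rintro ⟨i, m, hi, h, rfl⟩
    simpa [joinBelow, h] using Nat.lt_succ_of_le hi
  · rintro ⟨hi, h⟩
    exact ⟨_, _, Nat.le_of_lt_succ hi, h, by simp⟩

theorem joinBelow_zero (g : ℕ → ℕ → Bool) : joinBelow g 0 = ∅ := by simp [joinBelow]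

theorem joinBelow_mono (g : ℕ → ℕ → Bool) {k l : ℕ} (h : k ≤ l) :
    char (joinBelow g k) ≤ᵀ char (joinBelow g l) := by
  refine char_reducible_iff.2 (ComputableIn.of_eq
    (f := fun p => p.unpair.1 < k ∧ p ∈ joinBelow g l) ?_ fun p => ?_)
  · exact .and (by fun_prop) (computableIn_mem _)
  · simp only [joinBelow, Set.mem_ofPred_eq, eq_iff_iff]
    constructor
    · exact fun h => ⟨h.1, h.2.2⟩
    · exact fun h' => ⟨h'.1, h'.1.trans_le h, h'.2⟩

/-- Counting the columns instead of naming the last one makes the case of g_0 an instance of the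
general one, the join of no columns being empty. -/
theorem isGenericSeq_iff {g : ℕ → ℕ → Bool} :
    IsGenericSeq g ↔ ∀ k, IsArithGeneric (joinBelow g k) (g k) := by
  simp only [IsGenericSeq, join_eq_joinBelow]
  constructor
  · rintro ⟨h₀, h⟩ (_ | k)
    · rwa [joinBelow_zero]
    · exact h k
  · exact fun h => ⟨joinBelow_zero g ▸ h 0, fun n => h (n + 1)⟩

section

variable {α : Type*} [Primcodable α] {O : Set (ℕ →. ℕ)}

@[fun_prop]
theorem _root_.ComputableIn.coord {f : α → List (List Bool)} {h : α → ℕ}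
    (hf : ComputableIn O f) (hh : ComputableIn O h) :
    ComputableIn O fun a => coord (f a) (h a) := by
  unfold Pointed.coord
  fun_prop

theorem _root_.ComputableIn.extends {f h : α → List (List Bool)}
    (hf : ComputableIn O f) (hh : ComputableIn O h) :
    ComputableIn O fun a => Extends (f a) (h a) := by
  have h₁ := (ComputableIn.forall_lt (O := O)
    (p := fun (x : List (List Bool) × List (List Bool)) i => Pointed.coord x.1 i <+: Pointed.coord x.2 i)
    (by fun_prop)).comp (g := fun a => ((f a, h a), (f a).length)) (by fun_prop)
  exact .and (by fun_prop) h₁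

end

/-- Only finitely many bits are compared with the oracle. The offset `s` covers both approximations
to a whole join (`s = 0`) and those to a later block of columns. -/
theorem computableIn_approx (g : ℕ → ℕ → Bool) (s r : ℕ) :
    ComputableIn {char (joinBelow g (s + r))} fun c : List (List Bool) =>
      c.length = r ∧ Approx (fun i => g (s + i)) c := by
  set O : Set (ℕ →. ℕ) := {char (joinBelow g (s + r))}
  have h₀ : ComputableIn O fun x : (List (List Bool) × ℕ) × ℕ =>
      (coord x.1.1 x.1.2)[x.2]? = some true ↔ Nat.pair (s + x.1.2) x.2 ∈ joinBelow g (s + r) :=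
    .iff (by fun_prop) ((computableIn_mem (joinBelow g (s + r))).comp
      (g := fun x : (List (List Bool) × ℕ) × ℕ => Nat.pair (s + x.1.2) x.2) (by fun_prop))
  have h₁ := (ComputableIn.forall_lt (p := fun (x : List (List Bool) × ℕ) j =>
    (coord x.1 x.2)[j]? = some true ↔ Nat.pair (s + x.2) j ∈ joinBelow g (s + r)) h₀).comp
    (g := fun x : List (List Bool) × ℕ => (x, (coord x.1 x.2).length)) (by fun_prop)
  have h₂ := (ComputableIn.forall_lt (p := fun (c : List (List Bool)) i =>
    ∀ j < (coord c i).length,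
    ((coord c i)[j]? = some true ↔ Nat.pair (s + i) j ∈ joinBelow g (s + r))) h₁).comp
    (g := fun c => (c, c.length)) (by fun_prop)
  refine ComputableIn.of_eq (ComputableIn.and (p := fun c => c.length = r) (by fun_prop) h₂)
    fun c => propext (and_congr_right fun hr => ?_)
  have hmem : ∀ i < c.length, ∀ j, Nat.pair (s + i) j ∈ joinBelow g (s + r) ↔
      g (s + i) j = true := by
    intro i hi j
    simp only [joinBelow, Set.mem_ofPred_eq, Nat.unpair_pair, and_iff_right_iff_imp]
    omega
  constructor
  · intro h i j v hv
    have hj := (List.getElem?_eq_some_iff.1 hv).1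
    have hi : i < c.length := by
      by_contra hi
      simp [coord_of_length_le (not_lt.1 hi)] at hj
    have := h i hi j hj
    rw [hmem i hi, hv] at this
    rcases v <;> simpa using this
  · intro h i hi j hj
    have := h i j _ (List.getElem?_eq_getElem hj)
    rw [hmem i hi, List.getElem?_eq_getElem hj, ← this]
    simp

end Pointed

namespace Pointed

open Encodable
open scoped Computability

/-! ## The use principle for finite joins -/

theorem exists_functional_joinBelow {g : ℕ → ℕ → Bool} {k : ℕ} {f : ℕ →. ℕ}
    (hf : f ≤ᵀ char (joinBelow g k)) :
    ∃ F : List (List Bool) → ℕ →. ℕ, Partrec₂ F ∧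
      (∀ c d, Extends c d → ∀ x y, y ∈ F c x → y ∈ F d x) ∧
      ∀ x y, y ∈ f x ↔ ∃ c, (c.length = k ∧ Approx g c) ∧ y ∈ F c x := by
  classical
  -- A column outside the tuple contributes nothing to the join, so the answer there is 0; a bit
  -- beyond the end of a column in the tuple is still unknown.
  let query : List (List Bool) → ℕ → Option ℕ := fun c p =>
    if p.unpair.1 < c.length then
      if (coord c p.unpair.1)[p.unpair.2]? = some true then some 1
      else if (coord c p.unpair.1)[p.unpair.2]? = some false then some 0 else none
    else some 0
  have hq : ComputableIn ∅ fun x : List (List Bool) × ℕ => query x.1 x.2 := by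
    have h := ComputableIn.ite (O := ∅) (α := List (List Bool) × ℕ)
      (c := fun x => x.2.unpair.1 < x.1.length) (by fun_prop)
      (.ite (c := fun x => (coord x.1 x.2.unpair.1)[x.2.unpair.2]? = some true) (by fun_prop)
        (.const (some 1)) (.ite (c := fun x => (coord x.1 x.2.unpair.1)[x.2.unpair.2]? = some false)
          (by fun_prop) (.const (some 0)) (.const none))) (.const (some 0))
    refine h.of_eq fun x => ?_
    simp only [query]
    split_ifs <;> rfl
  refine TuringReducible.exists_functional (le := Extends) (query := query)
    (hq.partrec_of_forall_mem (by simp)) ?_ (G := {c | c.length = k ∧ Approx g c}) ?_ ?_ ?_ hf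
  · intro c d hcd x y
    have key : ∀ v, (coord c x.unpair.1)[x.unpair.2]? = some v →
        (coord d x.unpair.1)[x.unpair.2]? = some v := fun v hv =>
      getElem?_of_prefix (hcd.prefix _) hv
    simp only [query, ← hcd.1]
    split_ifs with h₁ h₂ h₃ h₄ h₅ h₆ <;> simp_all
  · rintro c ⟨hc, hc'⟩ d ⟨hd, hd'⟩
    obtain ⟨e, he, h₁, h₂⟩ := hc'.exists_extends hd' (hc.trans hd.symm)
    exact ⟨e, ⟨h₁.1 ▸ hc, he⟩, h₁, h₂⟩
  · exact ⟨approxSeg g k 0, by simp, approx_approxSeg _ _ _⟩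
  · intro x y
    have h₁ : y ∈ char (joinBelow g k) x ↔ y = if x ∈ joinBelow g k then 1 else 0 := by
      simp only [char, Part.mem_some_iff]
    rw [h₁]
    constructor
    · rintro rfl
      refine ⟨approxSeg g k (x.unpair.2 + 1), ⟨by simp, approx_approxSeg _ _ _⟩, ?_⟩
      clear h₁
      by_cases hk : x.unpair.1 < k
      · simp only [query, length_approxSeg, coord_approxSeg hk, getElem?_initSeg, joinBelow,
          Set.mem_ofPred_eq, hk, true_and, if_true, lt_add_one]
        cases g x.unpair.1 x.unpair.2 <;> simp
      · simp [query, joinBelow, hk]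
    · rintro ⟨c, ⟨hc, hc'⟩, h⟩
      have key : ∀ v, (coord c x.unpair.1)[x.unpair.2]? = some v →
        g x.unpair.1 x.unpair.2 = v := fun v hv => hc' _ _ _ hv
      simp only [query, hc] at h
      simp only [joinBelow]
      split_ifs at h with h₂ h₃ h₄ <;> simp_all

/-- The first `k` columns are taken from the oracle, while the remaining ones are the free finite
condition `x.1`. This is how the forcing arguments work over J_k. -/
theorem reIn_functional (g : ℕ → ℕ → Bool) (k : ℕ) {F : List (List Bool) → ℕ →. ℕ}
    (hF : Partrec₂ F) : REIn {char (joinBelow g k)} fun x : List (List Bool) × ℕ × ℕ =>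
      ∃ a, (a.length = k ∧ Approx g a) ∧ x.2.2 ∈ F (a ++ x.1) x.2.1 := by
  refine REIn.exists_of (p := fun (x : List (List Bool) × ℕ × ℕ) a =>
    (a.length = k ∧ Approx g a) ∧ x.2.2 ∈ F (a ++ x.1) x.2.1) (.and ?_ ?_)
  · have := computableIn_approx g 0 k
    simp only [zero_add] at this
    exact (REIn.of_computableIn this).comp .snd
  · exact (REIn.mem_of_partrec hF).comp
      (f := fun y : (List (List Bool) × ℕ × ℕ) × List (List Bool) =>
        ((y.2 ++ y.1.1, y.1.2.1), y.1.2.2)) (by fun_prop)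

/-! ## No `PA` degrees -/

/-- Induction on the number of generics: adding one generic cannot create a 0-1-valued diagonally
noncomputable function, because such a function could already be found by searching below a suitable
initial segment of the generic. -/
theorem not_diagonally_noncomputable {g : ℕ → ℕ → Bool}
    (hg : ∀ k, IsArithGeneric (joinBelow g k) (g k)) (k : ℕ) (z : ℕ → ℕ)
    (hz : ComputableIn {char (joinBelow g k)} z) (h01 : ∀ e, z e ≤ 1) :
    ¬ ∀ e, z e ∉ (Denumerable.ofNat Nat.Partrec.Code e).eval e := by
  intro hdnc
  induction k generalizing z with
  | zero =>
    have hz' : Computable z := hz.partrec_of_forall_mem fun f hf => by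
      obtain rfl := Set.mem_singleton_iff.1 hf
      have h := ComputableIn.const (O := ∅) (α := ℕ) False
      have h' := char_reducible_iff (A := joinBelow g 0) (g := fun _ => Part.none)
      refine TuringReducible.partrec_of_const (h'.2 ?_)
      rw [joinBelow_zero]
      exact .const False
    -- At an index of `z` itself, `z` agrees with the diagonal.
    obtain ⟨c, hc⟩ := Nat.Partrec.Code.exists_code.1 (Partrec.nat_iff.1 hz')
    exact hdnc (encode c) (by simp [hc])
  | succ k ih =>
    obtain ⟨F, hF, mF, eF⟩ := exists_functional_joinBelow hz
    simp only [Part.mem_some_iff] at eF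
    have hR := reIn_functional g k hF
    let R : List Bool → ℕ → ℕ → Prop := fun σ e w =>
      ∃ a, (a.length = k ∧ Approx g a) ∧ w ∈ F (a ++ [σ]) e
    have hR' : REIn {char (joinBelow g k)} fun x : List Bool × ℕ × ℕ => R x.1 x.2.1 x.2.2 :=
      hR.comp (f := fun x : List Bool × ℕ × ℕ => ([x.1], x.2)) (by fun_prop)
    have hev : REIn {char (joinBelow g k)} fun x : List Bool × ℕ × ℕ =>
        x.2.2 ∈ (Denumerable.ofNat Nat.Partrec.Code x.2.1).eval x.2.1 := by
      have h₁ : Partrec fun e : ℕ => (Denumerable.ofNat Nat.Partrec.Code e).eval e :=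
        Nat.Partrec.Code.eval_part.comp (Computable.ofNat _) Computable.id
      exact (REIn.mem_of_partrec h₁).comp (f := fun x : List Bool × ℕ × ℕ => x.2) (by fun_prop)
    -- The strings that make the reduction produce a forbidden value: one equal to the diagonal, or
    -- one other than 0 and 1.
    have hD : REIn {char (joinBelow g k)} fun σ => ∃ x : ℕ × ℕ, R σ x.1 x.2 ∧
        (x.2 ∈ (Denumerable.ofNat Nat.Partrec.Code x.1).eval x.1 ∨ 1 < x.2) :=
      REIn.exists_of (.and hR' (.or hev (.of_computableIn (by fun_prop))))
    have hRz : ∀ n e w, R (initSeg (g k) n) e w → w = z e := by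
      rintro n e w ⟨a, ⟨ha, ha'⟩, hw⟩
      refine ((eF e w).2 ⟨a ++ [initSeg (g k) n], ⟨by simp [ha], approx_append.2 ⟨ha', ?_⟩⟩, hw⟩)
      rintro (_ | i)
      · simpa [coord, ha] using isInit_initSeg _ _
      · rw [coord_of_length_le (by simp)]
        exact isInit_nil
    -- True values appear along arbitrarily long initial segments of g_k, hence beyond any given
    -- one; so the search below always succeeds.
    have hzR : ∀ e n, ∃ m, n ≤ m ∧ R (initSeg (g k) m) e (z e) := by
      intro e n
      obtain ⟨c, ⟨hc, hc'⟩, h⟩ := (eF e (z e)).1 rfl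
      refine ⟨max n (coord c k).length, le_max_left _ _, approxSeg g k
        ((Finset.range k).sup fun i => (coord c i).length), ⟨by simp, approx_approxSeg _ _ _⟩,
        mF c _ ⟨by simp [hc], fun i hi => ?_⟩ _ _ h⟩
      rcases Nat.lt_succ_iff_lt_or_eq.1 (hc ▸ hi) with hi | rfl
      · rw [coord_append_left (by simpa using hi), coord_approxSeg hi]
        exact (hc' i).prefix_of_le (isInit_initSeg _ _) (by
          simpa using Finset.le_sup (f := fun i => (coord c i).length) (Finset.mem_range.2 hi))
      · have := coord_append_right (approxSeg g i ((Finset.range i).sup fun i =>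
          (coord c i).length)) [initSeg (g i) (max n (coord c i).length)] 0
        simp only [length_approxSeg, add_zero] at this
        rw [this]
        exact (hc' i).prefix_of_le (by simpa [coord] using isInit_initSeg _ _) (by simp [coord])
    obtain ⟨n, hn⟩ := hg k _ (ArithPred.of_reIn hD).arithIn
    rcases hn with ⟨⟨e, w⟩, h₁, h₂⟩ | hn
    · dsimp only at h₁ h₂
      obtain rfl : w = z e := hRz _ _ _ h₁
      rcases h₂ with h₂ | h₂
      · exact hdnc _ h₂
      · exact absurd (h01 e) (not_le.2 h₂)
    -- Different arguments may be answered by incompatible extensions. This is harmless, as no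
    -- extension gives a forbidden value.
    · have hext : REIn {char (joinBelow g k)} fun x : ℕ × ℕ =>
          ∃ σ, initSeg (g k) n <+: σ ∧ R σ x.1 x.2 :=
        REIn.exists_of (p := fun (x : ℕ × ℕ) σ => initSeg (g k) n <+: σ ∧ R σ x.1 x.2)
          (.and (.of_computableIn (by fun_prop)) (hR'.comp
            (f := fun x : (ℕ × ℕ) × List Bool => (x.2, x.1)) (by fun_prop)))
      obtain ⟨z', hz', h'⟩ := hext.exists_computableIn (p := fun e w =>
        ∃ σ, initSeg (g k) n <+: σ ∧ R σ e w) fun e => by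
          obtain ⟨m, hm, h⟩ := hzR e n
          exact ⟨z e, _, initSeg_prefix _ hm, h⟩
      refine ih z' hz' (fun e => ?_) fun e he => ?_
      · obtain ⟨σ, hσ, h⟩ := h' e
        by_contra hlt
        exact hn σ hσ ⟨(e, z' e), h, .inr (not_le.1 hlt)⟩
      · obtain ⟨σ, hσ, h⟩ := h' e
        exact hn σ hσ ⟨(e, z' e), h, .inl he⟩

/-! ## Product genericity -/

/-- The usual argument for iterated genericity, with `D` arithmetical in J_k only. First the last
coordinate, generic over all earlier ones, decides whether `D` can be met by true approximations to
these. If not, the set of tuples that could still reach `D` above the segment found is arithmetical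
in J_k, and the induction hypothesis decides it. -/
theorem IsArithGeneric.prod {g : ℕ → ℕ → Bool} (hg : ∀ k, IsArithGeneric (joinBelow g k) (g k))
    (k r : ℕ) {D : List (List Bool) → Prop} (hD : ArithPred (joinBelow g k) D) :
    ∃ p, p.length = r ∧ Approx (fun i => g (k + i)) p ∧ (D p ∨ ∀ q, Extends p q → ¬ D q) := by
  induction r generalizing D with
  | zero =>
    refine ⟨[], rfl, fun i => by rw [coord_of_length_le (by simp)]; exact isInit_nil, ?_⟩
    by_cases h : D []
    · exact .inl h
    · refine .inr fun q hq => ?_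
      rwa [List.eq_nil_of_length_eq_zero hq.1.symm]
  | succ r ih =>
    have hap : ∀ (c : List (List Bool)) (τ : List Bool), c.length = r →
        Approx (fun i => g (k + i)) c → IsInit (g (k + r)) τ →
        Approx (fun i => g (k + i)) (c ++ [τ]) := by
      refine fun c τ hc hc' hτ => approx_append.2 ⟨hc', ?_⟩
      rintro (_ | i)
      · simpa [coord, hc] using hτ
      · rw [coord_of_length_le (by simp)]
        exact isInit_nil
    have hD₁ : ArithPred (joinBelow g (k + r)) fun τ => ∃ c : List (List Bool),
        (c.length = r ∧ Approx (fun i => g (k + i)) c) ∧ D (c ++ [τ]) :=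
      .exists_of (p := fun (τ : List Bool) (c : List (List Bool)) =>
        (c.length = r ∧ Approx (fun i => g (k + i)) c) ∧ D (c ++ [τ])) (.and
        ((ArithPred.of_computableIn (computableIn_approx g k r)).comp .snd)
        ((hD.mono (joinBelow_mono g (by omega))).comp
          (f := fun x : List Bool × List (List Bool) => x.2 ++ [x.1]) (by fun_prop)))
    obtain ⟨n, hn | hn⟩ := hg (k + r) _ hD₁.arithIn
    · obtain ⟨c, ⟨hc, hc'⟩, h⟩ := hn
      exact ⟨c ++ [initSeg (g (k + r)) n], by simp [hc], hap _ _ hc hc' (isInit_initSeg _ _),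
        .inl h⟩
    · have hD₂ : ArithPred (joinBelow g k) fun c => ∃ τ,
          initSeg (g (k + r)) n <+: τ ∧ D (c ++ [τ]) :=
        .exists_of (p := fun (c : List (List Bool)) τ =>
          initSeg (g (k + r)) n <+: τ ∧ D (c ++ [τ])) (.and
          (.of_computableIn (by fun_prop)) (hD.comp
            (f := fun x : List (List Bool) × List Bool => x.1 ++ [x.2]) (by fun_prop)))
      obtain ⟨p, hp, hp', h | h⟩ := ih hD₂
      · obtain ⟨τ, hτ, h⟩ := h
        -- `p` consists of true initial segments, so `τ` would be an excluded extension.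
        exact absurd ⟨p, ⟨hp, hp'⟩, h⟩ (hn τ hτ)
      · refine ⟨p ++ [initSeg (g (k + r)) n], by simp [hp], hap _ _ hp hp' (isInit_initSeg _ _),
          .inr fun q hq hqD => ?_⟩
        have hlen : q.length = r + 1 := by simpa [hp] using hq.1.symm
        obtain ⟨c, τ, rfl⟩ : ∃ c τ, q = c ++ [τ] :=
          ⟨q.dropLast, q.getLast (List.ne_nil_of_length_pos (by omega)),
            (List.dropLast_append_getLast _).symm⟩
        have hc : c.length = r := by simpa using hlen
        refine h c ⟨hp.trans hc.symm, fun i hi => ?_⟩ ⟨τ, ?_, hqD⟩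
        · have := hq.prefix i
          rwa [coord_append_left hi, coord_append_left (by omega)] at this
        · have := hq.prefix r
          have h₁ := coord_append_right p [initSeg (g (k + r)) n] 0
          have h₂ := coord_append_right c [τ] 0
          rw [add_zero, hp] at h₁
          rw [add_zero, hc] at h₂
          rw [h₁, h₂] at this
          simpa [coord] using this

end Pointed

namespace Pointed

open Encodable
open scoped Computability

/-! ## Perfect subtrees of recursively enumerable trees -/

theorem computableIn_testBit {O : Set (ℕ →. ℕ)} :
    ComputableIn O fun x : ℕ × ℕ => x.1.testBit x.2 = true := by
  have h₁ := ComputableIn.nat_rec (O := O) (α := ℕ × ℕ) (f := Prod.snd) (g := fun _ => 1)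
    (h := fun _ _ s => s * 2) (by fun_prop) (by fun_prop) (by fun_prop)
  have h₂ : ∀ n : ℕ, (Nat.rec 1 (fun _ s => s * 2) n : ℕ) = 2 ^ n := fun n => by
    induction n with
    | zero => rfl
    | succ n ih => rw [pow_succ, ← ih]
  simp only [h₂] at h₁
  have h₃ := ComputableIn.comp₂ Primrec.nat_mod.computableIn₂ (ComputableIn.comp₂
    Primrec.nat_div.computableIn₂ .fst h₁) (.const 2)
  refine (h₃.eq (.const 1)).of_eq fun x => ?_
  simp [Nat.testBit_eq_decide_div_mod_eq]

theorem computableIn_two_pow {O : Set (ℕ →. ℕ)} : ComputableIn O fun n : ℕ => 2 ^ n := by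
  have h₁ := ComputableIn.nat_rec (O := O) (α := ℕ) (f := id) (g := fun _ => 1)
    (h := fun _ _ s => s * 2) (by fun_prop) (by fun_prop) (by fun_prop)
  refine h₁.of_eq fun n => ?_
  simp only [id]
  induction n with
  | zero => rfl
  | succ n ih => rw [pow_succ, ← ih]

/-- An r.e. set of strings with splittings contains a full binary tree of chosen nodes, found by
search. Downward closure is still decidable because the nodes of level k have length at least k.
`Good k` is imposed at level k + 1, which every path passes. -/
theorem exists_perfect_subtree {O : Set (ℕ →. ℕ)} {V : List ℕ → Prop} {Good : ℕ → List ℕ → Prop}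
    (hV : REIn O V) (hne : ∃ v, V v) (hGood : REIn O fun x : ℕ × List ℕ => Good x.1 x.2)
    (split : ∀ v, V v → ∀ k, ∃ v₀ v₁, V v₀ ∧ V v₁ ∧ v <+: v₀ ∧ v <+: v₁ ∧ ¬ v₀ <+: v₁ ∧
      ¬ v₁ <+: v₀ ∧ k < v₀.length ∧ k < v₁.length ∧ Good k v₀ ∧ Good k v₁) :
    ∃ S : Set (List ℕ), IsTree S ∧ IsPerfect S ∧ (∀ τ ∈ S, ∃ v, V v ∧ τ <+: v) ∧
      ComputableIn O (fun τ => τ ∈ S) ∧ ∀ z ∈ paths S, ∀ k, ∃ l, Good k (initSeg z l) := by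
  obtain ⟨e, he, heV, hVe⟩ := hV.exists_range_eq hne
  obtain ⟨nx, hnx, hnx'⟩ := REIn.exists_computableIn (O := O) (α := ℕ × ℕ) (β := ℕ × ℕ)
    (p := fun x y => (e x.1 <+: e y.1 ∧ e x.1 <+: e y.2 ∧ ¬ e y.1 <+: e y.2 ∧
      ¬ e y.2 <+: e y.1 ∧ x.2 < (e y.1).length ∧ x.2 < (e y.2).length) ∧
      Good x.2 (e y.1) ∧ Good x.2 (e y.2))
    (.and (.of_computableIn (by fun_prop)) (.and
      (hGood.comp (f := fun z : (ℕ × ℕ) × (ℕ × ℕ) => (z.1.2, e z.2.1)) (by fun_prop))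
      (hGood.comp (f := fun z : (ℕ × ℕ) × (ℕ × ℕ) => (z.1.2, e z.2.2)) (by fun_prop))))
    fun x => by
      obtain ⟨v₀, v₁, h₀, h₁, h⟩ := split _ (heV x.1) x.2
      obtain ⟨n₀, rfl⟩ := hVe _ h₀
      obtain ⟨n₁, rfl⟩ := hVe _ h₁
      exact ⟨(n₀, n₁), by simp only; tauto⟩
  clear hVe split hGood
  classical
  -- The bits of `n` steer through the binary tree: `st n k` is the index in the enumeration `e` of
  -- the node reached after `k` turns. It depends only on the first `k` bits.
  let st : ℕ → ℕ → ℕ := fun n k => Nat.rec 0 (fun j s =>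
    if n.testBit j = true then (nx (s, j)).2 else (nx (s, j)).1) k
  have hst : ComputableIn O fun x : ℕ × ℕ => st x.1 x.2 := by
    refine ComputableIn.nat_rec (α := ℕ × ℕ) (f := Prod.snd) (g := fun _ => 0)
      (h := fun x j s => if x.1.testBit j = true then (nx (s, j)).2 else (nx (s, j)).1)
      (by fun_prop) (by fun_prop) ?_
    have := ComputableIn.ite (O := O) (α := (ℕ × ℕ) × ℕ × ℕ)
      (c := fun y => y.1.1.testBit y.2.1 = true)
      (f := fun y => (nx (y.2.2, y.2.1)).2) (g := fun y => (nx (y.2.2, y.2.1)).1)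
      (computableIn_testBit.comp (g := fun y : (ℕ × ℕ) × ℕ × ℕ => (y.1.1, y.2.1)) (by fun_prop))
      (by fun_prop) (by fun_prop)
    refine this.of_eq fun y => ?_
    split_ifs <;> rfl
  let v : ℕ → ℕ → List ℕ := fun n k => e (st n k)
  have hv : ComputableIn O fun x : ℕ × ℕ => v x.1 x.2 := he.comp hst
  have hsucc : ∀ n k, v n (k + 1) = if n.testBit k = true then e (nx (st n k, k)).2
      else e (nx (st n k, k)).1 := fun n k => apply_ite e _ _ _
  have hle : ∀ n k, v n k <+: v n (k + 1) := fun n k => by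
    rw [hsucc]
    have := hnx' (st n k, k)
    split_ifs <;> tauto
  have hmono : ∀ n k l, k ≤ l → v n k <+: v n l := fun n k l h => by
    induction l, h using Nat.le_induction with
    | base => exact List.prefix_rfl
    | succ l _ ih => exact ih.trans (hle n l)
  have hgood : ∀ n k, Good k (v n (k + 1)) := fun n k => by
    rw [hsucc]
    have := hnx' (st n k, k)
    split_ifs <;> tauto
  have hlen : ∀ n k, k ≤ (v n k).length := fun n k => by
    rcases k with - | k
    · exact Nat.zero_le _
    · rw [hsucc]
      have := hnx' (st n k, k)
      split_ifs
      · exact this.1.2.2.2.2.2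
      · exact this.1.2.2.2.2.1
  have hbits : ∀ m n k, (∀ j < k, m.testBit j = n.testBit j) → st m k = st n k := by
    intro m n k
    induction k with
    | zero => exact fun _ => rfl
    | succ k ih =>
      intro h
      have ih := ih fun j hj => h j (by omega)
      simp only [st, h k (by omega)] at ih ⊢
      rw [ih]
  have hmod : ∀ n k, v n k = v (n % 2 ^ k) k := fun n k =>
    congrArg e (hbits _ _ _ fun j hj => by simp [Nat.testBit_mod_two_pow, hj])
  let S : Set (List ℕ) := {τ | ∃ n k, τ <+: v n k}
  have hSlen : ∀ τ n k l, τ <+: v n k → τ.length ≤ (v n l).length → τ <+: v n l := by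
    intro τ n k l h hl
    exact List.prefix_of_prefix_length_le (h.trans (hmono n k (max k l) (le_max_left _ _)))
      (hmono n l (max k l) (le_max_right _ _)) hl
  have hSiff : ∀ τ, τ ∈ S ↔ ∃ n < 2 ^ τ.length, τ <+: v n τ.length := by
    refine fun τ => ⟨fun ⟨n, k, h⟩ => ⟨n % 2 ^ τ.length, Nat.mod_lt _ (by positivity), ?_⟩,
      fun ⟨n, _, h⟩ => ⟨n, _, h⟩⟩
    rw [← hmod]
    exact hSlen τ n k _ h (hlen _ _)
  refine ⟨S, fun σ τ h ⟨n, k, h'⟩ => ⟨n, k, h.trans h'⟩, ⟨⟨[], 0, 0, List.nil_prefix⟩, ?_⟩,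
    fun τ ⟨n, k, h⟩ => ⟨_, heV _, h⟩, ?_, ?_⟩
  · rintro τ ⟨n, k, h⟩
    -- Adding 2^k flips bit k and leaves the lower bits alone, so it selects the sibling at level k
    -- + 1; carries to higher bits do not matter.
    have hk : ∀ j < k, (2 ^ k + n).testBit j = n.testBit j := fun j hj =>
      Nat.testBit_two_pow_add_gt hj n
    have h₁ := hsucc n k
    have h₂ := hsucc (2 ^ k + n) k
    rw [hbits _ _ k hk, Nat.testBit_two_pow_add_eq] at h₂
    have h₃ := hnx' (st n k, k)
    refine ⟨v n (k + 1), ⟨n, k + 1, List.prefix_rfl⟩, v (2 ^ k + n) (k + 1),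
      ⟨2 ^ k + n, k + 1, List.prefix_rfl⟩, h.trans (hle n k), ?_⟩
    have h₄ : τ <+: v (2 ^ k + n) (k + 1) := by
      refine h.trans ?_
      have := hle (2 ^ k + n) k
      rwa [show v (2 ^ k + n) k = v n k from congrArg e (hbits _ _ k hk)] at this
    refine ⟨h₄, ?_⟩
    rw [h₁, h₂]
    cases n.testBit k <;> simp <;> tauto
  · have h₁ := (ComputableIn.exists_lt (O := O) (p := fun (τ : List ℕ) n => τ <+: v n τ.length)
      (.list_isPrefix (by fun_prop) (hv.comp (g := fun x : List ℕ × ℕ => (x.2, x.1.length))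
        (by fun_prop)))).comp (g := fun τ => (τ, 2 ^ τ.length))
      (.pair (by fun_prop) (computableIn_two_pow.comp (g := fun τ : List ℕ => τ.length) (by fun_prop)))
    exact h₁.of_eq fun τ => propext (hSiff τ).symm
  · intro z hz k
    -- Level k + 1 is finite, so an initial segment of this length must extend one of its nodes.
    let L := (Finset.range (2 ^ (k + 1))).sup fun n => (v n (k + 1)).length
    have hL : ∀ n, (v n (k + 1)).length ≤ L := fun n => by
      rw [show v n (k + 1) = _ from hmod n (k + 1)]
      exact Finset.le_sup (f := fun n => (v n (k + 1)).length)
        (Finset.mem_range.2 (Nat.mod_lt _ (by positivity)))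
    obtain ⟨n, m, h⟩ := hz L
    have h₁ : v n (k + 1) <+: initSeg z L :=
      List.prefix_of_prefix_length_le (hmono n _ (max m (k + 1)) (le_max_right _ _))
        (h.trans (hmono n _ _ (le_max_left _ _))) (by simpa using hL n)
    have h₂ := ((isInit_initSeg z L).of_prefix h₁).eq_initSeg
    exact ⟨_, h₂ ▸ hgood n k⟩

end Pointed

/-! ### Pointed subtrees by forcing -/

namespace Pointed

open Encodable Filter
open scoped Computability

theorem computableIn_initSeg (x : ℕ → ℕ) :
    ComputableIn {(x : ℕ →. ℕ)} fun n : ℕ => initSeg x n := by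
  have hx : ComputableIn {(x : ℕ →. ℕ)} x := TuringReducible.refl _
  have := ComputableIn.nat_rec (O := {(x : ℕ →. ℕ)}) (α := ℕ) (f := id) (g := fun _ => [])
    (h := fun _ n s => s ++ [x n]) (by fun_prop) (by fun_prop) (by fun_prop)
  refine this.of_eq fun n => ?_
  simp only [id]
  induction n with
  | zero => rfl
  | succ n ih => rw [initSeg_succ, ← ih]

theorem exists_functional_fun {y : ℕ → ℕ} {f : ℕ →. ℕ} (hf : f ≤ᵀ (y : ℕ →. ℕ)) :
    ∃ H : List ℕ → ℕ →. ℕ, Partrec₂ H ∧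
      (∀ σ τ, σ <+: τ → ∀ x w, w ∈ H σ x → w ∈ H τ x) ∧
      ∀ x w, w ∈ f x ↔ ∃ n, w ∈ H (initSeg y n) x := by
  obtain ⟨H, hH, mH, eH⟩ := TuringReducible.exists_functional (le := (· <+: ·))
    (query := fun (σ : List ℕ) n => σ[n]?) Computable.list_getElem?
    (fun σ τ h x w hw => getElem?_of_prefix h hw) (G := Set.range (initSeg y)) (by
      rintro _ ⟨m, rfl⟩ _ ⟨n, rfl⟩
      exact ⟨_, ⟨max m n, rfl⟩, initSeg_prefix _ (le_max_left _ _),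
        initSeg_prefix _ (le_max_right _ _)⟩) ⟨_, 0, rfl⟩ (fun x w => by
      simp only [Set.exists_range_iff, PFun.coe_val, Part.mem_some_iff]
      constructor
      · rintro rfl
        exact ⟨x + 1, by rw [getElem?_initSeg, if_pos (Nat.lt_succ_self x)]⟩
      · rintro ⟨n, hn⟩
        exact (isInit_initSeg y n x w hn).symm) hf
  exact ⟨H, hH, mH, fun x w => by simp [eH]⟩

theorem approxSeg_add (g : ℕ → ℕ → Bool) (k r N : ℕ) :
    approxSeg g (k + r) N = approxSeg g k N ++ approxSeg (fun i => g (k + i)) r N := by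
  simp [approxSeg, List.range_add]

theorem Approx.eventually_extends {g : ℕ → ℕ → Bool} {c : List (List Bool)} (hc : Approx g c) :
    ∀ᶠ N in atTop, Extends c (approxSeg g c.length N) := by
  have : ∀ᶠ N in atTop, ∀ i ∈ Finset.range c.length, (coord c i).length ≤ N :=
    (eventually_all_finset _).2 fun i _ => eventually_ge_atTop _
  filter_upwards [this] with N hN
  refine ⟨by simp, fun i hi => ?_⟩
  rw [coord_approxSeg hi]
  exact (hc i).prefix_of_le (isInit_initSeg _ _) (by simpa using hN i (Finset.mem_range.2 hi))

/-- `F` computes `y` from the generics and `H` computes J_{k+1} from `y`. A condition that forces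
this to work is turned into a tree of possible values of `y`. Coordinate 0 of a condition
approximates g_k; its freedom makes the tree perfect, while the columns below `k` are what its paths
compute. -/
theorem exists_pointed_subtree {g : ℕ → ℕ → Bool}
    (hg : ∀ k, IsArithGeneric (joinBelow g k) (g k)) {T : Set (List ℕ)} (hT : IsTree T) {k r : ℕ}
    (hTk : ComputableIn {char (joinBelow g k)} fun τ => τ ∈ T) {y : ℕ → ℕ} (hyT : y ∈ paths T)
    (hy : (y : ℕ →. ℕ) ≤ᵀ char (joinBelow g (k + (r + 1))))
    (hky : char (joinBelow g (k + 1)) ≤ᵀ (y : ℕ →. ℕ)) :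
    ∃ S ⊆ T, IsTree S ∧ IsPerfect S ∧ ComputableIn {char (joinBelow g k)} (fun τ => τ ∈ S) ∧
      ∀ z ∈ paths S, char (joinBelow g k) ≤ᵀ (z : ℕ →. ℕ) := by
  obtain ⟨F, hF, mF, eF⟩ := exists_functional_joinBelow hy
  obtain ⟨H, hH, mH, eH⟩ := exists_functional_fun hky
  simp only [PFun.coe_val, Part.mem_some_iff] at eF
  have eH' : ∀ x w, (∃ n, w ∈ H (initSeg y n) x) ↔
      (x ∈ joinBelow g (k + 1) ∧ w = 1) ∨ (x ∉ joinBelow g (k + 1) ∧ w = 0) := by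
    intro x w
    rw [← eH]
    by_cases hx : x ∈ joinBelow g (k + 1) <;> simp [char, hx]
  clear eH hky hy
  set O : Set (ℕ →. ℕ) := {char (joinBelow g k)} with hO
  have hJ : ComputableIn O fun n => n ∈ joinBelow g k := computableIn_mem _
  -- values computed from a condition
  let R : List (List Bool) → ℕ → ℕ → Prop := fun q x w =>
    ∃ a, (a.length = k ∧ Approx g a) ∧ w ∈ F (a ++ q) x
  have hR : REIn O fun x : List (List Bool) × ℕ × ℕ => R x.1 x.2.1 x.2.2 := reIn_functional g k hF
  have R_mono : ∀ {q q'}, Extends q q' → ∀ {x w}, R q x w → R q' x w :=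
    fun h _ _ ⟨a, ha, hw⟩ => ⟨a, ha, mF _ _ ((Extends.refl a).append h) _ _ hw⟩
  have R_unique : ∀ {q x w w'}, R q x w → R q x w' → w = w' := by
    rintro q x w w' ⟨a, ⟨ha, ha'⟩, hw⟩ ⟨b, ⟨hb, hb'⟩, hw'⟩
    obtain ⟨e, -, h₁, h₂⟩ := ha'.exists_extends hb' (ha.trans hb.symm)
    exact Part.mem_unique (mF _ _ (h₁.append (Extends.refl q)) _ _ hw)
      (mF _ _ (h₂.append (Extends.refl q)) _ _ hw')
  -- The condition `q` computes the string `v`; the default 0 is never reached.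
  let E : List (List Bool) → List ℕ → Prop := fun q v => ∀ j < v.length, R q j (v[j]?.getD 0)
  have hE : REIn O fun x : List (List Bool) × List ℕ => E x.1 x.2 := by
    have h₁ := hR.comp (f := fun x : (List (List Bool) × List ℕ) × ℕ =>
      (x.1.1, x.2, x.1.2[x.2]?.getD 0)) (by fun_prop)
    exact (REIn.forall_lt (p := fun (x : List (List Bool) × List ℕ) j =>
      R x.1 j (x.2[j]?.getD 0)) h₁).comp (f := fun x => (x, x.2.length)) (by fun_prop)
  have hHre : REIn O fun x : List ℕ × ℕ × ℕ => x.2.2 ∈ H x.1 x.2.1 :=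
    (REIn.mem_of_partrec hH).comp (f := fun x : List ℕ × ℕ × ℕ => ((x.1, x.2.1), x.2.2))
      (by fun_prop)
  -- the three kinds of conditions to be avoided
  let U₁ : List (List Bool) → Prop := fun q => ∃ v, E q v ∧ v ∉ T
  -- The answer `w` about bit `t` is wrong: it contradicts J_k, or it contradicts the part of g_k
  -- that `q` has fixed.
  let Bad : List (List Bool) → ℕ → ℕ → Prop := fun q t w =>
    (t.unpair.1 < k ∧ ((t ∈ joinBelow g k ∧ w ≠ 1) ∨ (t ∉ joinBelow g k ∧ w ≠ 0))) ∨
    (t.unpair.1 = k ∧ (((coord q 0)[t.unpair.2]? = some true ∧ w ≠ 1) ∨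
      ((coord q 0)[t.unpair.2]? = some false ∧ w ≠ 0)))
  let U₂ : List (List Bool) → Prop := fun q =>
    ∃ x : List ℕ × ℕ × ℕ, (E q x.1 ∧ x.2.2 ∈ H x.1 x.2.1) ∧ Bad q x.2.1 x.2.2
  let P : List (List Bool) → ℕ → List (List Bool) × List ℕ → Prop := fun q n x =>
    (Extends q x.1 ∧ n ≤ x.2.length) ∧ E x.1 x.2 ∧ ∀ t < n, ∃ w, w ∈ H x.2 t
  -- This condition is arithmetical in J_k but not given as r.e., which is why more than
  -- 1-genericity is invoked.
  let W : List (List Bool) → Prop := fun q => ∃ n, ¬ ∃ x, P q n x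
  have hU₁ : REIn O U₁ := REIn.exists_of (p := fun q v => E q v ∧ v ∉ T)
    (.and hE (.of_computableIn (.not (hTk.comp .snd))))
  have hU₂ : REIn O U₂ := by
    have hJ' := hJ.comp (g := fun x : List (List Bool) × List ℕ × ℕ × ℕ => x.2.2.1) (by fun_prop)
    refine REIn.exists_of (p := fun q (x : List ℕ × ℕ × ℕ) =>
      (E q x.1 ∧ x.2.2 ∈ H x.1 x.2.1) ∧ Bad q x.2.1 x.2.2) (.and (.and ?_ ?_)
      (.of_computableIn (.or (.and (by fun_prop) (.or (.and hJ' (by fun_prop))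
        (.and hJ'.not (by fun_prop)))) (by fun_prop))))
    · exact hE.comp (f := fun x : List (List Bool) × List ℕ × ℕ × ℕ => (x.1, x.2.1)) (by fun_prop)
    · exact hHre.comp (f := fun x : List (List Bool) × List ℕ × ℕ × ℕ => x.2) (by fun_prop)
  have hW : ArithPred (joinBelow g k) W := by
    refine ArithPred.exists_of (p := fun q n => ¬ ∃ x, P q n x) (.not (.of_reIn
      (REIn.exists_of (p := fun (y : List (List Bool) × ℕ) x => P y.1 y.2 x) ?_)))
    have h₁ : REIn O fun x : List ℕ × ℕ => ∃ w, w ∈ H x.1 x.2 :=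
      REIn.exists_of (p := fun (x : List ℕ × ℕ) w => w ∈ H x.1 x.2)
        (hHre.comp (f := fun x : (List ℕ × ℕ) × ℕ => (x.1.1, x.1.2, x.2)) (by fun_prop))
    have h₂ := REIn.forall_lt (p := fun (v : List ℕ) t => ∃ w, w ∈ H v t) h₁
    refine .and (.of_computableIn (.and ?_ (by fun_prop))) (.and ?_ ?_)
    · exact .extends (by fun_prop) (by fun_prop)
    · exact hE.comp (f := fun x : (List (List Bool) × ℕ) × List (List Bool) × List ℕ => x.2)
        (by fun_prop)
    · exact h₂.comp (f := fun x : (List (List Bool) × ℕ) × List (List Bool) × List ℕ =>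
        (x.2.2, x.1.2)) (by fun_prop)
  obtain ⟨p, hp, hp', hD⟩ := IsArithGeneric.prod hg k (r + 1)
    (((ArithPred.of_reIn hU₁).or (.of_reIn hU₂)).or hW)
  have Ry : ∀ {x w}, R p x w → w = y x := by
    rintro x w ⟨a, ⟨ha, ha'⟩, hw⟩
    exact (eF x w).2 ⟨a ++ p, ⟨by simp [ha, hp], approx_append.2 ⟨ha', by rwa [ha]⟩⟩, hw⟩
  have Ey : ∀ {v}, E p v → v = initSeg y v.length := by
    intro v hv
    refine IsInit.eq_initSeg fun i w hw => ?_
    have := Ry (hv i (List.getElem?_eq_some_iff.1 hw).1)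
    rw [hw] at this
    exact this.symm
  -- A condition made of true initial segments computes only initial segments of `y`, which lie in
  -- `T` and on which `H` is correct; and it can be prolonged along the generics as far as needed.
  -- So `p` itself is in none of the three sets.
  replace hD : ∀ q, Extends p q → ¬ ((U₁ q ∨ U₂ q) ∨ W q) := by
    refine hD.resolve_left ?_
    rintro ((⟨v, hv, hvT⟩ | ⟨⟨v, t, w⟩, ⟨hv, hw⟩, hbad⟩) | ⟨n, hn⟩)
    · rw [Ey hv] at hvT
      exact hvT (hyT _)
    · dsimp only at hv hw hbad
      rw [Ey hv] at hw
      have hw := (eH' t w).1 ⟨_, hw⟩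
      have hcoord := hp' 0
      have hmem : t.unpair.1 ≤ k →
          (t ∈ joinBelow g (k + 1) ↔ g t.unpair.1 t.unpair.2 = true) :=
        fun ht => and_iff_right (Nat.lt_succ_of_le ht)
      rcases hbad with ⟨ht, hbad⟩ | ⟨ht, hbad⟩
      · have hmem' : t ∈ joinBelow g k ↔ g t.unpair.1 t.unpair.2 = true := and_iff_right ht
        rw [hmem ht.le] at hw
        rw [hmem'] at hbad
        tauto
      · rw [hmem ht.le, ht] at hw
        rcases hbad with ⟨hb, hbad⟩ | ⟨hb, hbad⟩
        · have : g k t.unpair.2 = true := hcoord _ _ hb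
          simp only [this, true_and, not_true, false_and, or_false] at hw
          exact hbad hw
        · have : g k t.unpair.2 = false := hcoord _ _ hb
          simp only [this, Bool.false_eq_true, false_and, not_false_eq_true, true_and,
            false_or] at hw
          exact hbad hw
    · have h₁ : ∀ᶠ l in atTop, ∀ t ∈ Finset.range n, ∃ w, w ∈ H (initSeg y l) t := by
        refine (eventually_all_finset _).2 fun t _ => ?_
        obtain ⟨w, l, hl⟩ : ∃ w l, w ∈ H (initSeg y l) t := by
          by_cases ht : t ∈ joinBelow g (k + 1)
          · exact ⟨1, (eH' t 1).2 (.inl ⟨ht, rfl⟩)⟩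
          · exact ⟨0, (eH' t 0).2 (.inr ⟨ht, rfl⟩)⟩
        filter_upwards [eventually_ge_atTop l] with l' hl'
        exact ⟨w, mH _ _ (initSeg_prefix y hl') _ _ hl⟩
      obtain ⟨l, hl, hnl⟩ := (h₁.and (eventually_ge_atTop n)).exists
      -- Sufficiently long initial segments of all the generics compute the first `l` values of `y`.
      have h₂ : ∀ᶠ N in atTop, ∀ j ∈ Finset.range l,
          y j ∈ F (approxSeg g (k + (r + 1)) N) j := by
        refine (eventually_all_finset _).2 fun j _ => ?_
        obtain ⟨c, ⟨hc, hc'⟩, h⟩ := (eF j (y j)).1 rfl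
        filter_upwards [hc'.eventually_extends] with N hN
        exact mF _ _ (hc ▸ hN) _ _ h
      obtain ⟨N, hN, hpN⟩ := (h₂.and hp'.eventually_extends).exists
      refine hn ⟨(approxSeg (fun i => g (k + i)) (r + 1) N, initSeg y l),
        ⟨hp ▸ hpN, by simpa using hnl⟩, fun j hj => ?_, fun t ht => hl t (Finset.mem_range.2 ht)⟩
      have hj : j < l := by simpa using hj
      refine ⟨approxSeg g k N, ⟨by simp, approx_approxSeg _ _ _⟩, ?_⟩
      rw [← approxSeg_add, getElem?_initSeg, if_pos hj]
      exact hN j (Finset.mem_range.2 hj)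
  clear Ry Ey hW hU₁ hU₂ eF eH'
  let V : List ℕ → Prop := fun v => ∃ q, Extends p q ∧ E q v
  have hV : REIn O V := REIn.exists_of (p := fun v q => Extends p q ∧ E q v)
    (.and (.of_computableIn (.extends (by fun_prop) (by fun_prop)))
      (hE.comp (f := fun x : List ℕ × List (List Bool) => (x.2, x.1)) (by fun_prop)))
  -- In the columns from `k` on only definedness is asked for: different nodes must be allowed to
  -- disagree there.
  let Good : ℕ → List ℕ → Prop := fun n v => ∃ w, w ∈ H v n ∧
    ((n ∈ joinBelow g k ∧ w = 1) ∨ (n ∉ joinBelow g k ∧ w = 0) ∨ k ≤ n.unpair.1)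
  have hGood : REIn O fun x : ℕ × List ℕ => Good x.1 x.2 := by
    have hJ' := hJ.comp (g := fun x : (ℕ × List ℕ) × ℕ => x.1.1) (by fun_prop)
    refine REIn.exists_of (p := fun (x : ℕ × List ℕ) w => w ∈ H x.2 x.1 ∧
      ((x.1 ∈ joinBelow g k ∧ w = 1) ∨ (x.1 ∉ joinBelow g k ∧ w = 0) ∨ k ≤ x.1.unpair.1))
      (.and (hHre.comp (f := fun x : (ℕ × List ℕ) × ℕ => (x.1.2, x.1.1, x.2)) (by fun_prop))
        (.of_computableIn (.or (.and hJ' (by fun_prop)) (.or (.and hJ'.not (by fun_prop))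
          (by fun_prop)))))
  obtain ⟨S, hS, hSp, hSV, hSO, hSz⟩ := exists_perfect_subtree hV
    ⟨[], p, Extends.refl p, by simp [E]⟩ hGood (by
      rintro v ⟨q, hpq, hqv⟩ n
      have hq0 : 0 < q.length := by have := hpq.1; omega
      -- The first bit of g_k that `q` leaves open; both values are tried.
      let t₀ := Nat.pair k (coord q 0).length
      have key : ∀ b : Bool, ∃ v', V v' ∧ v <+: v' ∧ n < v'.length ∧ Good n v' ∧
          (bif b then 1 else 0) ∈ H v' t₀ := by
        intro b
        have hc0 : coord (q.set 0 (coord q 0 ++ [b])) 0 = coord q 0 ++ [b] := by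
          simp [coord, hq0]
        have hqb : Extends q (q.set 0 (coord q 0 ++ [b])) := by
          refine ⟨by simp, fun i hi => ?_⟩
          rcases Nat.eq_zero_or_pos i with rfl | hi
          · rw [hc0]
            exact List.prefix_append _ _
          · simp [coord, List.getElem?_set_ne (Nat.ne_of_lt hi)]
        have h₁ := hD _ (hpq.trans hqb)
        simp only [W, not_or, not_exists] at h₁
        push Not at h₁
        -- The bound makes `H v'` defined at `n` and at `t₀`, and `v'` longer than both `n` and `v`.
        obtain ⟨⟨q', v'⟩, ⟨hqq', hlen⟩, hE', hdef⟩ := h₁.2 (n + t₀ + v.length + 1)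
        dsimp only at hqq' hlen hE' hdef
        have h₂ := hD _ ((hpq.trans hqb).trans hqq')
        have h₃ : ∀ {t w}, w ∈ H v' t → ¬ Bad q' t w :=
          fun hw hbad => h₂ (.inl (.inr ⟨(v', _, _), ⟨hE', hw⟩, hbad⟩))
        refine ⟨v', ⟨q', (hpq.trans hqb).trans hqq', hE'⟩, ?_, by omega, ?_, ?_⟩
        -- `q'` extends `q`, so it computes the entries of both `v` and `v'`, and computed values
        -- are unique.
        · refine List.prefix_iff_getElem.2 ⟨by omega, fun i hi => ?_⟩
          have := R_unique (R_mono (hqb.trans hqq') (hqv i hi)) (hE' i (by omega))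
          simpa [List.getElem?_eq_getElem hi,
            List.getElem?_eq_getElem (show i < v'.length by omega)] using this
        · obtain ⟨w, hw⟩ := hdef n (by omega)
          refine ⟨w, hw, ?_⟩
          by_contra hcon
          simp only [not_or, not_and, not_le] at hcon
          by_cases hm : n ∈ joinBelow g k
          · exact h₃ hw (.inl ⟨hcon.2.2, .inl ⟨hm, hcon.1 hm⟩⟩)
          · exact h₃ hw (.inl ⟨hcon.2.2, .inr ⟨hm, hcon.2.1 hm⟩⟩)
        · obtain ⟨w, hw⟩ := hdef t₀ (by omega)
          have h₄ := h₃ hw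
          have h₅ : (coord q' 0)[(coord q 0).length]? = some b :=
            getElem?_of_prefix (hqq'.prefix 0) (by simp [hc0])
          have h₆ : t₀.unpair = (k, (coord q 0).length) := Nat.unpair_pair _ _
          simp only [Bad, h₆, h₅, lt_irrefl, false_and, false_or, true_and] at h₄
          by_cases hwb : w = bif b then 1 else 0
          · exact hwb ▸ hw
          · cases b
            · exact (h₄ (.inr ⟨rfl, hwb⟩)).elim
            · exact (h₄ (.inl ⟨rfl, hwb⟩)).elim
      obtain ⟨v₀, hV₀, hv₀, hn₀, hg₀, hw₀⟩ := key false
      obtain ⟨v₁, hV₁, hv₁, hn₁, hg₁, hw₁⟩ := key true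
      refine ⟨v₀, v₁, hV₀, hV₁, hv₀, hv₁, fun h => ?_, fun h => ?_, hn₀, hn₁, hg₀, hg₁⟩
      -- Compatible strings would give `H` the two values 0 and 1 at `t₀`.
      · simpa using Part.mem_unique (mH _ _ h _ _ hw₀) hw₁
      · simpa using Part.mem_unique (mH _ _ h _ _ hw₁) hw₀)
  refine ⟨S, fun τ hτ => ?_, hS, hSp, hSO, fun z hz => ?_⟩
  · obtain ⟨v, ⟨q, hq, hv⟩, hτv⟩ := hSV τ hτ
    refine hT _ _ hτv ?_
    by_contra hvT
    exact hD q hq (.inl (.inl ⟨v, hv, hvT⟩))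
  · have hval : ∀ w, REIn {(z : ℕ →. ℕ)} fun n => ∃ l, w ∈ H (initSeg z l) n := fun w =>
      REIn.exists_of (p := fun n l => w ∈ H (initSeg z l) n) ((REIn.mem_of_partrec hH).comp
        (f := fun x : ℕ × ℕ => ((initSeg z x.2, x.1), w)) (.pair (.pair
          ((computableIn_initSeg z).comp .snd) .fst) (.const w)))
    have huniq : ∀ {n w w' l l'}, w ∈ H (initSeg z l) n → w' ∈ H (initSeg z l') n → w = w' :=
      fun {n w w' l l'} h h' => Part.mem_unique
        (mH _ _ (initSeg_prefix z (le_max_left l l')) _ _ h)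
        (mH _ _ (initSeg_prefix z (le_max_right l l')) _ _ h')
    -- Membership in J_k and its negation are both r.e. in `z`, read off the value of `H`, with the
    -- columns from `k` on ruled out directly.
    refine char_reducible_iff.2 (REIn.computableIn (((hval 1).and (.of_computableIn
      (by fun_prop : ComputableIn _ fun n : ℕ => n.unpair.1 < k))).of_iff fun n => ?_)
      (((hval 0).or (.of_computableIn
      (by fun_prop : ComputableIn _ fun n : ℕ => ¬ n.unpair.1 < k))).of_iff fun n => ?_))
    · obtain ⟨l, w, hw, h⟩ := hSz z hz n
      constructor
      · intro hn
        have hnk : n.unpair.1 < k := hn.1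
        rcases h with ⟨-, rfl⟩ | ⟨h, -⟩ | h
        · exact ⟨⟨l, hw⟩, hnk⟩
        · exact absurd hn h
        · omega
      · rintro ⟨⟨l', hl'⟩, hnk⟩
        have := huniq hw hl'
        rcases h with ⟨h, -⟩ | ⟨-, rfl⟩ | h
        · exact h
        · omega
        · omega
    · obtain ⟨l, w, hw, h⟩ := hSz z hz n
      constructor
      · intro hn
        rcases h with ⟨h, -⟩ | ⟨h, rfl⟩ | h
        · exact absurd h hn
        · exact .inl ⟨l, hw⟩
        · exact .inr (not_lt.2 h)
      · rintro (⟨l', hl'⟩ | hnk) hn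
        · have := huniq hw hl'
          have hnk : n.unpair.1 < k := hn.1
          rcases h with ⟨-, rfl⟩ | ⟨h, -⟩ | h
          · omega
          · exact h hn
          · omega
        · exact hnk hn.1

end Pointed

namespace Pointed

open Encodable
open scoped Computability

/-! ## Existence of generic sequences -/

/-- By the use principle a set recursive in `Y` is determined by a code of an oracle-free functional
on initial segments of `Y`. -/
theorem countable_setOf_reducible (Y : Set ℕ) : {A : Set ℕ | char A ≤ᵀ char Y}.Countable := by
  classical
  let y : ℕ → ℕ := fun n => if n ∈ Y then 1 else 0
  have hy : char Y = (y : ℕ →. ℕ) := funext fun n => by simp [char, y]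
  refine (Set.countable_range fun c : Nat.Partrec.Code =>
    {x : ℕ | ∃ n, 1 ∈ c.eval (encode (initSeg y n, x))}).mono fun A hA => ?_
  obtain ⟨H, hH, -, eH⟩ := exists_functional_fun (hy ▸ hA : char A ≤ᵀ (y : ℕ →. ℕ))
  obtain ⟨c, hc⟩ := Nat.Partrec.Code.exists_code.1 hH
  refine ⟨c, Set.ext fun x => ?_⟩
  have h₁ : (∃ n, 1 ∈ H (initSeg y n) x) ↔ x ∈ A := by
    rw [← eH]
    by_cases hx : x ∈ A <;> simp [char, hx]
  rw [← h₁]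
  simp [hc]

theorem countable_setOf_arithIn (Y : Set ℕ) : {A : Set ℕ | ArithIn Y A}.Countable := by
  -- Countable stages of the inductive definition: each one adds a single application of the closure
  -- operations.
  let L : ℕ → Set (Set ℕ) := fun n => Nat.rec {A | char A ≤ᵀ char Y} (fun _ L =>
    ((L ∪ compl '' L) ∪ Set.image2 (· ∩ ·) L L) ∪
      (fun A => {x | ∃ y, Nat.pair x y ∈ A}) '' L) n
  have hL : ∀ n, (L n).Countable := fun n => by
    induction n with
    | zero => exact countable_setOf_reducible Y
    | succ n ih => exact ((ih.union (ih.image _)).union (ih.image2 ih _)).union (ih.image _)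
  have hmono : Monotone L := monotone_nat_of_le_succ fun n A hA => .inl (.inl (.inl hA))
  refine (Set.countable_iUnion hL).mono fun A hA => Set.mem_iUnion.2 ?_
  induction hA with
  | of_recursive h => exact ⟨0, h⟩
  | compl _ ih =>
    obtain ⟨n, hn⟩ := ih
    exact ⟨n + 1, .inl (.inl (.inr ⟨_, hn, rfl⟩))⟩
  | inter _ _ ih₁ ih₂ =>
    obtain ⟨m, hm⟩ := ih₁
    obtain ⟨n, hn⟩ := ih₂
    exact ⟨max m n + 1, .inl (.inr ⟨_, hmono (le_max_left m n) hm, _,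
      hmono (le_max_right m n) hn, rfl⟩)⟩
  | proj _ ih =>
    obtain ⟨n, hn⟩ := ih
    exact ⟨n + 1, .inr ⟨_, hn, rfl⟩⟩

theorem exists_isArithGeneric (Y : Set ℕ) : ∃ x, IsArithGeneric Y x := by
  classical
  have hcount : {D : Set (List Bool) | ArithIn Y (encode '' D)}.Countable :=
    Set.MapsTo.countable_of_injOn (f := fun D : Set (List Bool) => encode '' D) (fun _ h => h)
      (Set.image_injective.2 encode_injective).injOn (countable_setOf_arithIn Y)
  have hempty : ArithIn Y (encode '' (∅ : Set (List Bool))) :=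
    .of_recursive (char_reducible_iff.2 ((ComputableIn.const False).of_eq (by simp)))
  obtain ⟨D, hD⟩ := hcount.exists_eq_range ⟨∅, hempty⟩
  -- The extra bit appended in either case only ensures that the strings grow to an infinite
  -- sequence.
  have step : ∀ (σ : List Bool) (n : ℕ), ∃ τ, σ <+: τ ∧ σ.length < τ.length ∧
      ((∃ ρ, ρ <+: τ ∧ ρ ∈ D n) ∨ ∀ ρ, σ <+: ρ → ρ ∉ D n) := by
    intro σ n
    by_cases h : ∃ ρ, σ <+: ρ ∧ ρ ∈ D n
    · obtain ⟨ρ, h₁, h₂⟩ := h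
      exact ⟨ρ ++ [false], h₁.trans (List.prefix_append _ _), by
        simpa using Nat.lt_succ_of_le h₁.length_le, .inl ⟨ρ, List.prefix_append _ _, h₂⟩⟩
    · push Not at h
      exact ⟨σ ++ [false], List.prefix_append _ _, by simp, .inr h⟩
  choose s hs₁ hs₂ hs₃ using step
  let σ : ℕ → List Bool := fun n => Nat.rec [] (fun n τ => s τ n) n
  have hmono : ∀ m n, m ≤ n → σ m <+: σ n := fun m n h => by
    induction n, h using Nat.le_induction with
    | base => exact List.prefix_rfl
    | succ n _ ih => exact ih.trans (hs₁ _ _)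
  have hlen : ∀ n, n ≤ (σ n).length := fun n => by
    induction n with
    | zero => exact Nat.zero_le _
    | succ n ih => exact ih.trans_lt (hs₂ _ _)
  let x : ℕ → Bool := fun i => (σ (i + 1))[i]?.getD false
  have hx : ∀ n, IsInit x (σ n) := by
    intro n i v hv
    have h₁ : (σ (i + 1))[i]? = some ((σ (i + 1))[i]'(hlen (i + 1))) :=
      List.getElem?_eq_getElem _
    have h₂ := getElem?_of_prefix (hmono _ _ (le_max_left n (i + 1))) hv
    have h₃ := getElem?_of_prefix (hmono _ _ (le_max_right n (i + 1))) h₁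
    rw [h₂] at h₃
    simp only [x, h₁]
    simpa using h₃.symm
  refine ⟨x, fun E hE => ?_⟩
  obtain ⟨n, rfl⟩ : E ∈ Set.range D := hD ▸ hE
  rcases hs₃ (σ n) n with ⟨ρ, h₁, h₂⟩ | h
  · exact ⟨ρ.length, .inl (((hx (n + 1)).of_prefix h₁).eq_initSeg ▸ h₂)⟩
  · exact ⟨(σ n).length, .inr ((hx n).eq_initSeg ▸ h)⟩

theorem joinBelow_congr {g h : ℕ → ℕ → Bool} {k : ℕ} (hgh : ∀ i < k, g i = h i) :
    joinBelow g k = joinBelow h k :=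
  Set.ext fun p => and_congr_right fun hp => by rw [hgh _ hp]

theorem exists_isGenericSeq : ∃ g, IsGenericSeq g := by
  choose G hG using exists_isArithGeneric
  -- Stage `n` has columns 0, …, n - 1 in their final form; the next column is chosen generic over
  -- their join.
  let h : ℕ → ℕ → ℕ → Bool := fun n => Nat.rec (fun _ _ => false)
    (fun k h => Function.update h k (G (joinBelow h k))) n
  have hsucc : ∀ k, h (k + 1) = Function.update (h k) k (G (joinBelow (h k) k)) := fun _ => rfl
  have hg : ∀ k, ∀ i < k, h k i = h (i + 1) i := fun k => by
    induction k with
    | zero => exact fun i hi => absurd hi (Nat.not_lt_zero i)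
    | succ k ih =>
      intro i hi
      rcases Nat.lt_succ_iff_lt_or_eq.1 hi with hi | rfl
      · rw [hsucc, Function.update_of_ne hi.ne, ih i hi]
      · rfl
  refine ⟨fun k => h (k + 1) k, isGenericSeq_iff.2 fun k => ?_⟩
  rw [← joinBelow_congr (g := h k) (hg k)]
  simpa [hsucc] using hG (joinBelow (h k) k)

/-! ## The two semantic properties of the model -/

theorem below_iff {g : ℕ → ℕ → Bool} {f : ℕ →. ℕ} :
    Below g f ↔ ∃ k, f ≤ᵀ char (joinBelow g k) := by
  simp only [Below, join_eq_joinBelow]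
  exact ⟨fun ⟨n, h⟩ => ⟨_, h⟩, fun ⟨k, h⟩ => ⟨k, h.trans (joinBelow_mono g (by omega))⟩⟩

theorem IsGenericSeq.not_isPA {g : ℕ → ℕ → Bool} (hg : IsGenericSeq g) {x : ℕ → ℕ}
    (hx : Below g x) : ¬ IsPA x := by
  rintro ⟨z, h01, hzx, hz⟩
  obtain ⟨k, hk⟩ := below_iff.1 hx
  exact not_diagonally_noncomputable (isGenericSeq_iff.1 hg) k z (hzx.trans hk)
    (fun e => by rcases h01 e with h | h <;> omega) hz

theorem charSeq_reducible_iff {α : Type} [Primcodable α] {T : Set (List α)} {g : ℕ →. ℕ} :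
    charSeq T ≤ᵀ g ↔ ComputableIn {g} fun τ : List α => τ ∈ T := by
  rw [charSeq, char_reducible_iff]
  constructor
  · intro h
    refine (h.comp (g := fun τ : List α => encode τ) (by fun_prop)).of_eq fun τ => ?_
    simp
  · intro h
    have h₁ : ComputableIn {g} fun n : ℕ => n ∈ Set.range (encode : List α → ℕ) ∧
        (Encodable.decode n : Option (List α)).getD [] ∈ T :=
      .and (.of_primrecPred Primcodable.mem_range_encode)
        (h.comp (g := fun n : ℕ => (Encodable.decode n : Option (List α)).getD []) (by fun_prop))
    refine h₁.of_eq fun n => propext ?_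
    constructor
    · rintro ⟨⟨τ, rfl⟩, h⟩
      exact ⟨τ, by simpa using h, rfl⟩
    · rintro ⟨τ, hτ, rfl⟩
      exact ⟨⟨τ, rfl⟩, by simpa using hτ⟩

/-- In the model of a generic sequence every cofinal tree has a pointed subtree. -/
theorem IsGenericSeq.exists_isPointed {g : ℕ → ℕ → Bool} (hg : IsGenericSeq g)
    {T : Set (List ℕ)} (hT : IsTree T) (hTg : Below g (charSeq T))
    (hcof : ∀ X : Set ℕ, Below g (char X) →
      ∃ y ∈ paths T, Below g (y : ℕ → ℕ) ∧ char X ≤ᵀ (y : ℕ →. ℕ)) :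
    ∃ S ⊆ T, IsPointed S ∧ Below g (charSeq S) := by
  obtain ⟨k, hk⟩ := below_iff.1 hTg
  -- The only use of cofinality. The additional column g_k is what yields incompatible nodes.
  obtain ⟨y, hyT, hy, hky⟩ := hcof (joinBelow g (k + 1)) (below_iff.2 ⟨_, .refl _⟩)
  obtain ⟨m, hm⟩ := below_iff.1 hy
  obtain ⟨S, hST, hS, hSp, hSk, hSz⟩ := exists_pointed_subtree (isGenericSeq_iff.1 hg) hT
    (charSeq_reducible_iff.1 hk) hyT (r := m) (hm.trans (joinBelow_mono g (by omega))) hky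
  have hSk := charSeq_reducible_iff.2 hSk
  exact ⟨S, hST, ⟨hS, hSp, fun z hz => hSk.trans (hSz z hz)⟩, below_iff.2 ⟨k, hSk⟩⟩

theorem exists_fun_char (X : Set ℕ) : ∃ x : ℕ → ℕ, (x : ℕ →. ℕ) = char X := by
  classical exact ⟨fun n => if n ∈ X then 1 else 0, funext fun n => by simp [char]⟩

end Pointed

/-! ## Semantics of second-order arithmetic -/

namespace SOA

variable {M : Str}

@[simp] theorem Tm.val_add (s t : Tm) (v : ℕ → M.N) :
    (s + t).val M v = M.add (s.val M v) (t.val M v) := rfl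

@[simp] theorem Tm.val_mul (s t : Tm) (v : ℕ → M.N) :
    (s * t).val M v = M.mul (s.val M v) (t.val M v) := rfl

@[simp] theorem Tm.val_zero (v : ℕ → M.N) : (0 : Tm).val M v = M.zero := rfl

@[simp] theorem Tm.val_one (v : ℕ → M.N) : (1 : Tm).val M v = M.one := rfl

@[simp] theorem Tm.val_var (i : ℕ) (v : ℕ → M.N) : (Tm.var i).val M v = v i := rfl

theorem Tm.val_congr {t : Tm} {v v' : ℕ → M.N} (h : ∀ i, t.Occurs i → v i = v' i) :
    t.val M v = t.val M v' := by
  induction t with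
  | var i => exact h i rfl
  | zero | one => rfl
  | add s t ihs iht | mul s t ihs iht =>
    simp only [Tm.val]
    rw [ihs fun i hi => h i (.inl hi), iht fun i hi => h i (.inr hi)]

theorem Tm.val_update {t : Tm} {i : ℕ} (h : ¬ t.Occurs i) (v : ℕ → M.N) (a : M.N) :
    t.val M (Function.update v i a) = t.val M v :=
  Tm.val_congr fun j hj => Function.update_of_ne (fun e : j = i => h (e ▸ hj)) _ _

theorem Fml.sat_congr {φ : Fml} {v v' : ℕ → M.N} {V V' : ℕ → Set M.N}
    (hv : ∀ i, φ.OccursN i → v i = v' i) (hV : ∀ X, φ.OccursS X → V X = V' X) :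
    φ.Sat M v V ↔ φ.Sat M v' V' := by
  induction φ generalizing v v' V V' with
  | eq s t | lt s t =>
    simp only [Fml.Sat]
    rw [Tm.val_congr fun i hi => hv i (.inl hi), Tm.val_congr fun i hi => hv i (.inr hi)]
  | mem t X =>
    simp only [Fml.Sat]
    rw [Tm.val_congr fun i hi => hv i hi, hV X rfl]
  | not φ ih => exact not_congr (ih hv hV)
  | and φ ψ ih₁ ih₂ =>
    exact and_congr (ih₁ (fun i h => hv i (.inl h)) fun X h => hV X (.inl h))
      (ih₂ (fun i h => hv i (.inr h)) fun X h => hV X (.inr h))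
  | or φ ψ ih₁ ih₂ =>
    exact or_congr (ih₁ (fun i h => hv i (.inl h)) fun X h => hV X (.inl h))
      (ih₂ (fun i h => hv i (.inr h)) fun X h => hV X (.inr h))
  | imp φ ψ ih₁ ih₂ =>
    exact imp_congr (ih₁ (fun i h => hv i (.inl h)) fun X h => hV X (.inl h))
      (ih₂ (fun i h => hv i (.inr h)) fun X h => hV X (.inr h))
  | allN j φ ih =>
    refine forall_congr' fun a => ih (fun i h => ?_) hV
    rcases eq_or_ne i j with rfl | hij
    · simp
    · simpa [hij] using hv i (.inr h)
  | exN j φ ih =>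
    refine exists_congr fun a => ih (fun i h => ?_) hV
    rcases eq_or_ne i j with rfl | hij
    · simp
    · simpa [hij] using hv i (.inr h)
  | allS Y φ ih =>
    refine forall₂_congr fun A _ => ih hv fun X h => ?_
    rcases eq_or_ne X Y with rfl | hXY
    · simp
    · simpa [hXY] using hV X (.inr h)
  | exS Y φ ih =>
    refine exists_congr fun A => and_congr_right fun _ => ih hv fun X h => ?_
    rcases eq_or_ne X Y with rfl | hXY
    · simp
    · simpa [hXY] using hV X (.inr h)

end SOA

/-! ### The ω-model satisfies RCA₀ -/

namespace Pointed

open SOA Function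
open scoped Computability

variable {g : ℕ → ℕ → Bool}

theorem models_basicAxioms : (model g).ModelsTheory basicAxioms := by
  intro φ hφ
  simp only [basicAxioms, Set.mem_insert_iff, Set.mem_singleton_iff] at hφ
  rcases hφ with rfl | rfl | rfl | rfl | rfl | rfl | rfl | rfl <;> intro v V _ <;>
    simp [allN, beq, blt, bnot, bimp, band, bor, biff, Fml.Sat]
  · intros; omega
  · intros; ring
  · intros; omega

theorem models_indFml (φ : Fml) {i j : ℕ} (hij : j ≠ i) (hj : ¬ φ.OccursN j) :
    (model g).Models (indFml φ i j) := by
  intro v V _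
  simp only [indFml, Fml.Sat, Tm.val_var, Function.update_self, Tm.val_zero, Tm.val_add,
    Tm.val_one, forall_eq, Function.update_of_ne hij.symm, Function.update_of_ne hij]
  rintro ⟨h₀, hs⟩ a
  induction a with
  | zero => exact h₀
  | succ a ih =>
    have h := hs a ih
    -- The auxiliary variable `j` still carries the value `a + 1`; as `j` does not occur in `φ`,
    -- this is invisible.
    refine (Fml.sat_congr (fun l hl => ?_) fun _ _ => rfl).1 h
    have hlj : l ≠ j := fun e => hj (e ▸ hl)
    by_cases hli : l = i
    · subst hli
      simp
    · simp [hli, hlj]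

/-- A formula mentions finitely many set variables, so one finite join computes all its parameters;
the full assignment `V` need not lie below any single join. -/
theorem exists_computableIn_params {V : ℕ → Set ℕ} (hV : ∀ X, Below g (char (V X))) (φ : Fml) :
    ∃ k, ∀ X, φ.OccursS X → ComputableIn {char (joinBelow g k)} fun n => n ∈ V X := by
  have two : ∀ φ ψ : Fml,
      (∃ k, ∀ X, φ.OccursS X → ComputableIn {char (joinBelow g k)} fun n => n ∈ V X) →
      (∃ k, ∀ X, ψ.OccursS X → ComputableIn {char (joinBelow g k)} fun n => n ∈ V X) →
      ∃ k, ∀ X, φ.OccursS X ∨ ψ.OccursS X →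
        ComputableIn {char (joinBelow g k)} fun n => n ∈ V X := by
    rintro φ ψ ⟨k, hk⟩ ⟨l, hl⟩
    refine ⟨max k l, fun X hX => ?_⟩
    rcases hX with hX | hX
    · exact (hk X hX).trans (joinBelow_mono g (le_max_left k l))
    · exact (hl X hX).trans (joinBelow_mono g (le_max_right k l))
  have one : ∀ Y, ∃ k, ∀ X, X = Y → ComputableIn {char (joinBelow g k)} fun n => n ∈ V X := by
    intro Y
    obtain ⟨k, hk⟩ := below_iff.1 (hV Y)
    exact ⟨k, fun X e => e ▸ char_reducible_iff.1 hk⟩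
  induction φ with
  | eq | lt => exact ⟨0, fun X h => h.elim⟩
  | mem t Y => exact one Y
  | not φ ih | allN _ φ ih | exN _ φ ih => exact ih
  | and φ ψ ih₁ ih₂ | or φ ψ ih₁ ih₂ | imp φ ψ ih₁ ih₂ => exact two φ ψ ih₁ ih₂
  -- The atomic formula serves only as one in which exactly the set variable `Y` occurs.
  | allS Y φ ih | exS Y φ ih => exact two (.mem 0 Y) φ (one Y) ih

theorem computableIn_val {O : Set (ℕ →. ℕ)} {w : ℕ → ℕ → ℕ}
    (hw : ∀ i, ComputableIn O fun x => w x i) (t : Tm) :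
    ComputableIn O fun x => t.val (model g) (w x) := by
  induction t with
  | var i => exact hw i
  | zero | one => exact .const _
  | add s t ihs iht => exact .nat_add ihs iht
  | mul s t ihs iht => exact .nat_mul ihs iht

theorem computableIn_update {O : Set (ℕ →. ℕ)} {w : ℕ → ℕ → ℕ}
    (hw : ∀ i, ComputableIn O fun x => w x i) (i j : ℕ) :
    ComputableIn O fun x : ℕ => update (w x.unpair.1) i x.unpair.2 j := by
  rcases eq_or_ne j i with rfl | hij
  · simp only [update_self]
    fun_prop
  · simp only [update_of_ne hij]
    exact (hw j).comp (g := fun x : ℕ => x.unpair.1) (by fun_prop)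

/-- The number assignment varies computably with a parameter, so that under a bounded quantifier the
bound variable can be paired into that parameter. -/
theorem computableIn_sat_of_bounded {O : Set (ℕ →. ℕ)} {V : ℕ → Set ℕ} {θ : Fml}
    (hθ : θ.Bounded) (hV : ∀ X, θ.OccursS X → ComputableIn O fun n => n ∈ V X) {w : ℕ → ℕ → ℕ}
    (hw : ∀ i, ComputableIn O fun x => w x i) :
    ComputableIn O fun x => θ.Sat (model g) (w x) V := by
  induction hθ generalizing w with
  | eq s t => exact .eq (computableIn_val hw s) (computableIn_val hw t)
  | lt s t => exact .nat_lt (computableIn_val hw s) (computableIn_val hw t)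
  | mem t X => exact (hV X rfl).comp (computableIn_val hw t)
  | not _ ih => exact .not (ih hV hw)
  | and _ _ ih₁ ih₂ =>
    exact .and (ih₁ (fun X h => hV X (.inl h)) hw) (ih₂ (fun X h => hV X (.inr h)) hw)
  | or _ _ ih₁ ih₂ =>
    exact .or (ih₁ (fun X h => hV X (.inl h)) hw) (ih₂ (fun X h => hV X (.inr h)) hw)
  | imp _ _ ih₁ ih₂ =>
    exact .imp (ih₁ (fun X h => hV X (.inl h)) hw) (ih₂ (fun X h => hV X (.inr h)) hw)
  | @ball i t φ ht _ ih =>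
    have h₁ := (ih (fun X h => hV X (.inr h)) (computableIn_update hw i)).comp
      (g := fun x : ℕ × ℕ => Nat.pair x.1 x.2) (by fun_prop)
    simp only [Nat.unpair_pair] at h₁
    have h₂ := (ComputableIn.forall_lt (p := fun x a => φ.Sat (model g) (update (w x) i a) V)
      h₁).comp (g := fun x => (x, t.val (model g) (w x))) (.pair .id (computableIn_val hw t))
    refine h₂.of_eq fun x => ?_
    simp [Fml.Sat, Tm.val_update ht]
  | @bex i t φ ht _ ih =>
    have h₁ := (ih (fun X h => hV X (.inr h)) (computableIn_update hw i)).comp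
      (g := fun x : ℕ × ℕ => Nat.pair x.1 x.2) (by fun_prop)
    simp only [Nat.unpair_pair] at h₁
    have h₂ := (ComputableIn.exists_lt (p := fun x a => φ.Sat (model g) (update (w x) i a) V)
      h₁).comp (g := fun x => (x, t.val (model g) (w x))) (.pair .id (computableIn_val hw t))
    refine h₂.of_eq fun x => ?_
    simp [Fml.Sat, Tm.val_update ht]

theorem reIn_exists_sat {O : Set (ℕ →. ℕ)} {V : ℕ → Set ℕ} {θ : Fml}
    (hθ : θ.Bounded) (hV : ∀ X, θ.OccursS X → ComputableIn O fun n => n ∈ V X) (v : ℕ → ℕ)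
    (i j : ℕ) : REIn O fun a => ∃ b, θ.Sat (model g) (update (update v i a) j b) V := by
  have h₁ : ∀ l, ComputableIn O fun x => update v i x l := fun l => by
    rcases eq_or_ne l i with rfl | hij
    · simp only [update_self]
      fun_prop
    · simp only [update_of_ne hij]
      exact .const _
  have h₂ := (computableIn_sat_of_bounded (g := g) hθ hV (computableIn_update h₁ j)).comp
    (g := fun x : ℕ × ℕ => Nat.pair x.1 x.2) (by fun_prop)
  simp only [Nat.unpair_pair] at h₂
  exact REIn.exists_of (p := fun a b => θ.Sat (model g) (update (update v i a) j b) V)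
    (.of_computableIn h₂)

/-- The Σ⁰₁ form makes the set r.e. in a finite join, the Π⁰₁ form does the same for its complement,
and Post's theorem puts the set into the model. -/
theorem models_compFml {φ ψ : Fml} (hφ : φ.Sigma01) (hψ : ψ.Pi01) {X : ℕ} (hX : ¬ φ.OccursS X)
    (i : ℕ) : (model g).Models (compFml φ ψ i X) := by
  intro v V hV heq
  obtain ⟨j, θ, hθ, rfl⟩ := hφ
  obtain ⟨l, η, hη, rfl⟩ := hψ
  obtain ⟨k₁, hk₁⟩ := exists_computableIn_params hV θ
  obtain ⟨k₂, hk₂⟩ := exists_computableIn_params hV η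
  have h₁ := reIn_exists_sat (g := g) hθ (fun Y hY => (hk₁ Y hY).trans
    (joinBelow_mono g (le_max_left k₁ k₂))) v i j
  have h₂ := reIn_exists_sat (g := g) hη.not (fun Y hY => (hk₂ Y hY).trans
    (joinBelow_mono g (le_max_right k₁ k₂))) v i l
  have hA := h₁.computableIn (h₂.of_iff fun a => by
    have : (∃ b, θ.Sat (model g) (update (update v i a) j b) V) ↔
      ∀ b, η.Sat (model g) (update (update v i a) l b) V := ⟨(heq a).1, (heq a).2⟩
    rw [this]
    simp [Fml.Sat])
  refine ⟨{a | ∃ b, θ.Sat (model g) (update (update v i a) j b) V},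
    below_iff.2 ⟨_, char_reducible_iff.2 hA⟩, fun a => ?_⟩
  have h₃ : (Fml.exN j θ).Sat (model g) (update v i a) (update V X
      {a | ∃ b, θ.Sat (model g) (update (update v i a) j b) V}) ↔
      (Fml.exN j θ).Sat (model g) (update v i a) V :=
    Fml.sat_congr (fun _ _ => rfl) fun Y hY => update_of_ne (fun e : Y = X => hX (e ▸ hY)) _ _
  have h₄ : (Fml.mem (.var i) X).Sat (model g) (update v i a) (update V X
      {a | ∃ b, θ.Sat (model g) (update (update v i a) j b) V}) ↔
      (Fml.exN j θ).Sat (model g) (update v i a) V := by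
    simp [Fml.Sat]
  exact ⟨fun h => h₃.2 (h₄.1 h), fun h => h₄.2 (h₃.1 h)⟩

theorem models_RCA0 : (model g).ModelsTheory RCA0 := by
  rintro χ ((h | ⟨φ, i, j, -, hij, hj, rfl⟩) | ⟨φ, ψ, i, X, hφ, hψ, hX, rfl⟩)
  · exact models_basicAxioms χ h
  · exact models_indFml φ hij hj
  · exact models_compFml hφ hψ hX i

end Pointed

/-! ### Satisfaction for formulas with fresh variables -/

namespace SOA

variable {M : Str} {v : ℕ → M.N} {V : ℕ → Set M.N} {k : ℕ}

section Builders

variable (φ ψ : Bld) (s t : Tm) (X : ℕ)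

@[simp] theorem sat_beq : ((s =ᵇ t) k).Sat M v V ↔ s.val M v = t.val M v := Iff.rfl
@[simp] theorem sat_blt : ((s <ᵇ t) k).Sat M v V ↔ M.lt (s.val M v) (t.val M v) := Iff.rfl
@[simp] theorem sat_bmem : ((t ∈ᵇ X) k).Sat M v V ↔ t.val M v ∈ V X := Iff.rfl
@[simp] theorem sat_bnot : ((¬ᵇ φ) k).Sat M v V ↔ ¬ (φ k).Sat M v V := Iff.rfl
@[simp] theorem sat_band : ((φ ∧ᵇ ψ) k).Sat M v V ↔ (φ k).Sat M v V ∧ (ψ k).Sat M v V := Iff.rfl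
@[simp] theorem sat_bor : ((φ ∨ᵇ ψ) k).Sat M v V ↔ (φ k).Sat M v V ∨ (ψ k).Sat M v V := Iff.rfl
@[simp] theorem sat_bimp : ((φ →ᵇ ψ) k).Sat M v V ↔ ((φ k).Sat M v V → (ψ k).Sat M v V) := Iff.rfl

@[simp] theorem sat_allN (f : Tm → Bld) : (allN f k).Sat M v V ↔
    ∀ a, (f (.var k) (k + 1)).Sat M (Function.update v k a) V := Iff.rfl
@[simp] theorem sat_exN (f : Tm → Bld) : (exN f k).Sat M v V ↔
    ∃ a, (f (.var k) (k + 1)).Sat M (Function.update v k a) V := Iff.rfl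
@[simp] theorem sat_allS (f : ℕ → Bld) : (allS f k).Sat M v V ↔
    ∀ A ∈ M.S, (f k (k + 1)).Sat M v (Function.update V k A) := Iff.rfl
@[simp] theorem sat_exS (f : ℕ → Bld) : (exS f k).Sat M v V ↔
    ∃ A ∈ M.S, (f k (k + 1)).Sat M v (Function.update V k A) := Iff.rfl

end Builders

/-- All number variables of `t` have an index less than `k`. -/
def Tm.Fresh (k : ℕ) (t : Tm) : Prop := ∀ i, t.Occurs i → i < k

theorem Tm.Fresh.mono {t : Tm} {k l : ℕ} (h : t.Fresh k) (hkl : k ≤ l) : t.Fresh l :=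
  fun i hi => (h i hi).trans_le hkl

@[simp] theorem Tm.fresh_var {i : ℕ} : (Tm.var i).Fresh k ↔ i < k :=
  ⟨fun h => h i rfl, fun h j hj => by rwa [show j = i from hj]⟩

@[simp] theorem Tm.fresh_zero : (0 : Tm).Fresh k := fun _ h => h.elim
@[simp] theorem Tm.fresh_one : (1 : Tm).Fresh k := fun _ h => h.elim

@[simp] theorem Tm.Fresh.add {t : Tm} {k j : ℕ} (h : t.Fresh k) : t.Fresh (k + j) :=
  h.mono (Nat.le_add_right _ _)

/-- Binding the variable `k` does not disturb terms formed earlier; with this, simplification can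
strip the builder quantifiers. -/
theorem Tm.Fresh.val_update {t : Tm} (h : t.Fresh k) (v : ℕ → M.N) (a : M.N) :
    t.val M (Function.update v k a) = t.val M v :=
  Tm.val_update (fun hk => lt_irrefl k (h k hk)) v a

theorem Tm.Fresh.val_update_add {t : Tm} (h : t.Fresh k) (j : ℕ) (v : ℕ → M.N) (a : M.N) :
    t.val M (Function.update v (k + j) a) = t.val M v :=
  h.add.val_update v a

end SOA

/-! ### Coded finite sets and single computation steps -/

namespace Pointed

open SOA Function
open scoped Computability

variable {g : ℕ → ℕ → Bool} {v : ℕ → ℕ} {V : ℕ → Set ℕ} {k : ℕ}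

/-- `i` belongs to the finite set coded by `b = (k, m, n)`. -/
def FinMem (b : ℕ × ℕ × ℕ) (i : ℕ) : Prop := i < b.1 ∧ ∃ q, q * (b.2.1 * (i + 1) + 1) = b.2.2

/-- Gödel's device: the numbers k!·(i+1)+1 for i < k are pairwise coprime, since a common prime
factor would divide k!·(j-i), hence k!, hence 1. So the product over `A` is divisible by exactly
those with i in `A`. -/
theorem exists_finMem (A : Finset ℕ) : ∃ b, ∀ i, FinMem b i ↔ i ∈ A := by
  obtain ⟨k, hk⟩ : ∃ k, ∀ i ∈ A, i < k :=
    ⟨A.sup id + 1, fun i hi => Nat.lt_succ_of_le (Finset.le_sup (f := id) hi)⟩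
  have hcop : ∀ i < k, ∀ j < k, i ≠ j →
      Nat.Coprime (k.factorial * (i + 1) + 1) (k.factorial * (j + 1) + 1) := by
    have key : ∀ i < k, ∀ j < k, i < j →
        Nat.Coprime (k.factorial * (i + 1) + 1) (k.factorial * (j + 1) + 1) := by
      intro i hi j hj hij
      refine Nat.Coprime.symm (Nat.coprime_of_dvd fun p hp h₁ h₂ => ?_)
      have h₃ : p ∣ k.factorial * (j - i) := by
        have h := Nat.dvd_sub h₁ h₂
        have e : k.factorial * (j + 1) + 1 - (k.factorial * (i + 1) + 1) =
            k.factorial * (j - i) := by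
          rw [Nat.add_sub_add_right, ← Nat.mul_sub]
          congr 1
          omega
        rwa [e] at h
      have h₄ : p ∣ k.factorial := by
        rcases (Nat.Prime.dvd_mul hp).1 h₃ with h | h
        · exact h
        · exact h.trans (Nat.dvd_factorial (by omega) (by omega))
      have h₅ : p ∣ 1 := (Nat.dvd_add_right (h₄.mul_right (i + 1))).1 h₂
      exact hp.one_lt.ne' (Nat.dvd_one.1 h₅)
    intro i hi j hj hij
    rcases lt_or_gt_of_ne hij with h | h
    · exact key i hi j hj h
    · exact (key j hj i hi h).symm
  refine ⟨(k, k.factorial, ∏ i ∈ A, (k.factorial * (i + 1) + 1)), fun i => ?_⟩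
  constructor
  · rintro ⟨hi, q, hq⟩
    by_contra hiA
    have h₁ : Nat.Coprime (k.factorial * (i + 1) + 1) (∏ i ∈ A, (k.factorial * (i + 1) + 1)) :=
      Nat.Coprime.prod_right fun j hj => hcop i hi j (hk j hj) fun e => hiA (e ▸ hj)
    have h₂ := Nat.Coprime.eq_one_of_dvd h₁ (Dvd.intro_left q hq)
    have := Nat.factorial_pos k
    have : 0 < k.factorial * (i + 1) := by positivity
    omega
  · intro hi
    obtain ⟨q, hq⟩ := Finset.dvd_prod_of_mem (fun i => k.factorial * (i + 1) + 1) hi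
    exact ⟨hk i hi, q, by rw [mul_comm]; exact hq.symm⟩

@[simp] theorem sat_isPair {a b z : Tm} : (isPair a b z k).Sat (model g) v V ↔
    z.val (model g) v = Nat.pair (a.val (model g) v) (b.val (model g) v) := by
  simp only [isPair, sat_bor, sat_band, sat_blt, sat_beq, sat_bnot, Tm.val_add, Tm.val_mul,
    Nat.pair]
  split_ifs with h <;> simp [h]

@[simp] theorem sat_isSnoc {σ a τ : Tm} (hσ : σ.Fresh k) (ha : a.Fresh k) (hτ : τ.Fresh k) :
    (isSnoc σ a τ k).Sat (model g) v V ↔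
    τ.val (model g) v = Nat.pair (a.val (model g) v) (σ.val (model g) v) + 1 := by
  simp [isSnoc, hσ.val_update, ha.val_update, hτ.val_update]

@[simp] theorem sat_inFin {b₁ b₂ b₃ i : Tm} (h₂ : b₂.Fresh k)
    (h₃ : b₃.Fresh k) (hi : i.Fresh k) : (inFin b₁ b₂ b₃ i k).Sat (model g) v V ↔
    FinMem (b₁.val (model g) v, b₂.val (model g) v, b₃.val (model g) v) (i.val (model g) v) := by
  simp [inFin, FinMem, h₂.val_update, h₃.val_update, hi.val_update]

@[simp] theorem sat_inRec {b₁ b₂ b₃ c x y : Tm} (h₁ : b₁.Fresh k) (h₂ : b₂.Fresh k)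
    (h₃ : b₃.Fresh k) (hc : c.Fresh k) (hx : x.Fresh k) (hy : y.Fresh k) :
    (inRec b₁ b₂ b₃ c x y k).Sat (model g) v V ↔
    FinMem (b₁.val (model g) v, b₂.val (model g) v, b₃.val (model g) v)
      (Nat.pair (c.val (model g) v) (Nat.pair (x.val (model g) v) (y.val (model g) v))) := by
  simp [inRec, h₂, h₃, h₁.val_update, h₂.val_update, h₃.val_update, hc.val_update,
    hx.val_update, hy.val_update, h₁.val_update_add, h₂.val_update_add, h₃.val_update_add,
    hc.val_update_add, hx.val_update_add, hy.val_update_add, add_assoc]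

/-- One step of a computation: the output `y` of the program `c` with oracle `Y` on the input `x`
follows from the claims in `R`. -/
def Step (Y : Set ℕ) (R : ℕ → ℕ → ℕ → Prop) (c x y : ℕ) : Prop :=
  ∃ tag c₁ c₂, c = Nat.pair tag (Nat.pair c₁ c₂) ∧
    ((tag = 0 ∧ y = 0) ∨ (tag = 1 ∧ y = x + 1) ∨ (tag = 2 ∧ ∃ b, x = Nat.pair y b) ∨
     (tag = 3 ∧ ∃ a, x = Nat.pair a y) ∨ (tag = 4 ∧ ((x ∈ Y ∧ y = 1) ∨ (x ∉ Y ∧ y = 0))) ∨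
     (tag = 5 ∧ ∃ y₁ y₂, R c₁ x y₁ ∧ R c₂ x y₂ ∧ y = Nat.pair y₁ y₂) ∨
     (tag = 6 ∧ ∃ z, R c₂ x z ∧ R c₁ z y) ∨
     (tag = 7 ∧ ∃ a l, x = Nat.pair a l ∧ ((l = 0 ∧ R c₁ a y) ∨
        ∃ l' i, l = l' + 1 ∧ R c (Nat.pair a l') i ∧ R c₂ (Nat.pair a (Nat.pair l' i)) y)) ∨
     (tag = 8 ∧ R c₁ (Nat.pair x y) 0 ∧ ∀ l < y, ∃ j, j ≠ 0 ∧ R c₁ (Nat.pair x l) j))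

@[simp] theorem val_num (n : ℕ) : (num n).val (model g) v = n := by
  induction n with
  | zero => rfl
  | succ n ih => simp [num, ih]

theorem sat_isStep {Y : ℕ} {b₁ b₂ b₃ c x y : Tm} (h₁ : b₁.Fresh k) (h₂ : b₂.Fresh k)
    (h₃ : b₃.Fresh k) (hc : c.Fresh k) (hx : x.Fresh k) (hy : y.Fresh k) :
    (isStep Y b₁ b₂ b₃ c x y k).Sat (model g) v V ↔
    Step (V Y) (fun c x y => FinMem (b₁.val (model g) v, b₂.val (model g) v, b₃.val (model g) v)
      (Nat.pair c (Nat.pair x y))) (c.val (model g) v) (x.val (model g) v)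
      (y.val (model g) v) := by
  simp [isStep, Step, h₁, h₂, h₃, hc, hx, hy, h₁.val_update, h₂.val_update, h₃.val_update,
    hc.val_update, hx.val_update, hy.val_update, h₁.val_update_add, h₂.val_update_add,
    h₃.val_update_add, hc.val_update_add, hx.val_update_add, hy.val_update_add, add_assoc]

end Pointed

/-! ### Arithmetized computations and Turing reducibility -/

namespace Pointed

open SOA Function
open scoped Computability

variable {g : ℕ → ℕ → Bool} {v : ℕ → ℕ} {V : ℕ → Set ℕ} {k : ℕ} {Y : Set ℕ}

/-- The claim that the program `c` on the input `x` has the output `y` is in the finite set coded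
by `b`. -/
def Claim (b : ℕ × ℕ × ℕ) (c x y : ℕ) : Prop := FinMem b (Nat.pair c (Nat.pair x y))

/-- Each claim in the finite set coded by `b` follows from others by one step. -/
def Valid (Y : Set ℕ) (b : ℕ × ℕ × ℕ) : Prop :=
  ∀ c x y, Claim b c x y → Step Y (Claim b) c x y

/-- The claim that the program `c` on the input `x` has the output `y` has a computation. -/
def Derivable (Y : Set ℕ) (c x y : ℕ) : Prop := ∃ b, Claim b c x y ∧ Valid Y b

theorem step_pair {R : ℕ → ℕ → ℕ → Prop} {tag c₁ c₂ x y : ℕ} :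
    Step Y R (Nat.pair tag (Nat.pair c₁ c₂)) x y ↔
    ((tag = 0 ∧ y = 0) ∨ (tag = 1 ∧ y = x + 1) ∨ (tag = 2 ∧ ∃ b, x = Nat.pair y b) ∨
     (tag = 3 ∧ ∃ a, x = Nat.pair a y) ∨ (tag = 4 ∧ ((x ∈ Y ∧ y = 1) ∨ (x ∉ Y ∧ y = 0))) ∨
     (tag = 5 ∧ ∃ y₁ y₂, R c₁ x y₁ ∧ R c₂ x y₂ ∧ y = Nat.pair y₁ y₂) ∨
     (tag = 6 ∧ ∃ z, R c₂ x z ∧ R c₁ z y) ∨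
     (tag = 7 ∧ ∃ a l, x = Nat.pair a l ∧ ((l = 0 ∧ R c₁ a y) ∨
        ∃ l' i, l = l' + 1 ∧ R (Nat.pair tag (Nat.pair c₁ c₂)) (Nat.pair a l') i ∧
          R c₂ (Nat.pair a (Nat.pair l' i)) y)) ∨
     (tag = 8 ∧ R c₁ (Nat.pair x y) 0 ∧ ∀ l < y, ∃ j, j ≠ 0 ∧ R c₁ (Nat.pair x l) j)) := by
  constructor
  · rintro ⟨tag', c₁', c₂', e, h⟩
    simp only [Nat.pair_eq_pair] at e
    obtain ⟨rfl, rfl, rfl⟩ := e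
    exact h
  · exact fun h => ⟨_, _, _, rfl, h⟩

theorem Step.mono {R R' : ℕ → ℕ → ℕ → Prop} (hR : ∀ c x y, R c x y → R' c x y) {c x y : ℕ}
    (h : Step Y R c x y) : Step Y R' c x y := by
  obtain ⟨tag, c₁, c₂, rfl, h⟩ := h
  refine ⟨tag, c₁, c₂, rfl, ?_⟩
  rcases h with h | h | h | h | h | ⟨h, y₁, y₂, h₁, h₂, h₃⟩ | ⟨h, z, h₁, h₂⟩ |
    ⟨h, a, l, h₁, ⟨h₂, h₃⟩ | ⟨l', i, h₂, h₃, h₄⟩⟩ | ⟨h, h₁, h₂⟩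
  · simp [h]
  · simp [h]
  · exact .inr (.inr (.inl h))
  · exact .inr (.inr (.inr (.inl h)))
  · exact .inr (.inr (.inr (.inr (.inl h))))
  · exact .inr (.inr (.inr (.inr (.inr (.inl ⟨h, y₁, y₂, hR _ _ _ h₁, hR _ _ _ h₂, h₃⟩)))))
  · exact .inr (.inr (.inr (.inr (.inr (.inr (.inl ⟨h, z, hR _ _ _ h₁, hR _ _ _ h₂⟩))))))
  · exact .inr (.inr (.inr (.inr (.inr (.inr (.inr (.inl
      ⟨h, a, l, h₁, .inl ⟨h₂, hR _ _ _ h₃⟩⟩)))))))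
  · exact .inr (.inr (.inr (.inr (.inr (.inr (.inr (.inl
      ⟨h, a, l, h₁, .inr ⟨l', i, h₂, hR _ _ _ h₃, hR _ _ _ h₄⟩⟩)))))))
  · refine .inr (.inr (.inr (.inr (.inr (.inr (.inr (.inr ⟨h, hR _ _ _ h₁, fun l hl => ?_⟩)))))))
    obtain ⟨j, hj, h₃⟩ := h₂ l hl
    exact ⟨j, hj, hR _ _ _ h₃⟩

/-- A program denotes a partial function recursive in the oracle. -/
theorem exists_recursiveIn_of_step (Y : Set ℕ) (c : ℕ) : ∃ f : ℕ →. ℕ, Nat.RecursiveIn {char Y} f ∧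
    ∀ R : ℕ → ℕ → ℕ → Prop, (∀ c x y, R c x y → Step Y R c x y) → ∀ x y, R c x y → y ∈ f x := by
  induction c using Nat.strong_induction_on with | _ c ih =>
  obtain ⟨tag, c₁, c₂, rfl⟩ : ∃ tag c₁ c₂, c = Nat.pair tag (Nat.pair c₁ c₂) :=
    ⟨c.unpair.1, c.unpair.2.unpair.1, c.unpair.2.unpair.2, by simp⟩
  have lt : 0 < tag → Nat.pair c₁ c₂ < Nat.pair tag (Nat.pair c₁ c₂) := fun h =>
    (Nat.right_le_pair 0 _).trans_lt (Nat.pair_lt_pair_left _ h)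
  -- The components are smaller than the program only for a positive tag; tag 0 has no subprograms
  -- and is treated separately.
  have ih₁ := fun h : 0 < tag => ih c₁ ((Nat.left_le_pair c₁ c₂).trans_lt (lt h))
  have ih₂ := fun h : 0 < tag => ih c₂ ((Nat.right_le_pair c₁ c₂).trans_lt (lt h))
  clear ih lt
  have key : ∀ {R : ℕ → ℕ → ℕ → Prop}, (∀ c x y, R c x y → Step Y R c x y) → ∀ {x y},
      R (Nat.pair tag (Nat.pair c₁ c₂)) x y → _ := fun hR _ _ h => step_pair.1 (hR _ _ _ h)
  -- No rule applies to such a tag, so there are no claims to satisfy and any function serves.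
  rcases Nat.lt_or_ge 8 tag with h8 | h8
  · refine ⟨_, .zero, fun R hR x y h => ?_⟩
    have := key hR h
    omega
  obtain ⟨f₁, hf₁, h₁⟩ | rfl : (∃ f : ℕ →. ℕ, Nat.RecursiveIn {char Y} f ∧ ∀ R : ℕ → ℕ → ℕ → Prop,
    (∀ c x y, R c x y → Step Y R c x y) → ∀ x y, R c₁ x y → y ∈ f x) ∨ tag = 0 := by
    rcases Nat.eq_zero_or_pos tag with h | h
    exacts [.inr h, .inl (ih₁ h)]
  swap
  · refine ⟨_, .zero, fun R hR x y h => ?_⟩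
    have := key hR h
    simp at this
    exact Part.mem_some_iff.2 this
  obtain ⟨f₂, hf₂, h₂⟩ | rfl : (∃ f : ℕ →. ℕ, Nat.RecursiveIn {char Y} f ∧ ∀ R : ℕ → ℕ → ℕ → Prop,
    (∀ c x y, R c x y → Step Y R c x y) → ∀ x y, R c₂ x y → y ∈ f x) ∨ tag = 0 := by
    rcases Nat.eq_zero_or_pos tag with h | h
    exacts [.inr h, .inl (ih₂ h)]
  swap
  · refine ⟨_, .zero, fun R hR x y h => ?_⟩
    have := key hR h
    simp at this
    exact Part.mem_some_iff.2 this
  clear ih₁ ih₂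
  interval_cases tag
  · refine ⟨_, .zero, fun R hR x y h => ?_⟩
    have := key hR h
    simp at this
    exact Part.mem_some_iff.2 this
  · refine ⟨_, .succ, fun R hR x y h => ?_⟩
    have := key hR h
    simp at this
    exact Part.mem_some_iff.2 this
  · refine ⟨_, .left, fun R hR x y h => ?_⟩
    have := key hR h
    simp at this
    obtain ⟨b, rfl⟩ := this
    simp
  · refine ⟨_, .right, fun R hR x y h => ?_⟩
    have := key hR h
    simp at this
    obtain ⟨b, rfl⟩ := this
    simp
  · refine ⟨_, .oracle _ rfl, fun R hR x y h => ?_⟩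
    have := key hR h
    simp at this
    rcases this with ⟨hx, rfl⟩ | ⟨hx, rfl⟩ <;> simp [char, hx]
  · refine ⟨_, .pair hf₁ hf₂, fun R hR x y h => ?_⟩
    have := key hR h
    simp at this
    obtain ⟨y₁, h₃, y₂, h₄, rfl⟩ := this
    simp only [Part.mem_bind_iff, Part.map_eq_map, Part.mem_map_iff, Seq.seq]
    exact ⟨_, ⟨_, h₁ R hR _ _ h₃, rfl⟩, _, h₂ R hR _ _ h₄, rfl⟩
  · refine ⟨_, .comp hf₁ hf₂, fun R hR x y h => ?_⟩
    have := key hR h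
    simp at this
    obtain ⟨z, h₃, h₄⟩ := this
    exact Part.mem_bind_iff.2 ⟨z, h₂ R hR _ _ h₃, h₁ R hR _ _ h₄⟩
  · refine ⟨_, .prec hf₁ hf₂, fun R hR => ?_⟩
    -- Primitive recursion calls the same program again, so the descent is on the recursion argument
    -- rather than on the program.
    have main : ∀ l a y, R (Nat.pair 7 (Nat.pair c₁ c₂)) (Nat.pair a l) y → y ∈
        (Nat.rec (f₁ a) (fun y IH => IH.bind fun i => f₂ (Nat.pair a (Nat.pair y i))) l :
          Part ℕ) := by
      intro l
      induction l with
      | zero =>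
        intro a y h
        have := key hR h
        simp at this
        exact h₁ R hR _ _ this
      | succ l ih =>
        intro a y h
        have := key hR h
        simp at this
        obtain ⟨i, h, h'⟩ := this
        exact Part.mem_bind_iff.2 ⟨i, ih _ _ h, h₂ R hR _ _ h'⟩
    intro x y h
    have := main x.unpair.2 x.unpair.1 y (by simpa using h)
    exact this
  · refine ⟨_, .rfind hf₁, fun R hR x y h => ?_⟩
    have := key hR h
    simp at this
    refine Nat.mem_rfind.2 ⟨?_, fun {l} hl => ?_⟩
    · exact Part.mem_map_iff _ |>.2 ⟨0, h₁ R hR _ _ this.1, by simp⟩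
    · obtain ⟨j, h⟩ := this.2 l hl
      exact Part.mem_map_iff _ |>.2 ⟨j + 1, h₁ R hR _ _ h, by simp⟩

theorem exists_finMem_iUnion (n : ℕ) (b : ℕ → ℕ × ℕ × ℕ) :
    ∃ b', ∀ i, FinMem b' i ↔ ∃ l < n, FinMem (b l) i := by
  classical
  obtain ⟨b', hb'⟩ := exists_finMem
    ((Finset.range n).biUnion fun l => (Finset.range (b l).1).filter (FinMem (b l)))
  refine ⟨b', fun i => ?_⟩
  simp only [hb', Finset.mem_biUnion, Finset.mem_range, Finset.mem_filter]
  exact exists_congr fun l => and_congr_right fun _ => and_iff_right_of_imp And.left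

theorem exists_finMem_insert (a : ℕ) (b : ℕ × ℕ × ℕ) :
    ∃ b', ∀ i, FinMem b' i ↔ i = a ∨ FinMem b i := by
  classical
  obtain ⟨b', hb'⟩ := exists_finMem (insert a ((Finset.range b.1).filter (FinMem b)))
  refine ⟨b', fun i => ?_⟩
  simp only [hb', Finset.mem_insert, Finset.mem_range, Finset.mem_filter]
  exact or_congr_right (and_iff_right_of_imp And.left)

theorem exists_valid_of_forall_lt {n : ℕ} {c x y : ℕ → ℕ}
    (h : ∀ l < n, Derivable Y (c l) (x l) (y l)) :
    ∃ b, Valid Y b ∧ ∀ l < n, Claim b (c l) (x l) (y l) := by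
  choose! b hb hv using h
  obtain ⟨b', hb'⟩ := exists_finMem_iUnion n b
  refine ⟨b', fun c x y h => ?_, fun l hl => (hb' _).2 ⟨l, hl, hb l hl⟩⟩
  obtain ⟨l, hl, h⟩ := (hb' _).1 h
  exact (hv l hl _ _ _ h).mono fun _ _ _ h => (hb' _).2 ⟨l, hl, h⟩

theorem exists_valid_of_two {c x y c' x' y' : ℕ} (h : Derivable Y c x y)
    (h' : Derivable Y c' x' y') : ∃ b, Valid Y b ∧ Claim b c x y ∧ Claim b c' x' y' := by
  obtain ⟨b, hv, hb⟩ := exists_valid_of_forall_lt (Y := Y) (n := 2)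
    (c := fun l => if l = 0 then c else c') (x := fun l => if l = 0 then x else x')
    (y := fun l => if l = 0 then y else y') fun l _ => by
      rcases l with _ | l <;> simpa
  exact ⟨b, hv, by simpa using hb 0 (by simp), by simpa using hb 1 (by simp)⟩

/-- A step uses finitely many premises. The union of their computations is again a valid finite set,
and the conclusion may be added to it. -/
theorem Derivable.of_step {c x y : ℕ} (h : Step Y (Derivable Y) c x y) : Derivable Y c x y := by
  suffices ∃ b, Valid Y b ∧ Step Y (Claim b) c x y by
    obtain ⟨b, hb, h⟩ := this
    obtain ⟨b', hb'⟩ := exists_finMem_insert (Nat.pair c (Nat.pair x y)) b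
    have hmono : ∀ c x y, Claim b c x y → Claim b' c x y := fun _ _ _ h => (hb' _).2 (.inr h)
    refine ⟨b', (hb' _).2 (.inl rfl), fun c' x' y' h' => ?_⟩
    rcases (hb' _).1 h' with e | h'
    · simp only [Nat.pair_eq_pair] at e
      obtain ⟨rfl, rfl, rfl⟩ := e
      exact h.mono hmono
    · exact (hb _ _ _ h').mono hmono
  have h0 : ∃ b, Valid Y b := by
    obtain ⟨b, hb⟩ := exists_finMem ∅
    exact ⟨b, fun c x y h => absurd ((hb _).1 h) (by simp)⟩
  obtain ⟨tag, c₁, c₂, rfl, h⟩ := h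
  simp only [step_pair]
  rcases h with h | h | h | h | h | ⟨h, y₁, y₂, h₁, h₂, h₃⟩ | ⟨h, z, h₁, h₂⟩ |
    ⟨h, a, l, h₁, ⟨h₂, h₃⟩ | ⟨l', i, h₂, h₃, h₄⟩⟩ | ⟨h, h₁, h₂⟩
  · exact h0.imp fun b hb => ⟨hb, .inl h⟩
  · exact h0.imp fun b hb => ⟨hb, .inr (.inl h)⟩
  · exact h0.imp fun b hb => ⟨hb, .inr (.inr (.inl h))⟩
  · exact h0.imp fun b hb => ⟨hb, .inr (.inr (.inr (.inl h)))⟩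
  · exact h0.imp fun b hb => ⟨hb, .inr (.inr (.inr (.inr (.inl h))))⟩
  · obtain ⟨b, hb, h₁, h₂⟩ := exists_valid_of_two h₁ h₂
    exact ⟨b, hb, .inr (.inr (.inr (.inr (.inr (.inl ⟨h, y₁, y₂, h₁, h₂, h₃⟩)))))⟩
  · obtain ⟨b, hb, h₁, h₂⟩ := exists_valid_of_two h₁ h₂
    exact ⟨b, hb, .inr (.inr (.inr (.inr (.inr (.inr (.inl ⟨h, z, h₁, h₂⟩))))))⟩
  · obtain ⟨b, h₃, hb⟩ := h₃
    exact ⟨b, hb, .inr (.inr (.inr (.inr (.inr (.inr (.inr (.inl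
      ⟨h, a, l, h₁, .inl ⟨h₂, h₃⟩⟩)))))))⟩
  · obtain ⟨b, hb, h₃, h₄⟩ := exists_valid_of_two h₃ h₄
    exact ⟨b, hb, .inr (.inr (.inr (.inr (.inr (.inr (.inr (.inl
      ⟨h, a, l, h₁, .inr ⟨l', i, h₂, h₃, h₄⟩⟩)))))))⟩
  · choose! j hj h₂ using h₂
    -- There are y + 1 premises: nonzero values below `y`, and the zero at `y` itself.
    obtain ⟨b, hb, h₃⟩ := exists_valid_of_forall_lt (Y := Y) (n := y + 1) (c := fun _ => c₁)
      (x := fun l => Nat.pair x l) (y := fun l => if l = y then 0 else j l) fun l hl => by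
        rcases eq_or_ne l y with rfl | hly
        · simpa using h₁
        · simpa [hly] using h₂ l (by omega)
    refine ⟨b, hb, .inr (.inr (.inr (.inr (.inr (.inr (.inr (.inr ⟨h, ?_, fun l hl => ?_⟩)))))))⟩
    · simpa using h₃ y (by simp)
    · exact ⟨j l, hj l hl, by simpa [hl.ne] using h₃ l (by omega)⟩

/-- Every partial function recursive in the oracle has a program. -/
theorem exists_derivable {f : ℕ →. ℕ} (hf : Nat.RecursiveIn {char Y} f) :
    ∃ c, ∀ x y, y ∈ f x → Derivable Y c x y := by
  induction hf with
  | zero =>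
    refine ⟨Nat.pair 0 (Nat.pair 0 0), fun x y h => .of_step (step_pair.2 ?_)⟩
    simpa using Part.mem_some_iff.1 h
  | succ =>
    refine ⟨Nat.pair 1 (Nat.pair 0 0), fun x y h => .of_step (step_pair.2 ?_)⟩
    simpa using Part.mem_some_iff.1 h
  | left =>
    refine ⟨Nat.pair 2 (Nat.pair 0 0), fun x y h => .of_step (step_pair.2 ?_)⟩
    have : y = x.unpair.1 := Part.mem_some_iff.1 h
    subst this
    exact .inr (.inr (.inl ⟨rfl, x.unpair.2, by simp⟩))
  | right =>
    refine ⟨Nat.pair 3 (Nat.pair 0 0), fun x y h => .of_step (step_pair.2 ?_)⟩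
    have : y = x.unpair.2 := Part.mem_some_iff.1 h
    subst this
    exact .inr (.inr (.inr (.inl ⟨rfl, x.unpair.1, by simp⟩)))
  | oracle f hf =>
    rw [Set.mem_singleton_iff] at hf
    subst hf
    refine ⟨Nat.pair 4 (Nat.pair 0 0), fun x y h => .of_step (step_pair.2 ?_)⟩
    have := Part.mem_some_iff.1 h
    by_cases hx : x ∈ Y <;> simpa [hx] using this
  | pair _ _ ih₁ ih₂ =>
    obtain ⟨c₁, h₁⟩ := ih₁
    obtain ⟨c₂, h₂⟩ := ih₂
    refine ⟨Nat.pair 5 (Nat.pair c₁ c₂), fun x y h => .of_step (step_pair.2 ?_)⟩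
    simp only [Part.mem_bind_iff, Part.map_eq_map, Part.mem_map_iff, Seq.seq] at h
    obtain ⟨_, ⟨y₁, hy₁, rfl⟩, y₂, hy₂, rfl⟩ := h
    exact .inr (.inr (.inr (.inr (.inr (.inl ⟨rfl, y₁, y₂, h₁ _ _ hy₁, h₂ _ _ hy₂, rfl⟩)))))
  | comp _ _ ih₁ ih₂ =>
    obtain ⟨c₁, h₁⟩ := ih₁
    obtain ⟨c₂, h₂⟩ := ih₂
    refine ⟨Nat.pair 6 (Nat.pair c₁ c₂), fun x y h => .of_step (step_pair.2 ?_)⟩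
    obtain ⟨z, hz, hy⟩ := Part.mem_bind_iff.1 h
    exact .inr (.inr (.inr (.inr (.inr (.inr (.inl ⟨rfl, z, h₂ _ _ hz, h₁ _ _ hy⟩))))))
  | @prec f₁ f₂ _ _ ih₁ ih₂ =>
    obtain ⟨c₁, h₁⟩ := ih₁
    obtain ⟨c₂, h₂⟩ := ih₂
    refine ⟨Nat.pair 7 (Nat.pair c₁ c₂), ?_⟩
    have main : ∀ l a y, y ∈ (Nat.rec (f₁ a) (fun y IH => IH.bind fun i =>
        f₂ (Nat.pair a (Nat.pair y i))) l : Part ℕ) →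
        Derivable Y (Nat.pair 7 (Nat.pair c₁ c₂)) (Nat.pair a l) y := by
      intro l
      induction l with
      | zero =>
        exact fun a y h => .of_step (step_pair.2 (.inr (.inr (.inr (.inr (.inr (.inr (.inr (.inl
          ⟨rfl, a, 0, rfl, .inl ⟨rfl, h₁ _ _ h⟩⟩)))))))))
      | succ l ih =>
        intro a y h
        obtain ⟨i, hi, hy⟩ := Part.mem_bind_iff.1 h
        exact .of_step (step_pair.2 (.inr (.inr (.inr (.inr (.inr (.inr (.inr (.inl
          ⟨rfl, a, l + 1, rfl, .inr ⟨l, i, rfl, ih a i hi, h₂ _ _ hy⟩⟩)))))))))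
    intro x y h
    simpa using main x.unpair.2 x.unpair.1 y h
  | rfind _ ih =>
    obtain ⟨c₁, h₁⟩ := ih
    refine ⟨Nat.pair 8 (Nat.pair c₁ 0), fun x y h => .of_step (step_pair.2 ?_)⟩
    obtain ⟨h, h'⟩ := Nat.mem_rfind.1 h
    refine .inr (.inr (.inr (.inr (.inr (.inr (.inr (.inr ⟨rfl, ?_, fun l hl => ?_⟩)))))))
    · obtain ⟨j, hj, e⟩ := (Part.mem_map_iff _).1 h
      simp at e
      subst e
      exact h₁ _ _ hj
    · obtain ⟨j, hj, e⟩ := (Part.mem_map_iff _).1 (h' hl)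
      exact ⟨j, by simpa using e, h₁ _ _ hj⟩

@[simp] theorem sat_computes {Y : ℕ} {e x y : Tm} (he : e.Fresh k) (hx : x.Fresh k)
    (hy : y.Fresh k) : (computes Y e x y k).Sat (model g) v V ↔
    Derivable (V Y) (e.val (model g) v) (x.val (model g) v) (y.val (model g) v) := by
  simp [computes, Derivable, Valid, Claim, sat_isStep, he, hx, hy, he.val_update, hx.val_update,
    hy.val_update, he.val_update_add, hx.val_update_add, hy.val_update_add, add_assoc]
  rfl

@[simp] theorem sat_isTuringRed {X Y : ℕ} : (isTuringRed X Y k).Sat (model g) v V ↔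
    char (V X) ≤ᵀ char (V Y) := by
  have h : (isTuringRed X Y k).Sat (model g) v V ↔ ∃ e, ∀ x,
      (x ∈ V X → Derivable (V Y) e x 1) ∧ (x ∉ V X → Derivable (V Y) e x 0) := by
    simp [isTuringRed, add_assoc]
  rw [h]
  constructor
  · rintro ⟨e, he⟩
    obtain ⟨f, hf, hs⟩ := exists_recursiveIn_of_step (V Y) e
    have hs' : ∀ {x y}, Derivable (V Y) e x y → y ∈ f x := fun ⟨b, hb, hv⟩ => hs _ hv _ _ hb
    refine RecursiveIn.iff_nat.2 <| hf.of_eq fun x => Part.eq_some_iff.2 ?_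
    by_cases hx : x ∈ V X
    · simpa [hx] using hs' ((he x).1 hx)
    · simpa [hx] using hs' ((he x).2 hx)
  · intro hr
    obtain ⟨e, he⟩ := exists_derivable (RecursiveIn.iff_nat.1 hr)
    exact ⟨e, fun x => ⟨fun hx => he _ _ (by simp [char, hx]),
      fun hx => he _ _ (by simp [char, hx])⟩⟩

end Pointed

namespace Pointed

open SOA Function Encodable
open scoped Computability

variable {g : ℕ → ℕ → Bool} {v : ℕ → ℕ} {V : ℕ → Set ℕ} {k : ℕ}

/-! ## Codes of sequences in second-order arithmetic -/

/-- The number that codes a finite sequence in second-order arithmetic. -/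
def code (τ : List ℕ) : ℕ := encode τ.reverse

/-- The finite sequence coded by a number. -/
def seq (n : ℕ) : List ℕ := (Denumerable.ofNat (List ℕ) n).reverse

@[simp] theorem seq_code (τ : List ℕ) : seq (code τ) = τ := by simp [seq, code]
@[simp] theorem code_seq (n : ℕ) : code (seq n) = n := by simp [seq, code]

theorem code_surjective : Surjective code := fun n => ⟨seq n, code_seq n⟩

@[simp] theorem code_inj {σ τ : List ℕ} : code σ = code τ ↔ σ = τ :=
  ⟨fun h => by rw [← seq_code σ, h, seq_code], congrArg code⟩

/-- The reason for the reversal in `code`: appending at the end becomes `cons`, whose standard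
encoding is this number. -/
theorem pair_code_add_one (σ : List ℕ) (a : ℕ) : Nat.pair a (code σ) + 1 = code (σ ++ [a]) := by
  simp [code, encode_list_cons]

theorem code_nil : code [] = 0 := rfl

theorem length_le_code (σ : List ℕ) : σ.length ≤ code σ := by
  simpa [code] using Encodable.length_le_encode σ.reverse

theorem computableIn_code {O : Set (ℕ →. ℕ)} : ComputableIn O code :=
  .encode (.list_reverse .id)

theorem computableIn_seq {O : Set (ℕ →. ℕ)} : ComputableIn O seq := by
  refine .list_reverse ?_
  refine ComputableIn.of_eq (f := fun n => (decode (α := List ℕ) n).getD []) ?_ fun n => by simp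
  exact .option_getD (.decode .id) (.const _)

theorem charSeq_preimage_code_reducible_iff {A : Set ℕ} {g : ℕ →. ℕ} :
    charSeq (code ⁻¹' A) ≤ᵀ g ↔ char A ≤ᵀ g := by
  rw [charSeq_reducible_iff, char_reducible_iff]
  constructor
  · intro h
    refine (h.comp computableIn_seq).of_eq fun n => by simp
  · exact fun h => h.comp computableIn_code

theorem isTree_iff {T : Set (List ℕ)} : IsTree T ↔ ∀ σ a, σ ++ [a] ∈ T → σ ∈ T := by
  constructor
  · exact fun h σ a => h _ _ (List.prefix_append _ _)
  · rintro h σ _ ⟨l, rfl⟩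
    induction l using List.reverseRecOn with
    | nil => simp
    | append_singleton l a ih => exact fun hl => ih (h _ a (by simpa using hl))

@[simp] theorem sat_isTree {T : ℕ} : (isTree T k).Sat (model g) v V ↔ IsTree (code ⁻¹' V T) := by
  have h : (isTree T k).Sat (model g) v V ↔ ∀ σ a, Nat.pair a σ + 1 ∈ V T → σ ∈ V T := by
    simp [isTree, add_assoc]
  rw [h, isTree_iff, code_surjective.forall]
  simp only [pair_code_add_one]
  rfl

@[simp] theorem sat_isSubset {S T : ℕ} : (isSubset S T k).Sat (model g) v V ↔ V S ⊆ V T := by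
  simp [isSubset, Set.subset_def]

@[simp] theorem sat_isExt {σ τ : Tm} (hσ : σ.Fresh k) (hτ : τ.Fresh k) :
    (isExt σ τ k).Sat (model g) v V ↔ seq (σ.val (model g) v) <+: seq (τ.val (model g) v) := by
  have h : (isExt σ τ k).Sat (model g) v V ↔ ∃ b, FinMem b (τ.val (model g) v) ∧
      ∀ ρ, FinMem b ρ → ρ = σ.val (model g) v ∨ ∃ ρ' a, ρ = Nat.pair a ρ' + 1 ∧ FinMem b ρ' := by
    simp [isExt, hτ, hσ.val_update, hτ.val_update, hσ.val_update_add, hτ.val_update_add,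
      add_assoc]
  rw [h]
  obtain ⟨s, hs⟩ := code_surjective (σ.val (model g) v)
  obtain ⟨t, ht⟩ := code_surjective (τ.val (model g) v)
  rw [← hs, ← ht, seq_code, seq_code]
  constructor
  · rintro ⟨b, hb, hstep⟩
    -- Passing to predecessors stays in the set and must stop; it can do so only at `s`, as the
    -- empty sequence has no predecessor.
    have main : ∀ ρ, FinMem b (code ρ) → s <+: ρ := by
      intro ρ
      induction ρ using List.reverseRecOn with
      | nil =>
        intro h
        rcases hstep _ h with h | ⟨ρ', a, h, -⟩
        · rw [code_inj.1 h]
        · simp [code_nil] at h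
      | append_singleton ρ a ih =>
        intro h
        rcases hstep _ h with h | ⟨ρ', a', h, h'⟩
        · rw [code_inj.1 h]
        · obtain ⟨ρ', rfl⟩ := code_surjective ρ'
          rw [pair_code_add_one, code_inj] at h
          obtain ⟨rfl, -⟩ := List.append_inj' h rfl
          exact (ih h').trans (List.prefix_append _ _)
    exact main t hb
  · intro hst
    -- The sequences between `s` and `t` form the required set.
    obtain ⟨b, hb⟩ := exists_finMem ((t.inits.filter fun ρ => s <+: ρ).map code).toFinset
    have hb' : ∀ ρ, FinMem b (code ρ) ↔ s <+: ρ ∧ ρ <+: t := fun ρ => by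
      simp [hb, and_comm]
    refine ⟨b, (hb' t).2 ⟨hst, List.prefix_rfl⟩, code_surjective.forall.2 fun ρ hρ => ?_⟩
    obtain ⟨h₁, h₂⟩ := (hb' ρ).1 hρ
    rcases List.eq_nil_or_concat' ρ with rfl | ⟨ρ', a, rfl⟩
    · exact .inl (by rw [List.prefix_nil.1 h₁])
    · rcases List.prefix_concat_iff.1 h₁ with rfl | h₁
      · exact .inl rfl
      · exact .inr ⟨code ρ', a, (pair_code_add_one _ _).symm,
          (hb' ρ').2 ⟨h₁, (List.prefix_append _ _).trans h₂⟩⟩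

/-- The set of codes of initial segments, which represents `y` in second-order arithmetic. -/
def pathSet (y : ℕ → ℕ) : Set ℕ := Set.range fun n => code (initSeg y n)

theorem code_mem_pathSet {y : ℕ → ℕ} {σ : List ℕ} :
    code σ ∈ pathSet y ↔ initSeg y σ.length = σ := by
  constructor
  · rintro ⟨n, h⟩
    obtain rfl := code_inj.1 h
    simp
  · exact fun h => ⟨σ.length, by simp [h]⟩

theorem char_pathSet_reducible (y : ℕ → ℕ) : char (pathSet y) ≤ᵀ (y : ℕ →. ℕ) := by
  rw [char_reducible_iff]
  have h₁ : ComputableIn {(y : ℕ →. ℕ)} fun n => initSeg y (seq n).length :=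
    (computableIn_initSeg y).comp (.list_length computableIn_seq)
  exact (h₁.eq computableIn_seq).of_eq fun n => by rw [← code_mem_pathSet, code_seq]

/-- The value at `n` is found by searching the set for its element of length n + 1. So a real and
its set of initial segments have the same degree. -/
theorem reducible_char_pathSet (y : ℕ → ℕ) : (y : ℕ →. ℕ) ≤ᵀ char (pathSet y) := by
  have h₁ : ComputableIn {char (pathSet y)}
      fun x : ℕ × ℕ => (seq x.2).length = x.1 + 1 ∧ x.2 ∈ pathSet y :=
    .and (.eq (.list_length (computableIn_seq.comp (by fun_prop))) (by fun_prop))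
      ((computableIn_mem _).comp (by fun_prop))
  obtain ⟨f, hf, h⟩ := ComputableIn.exists_find
    (p := fun n m => (seq m).length = n + 1 ∧ m ∈ pathSet y) h₁
    fun n => ⟨code (initSeg y (n + 1)), by simp, n + 1, rfl⟩
  rw [fun_reducible_iff]
  have h₂ : ComputableIn {char (pathSet y)} fun n => ((seq (f n))[n]?).getD 0 :=
    .option_getD (.list_getElem? .id (computableIn_seq.comp hf)) (.const _)
  refine h₂.of_eq fun n => ?_
  obtain ⟨h₃, h₄⟩ := h n
  rw [← code_seq (f n), code_mem_pathSet, h₃] at h₄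
  rw [← h₄, getElem?_initSeg, if_pos n.lt_succ_self, Option.getD_some]

theorem exists_path_of_branch {P : Set (List ℕ)} (hP : IsTree P) (hne : P.Nonempty)
    (h : ∀ σ ∈ P, ∃ a, σ ++ [a] ∈ P ∧ ∀ b, σ ++ [b] ∈ P → b = a) :
    ∃ y, ∀ σ, σ ∈ P ↔ initSeg y σ.length = σ := by
  choose! a ha hu using h
  let s : ℕ → List ℕ := fun n => Nat.rec [] (fun _ σ => σ ++ [a σ]) n
  have hs : ∀ n, initSeg (fun n => a (s n)) n = s n := by
    intro n
    induction n with
    | zero => rfl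
    | succ n ih => rw [initSeg_succ, ih]
  have hsP : ∀ n, s n ∈ P := by
    intro n
    induction n with
    | zero =>
      obtain ⟨σ, hσ⟩ := hne
      exact hP _ _ List.nil_prefix hσ
    | succ n ih => exact ha _ ih
  refine ⟨fun n => a (s n), fun σ => ⟨?_, fun h => h ▸ hs _ ▸ hsP _⟩⟩
  induction σ using List.reverseRecOn with
  | nil => exact fun _ => rfl
  | append_singleton σ b ih =>
    intro hσ
    have h₁ := isTree_iff.1 hP _ _ hσ
    have h₂ := ih h₁
    rw [List.length_append, List.length_singleton, initSeg_succ, h₂, ← hs, h₂, hu σ h₁ b hσ]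

@[simp] theorem sat_isPath {P T : ℕ} : (isPath P T k).Sat (model g) v V ↔
    ∃ y ∈ paths (code ⁻¹' V T), V P = pathSet y := by
  have h : (isPath P T k).Sat (model g) v V ↔ V P ⊆ V T ∧ IsTree (code ⁻¹' V P) ∧ (V P).Nonempty ∧
      ∀ σ ∈ V P, ∃ a, Nat.pair a σ + 1 ∈ V P ∧ ∀ b, Nat.pair b σ + 1 ∈ V P → b = a := by
    simp [isPath, add_assoc, Set.Nonempty]
  rw [h]
  constructor
  · rintro ⟨hPT, hP, hne, hb⟩
    obtain ⟨y, hy⟩ := exists_path_of_branch hP (hne.preimage code_surjective) fun σ hσ => by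
      obtain ⟨a, ha, hu⟩ := hb _ hσ
      rw [pair_code_add_one] at ha
      exact ⟨a, ha, fun b hb => hu b (by rwa [pair_code_add_one])⟩
    refine ⟨y, fun n => hPT ((hy _).2 (by simp)), Set.ext (code_surjective.forall.2 fun σ => ?_)⟩
    rw [code_mem_pathSet]
    exact hy σ
  · rintro ⟨y, hy, e⟩
    rw [e]
    refine ⟨?_, fun σ τ hστ hτ => ?_, ⟨_, 0, rfl⟩, ?_⟩
    · rintro _ ⟨n, rfl⟩
      exact hy n
    · rw [Set.mem_preimage, code_mem_pathSet] at hτ ⊢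
      exact (List.prefix_of_prefix_length_le (hτ ▸ initSeg_prefix _ hστ.length_le) hστ
        (by simp)).eq_of_length (by simp)
    · rintro _ ⟨n, rfl⟩
      refine ⟨y n, ?_, fun b hb => ?_⟩
      · exact ⟨n + 1, by simp only [pair_code_add_one, initSeg_succ]⟩
      · simp only [pair_code_add_one] at hb
        rw [code_mem_pathSet] at hb
        simp [initSeg_succ] at hb
        exact hb.symm

@[simp] theorem sat_isPerfect {S : ℕ} : (isPerfect S k).Sat (model g) v V ↔
    IsPerfect (code ⁻¹' V S) := by
  simp [isPerfect, IsPerfect, add_assoc, code_surjective.exists, code_surjective.forall,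
    Set.Nonempty]

/-- Coding is recursive in both directions and `pathSet y` has the degree of `y`, so the sentence
reduces to `IsGenericSeq.exists_isPointed`, which controls even the paths outside the model. -/
theorem models_MPT (hg : IsGenericSeq g) : (model g).Models MPT := by
  intro v V _
  simp [MPT, isCofinal, isPointed]
  intro A hA hT hcof
  obtain ⟨S, hST, hS, hSg⟩ := hg.exists_isPointed hT
    (hA.imp fun n => charSeq_preimage_code_reducible_iff.2) fun X hX => by
      obtain ⟨y, ⟨n, hn⟩, hy, h⟩ := hcof X hX
      exact ⟨y, hy, ⟨n, (reducible_char_pathSet y).trans hn⟩, h.trans (char_pathSet_reducible y)⟩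
  have hpre : code ⁻¹' (code '' S) = S := Set.preimage_image_eq _ fun _ _ => code_inj.1
  have hred : ∀ f, charSeq S ≤ᵀ f → char (code '' S) ≤ᵀ f := fun f => by
    rw [← charSeq_preimage_code_reducible_iff, hpre]
    exact id
  refine ⟨code '' S, hSg.imp fun n => hred _, Set.image_subset_iff.2 hST, ?_, ?_, ?_⟩
  · rw [hpre]
    exact hS.1
  · rw [hpre]
    exact hS.2.1
  · rintro _ - y hy rfl
    rw [hpre] at hy
    exact (hred _ (hS.2.2 y hy)).trans (reducible_char_pathSet y)

end Pointed

/-! ### Failure of weak König's lemma -/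

namespace Pointed

open SOA Function Encodable
open Nat.Partrec (Code)
open scoped Computability

variable {g : ℕ → ℕ → Bool}

/-- The tree of finite `0`-`1`-sequences that do not yet contradict being an initial segment of
a diagonally noncomputable function. -/
def dncTree : Set (List ℕ) :=
  {σ | ∀ e < σ.length, ((σ[e]?).getD 0 = 0 ∨ (σ[e]?).getD 0 = 1) ∧
    Code.evaln σ.length (Denumerable.ofNat Code e) e ≠ some ((σ[e]?).getD 0)}

theorem isTree_dncTree : IsTree dncTree := by
  intro σ τ hστ hτ e he
  have h := hτ e (he.trans_le hστ.length_le)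
  have h' : τ[e]? = σ[e]? := by
    obtain ⟨l, rfl⟩ := hστ
    exact List.getElem?_append_left he
  rw [h'] at h
  exact ⟨h.1, fun h' => h.2 (Code.evaln_mono hστ.length_le h')⟩

theorem initSeg_mem_dncTree {z : ℕ → ℕ} {n : ℕ} : initSeg z n ∈ dncTree ↔
    ∀ e < n, (z e = 0 ∨ z e = 1) ∧ Code.evaln n (Denumerable.ofNat Code e) e ≠ some (z e) := by
  simp only [dncTree, Set.mem_ofPred_eq, length_initSeg]
  refine forall₂_congr fun e he => ?_
  rw [getElem?_initSeg, if_pos he, Option.getD_some]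

theorem exists_initSeg_mem_dncTree : ∃ z : ℕ → ℕ, ∀ n, initSeg z n ∈ dncTree := by
  classical
  refine ⟨fun e => if 0 ∈ (Denumerable.ofNat Code e).eval e then 1 else 0, fun n =>
    initSeg_mem_dncTree.2 fun e _ => ?_⟩
  split_ifs with h
  · exact ⟨.inr rfl, fun h' => one_ne_zero (Part.mem_unique (Code.evaln_sound h') h)⟩
  · exact ⟨.inl rfl, fun h' => h (Code.evaln_sound h')⟩

theorem computableIn_dncTree {O : Set (ℕ →. ℕ)} : ComputableIn O fun σ => σ ∈ dncTree := by
  have h₁ : ComputableIn O fun x : List ℕ × ℕ => (x.1[x.2]?).getD 0 := by fun_prop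
  have h₂ : ComputableIn O fun x : List ℕ × ℕ =>
      Code.evaln x.1.length (Denumerable.ofNat Code x.2) x.2 :=
    (Code.primrec_evaln.comp ((((Primrec.list_length.comp .fst).pair
      ((Primrec.ofNat Code).comp .snd))).pair .snd)).computableIn
  exact (ComputableIn.forall_lt (p := fun (σ : List ℕ) e =>
      ((σ[e]?).getD 0 = 0 ∨ (σ[e]?).getD 0 = 1) ∧
      Code.evaln σ.length (Denumerable.ofNat Code e) e ≠ some ((σ[e]?).getD 0))
    (.and (.or (.eq h₁ (.const 0)) (.eq h₁ (.const 1))) (.not (.eq h₂ (.option_some h₁))))).comp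
    (g := fun σ : List ℕ => (σ, σ.length)) (by fun_prop)

theorem isPA_of_mem_paths {y : ℕ → ℕ} (hy : y ∈ paths dncTree) : IsPA y := by
  refine ⟨y, fun e => (initSeg_mem_dncTree.1 (hy (e + 1)) e e.lt_succ_self).1, .refl _,
    fun e he => ?_⟩
  obtain ⟨n, hn⟩ := Code.evaln_complete.1 he
  exact (initSeg_mem_dncTree.1 (hy (max n (e + 1))) e
    (e.lt_succ_self.trans_le (le_max_right _ _))).2 (Code.evaln_mono (le_max_left _ _) hn)

/-- `dncTree` is recursive, so it is in the model, and it is infinite since diagonally noncomputable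
functions exist; but any path in the model would have PA degree. -/
theorem not_models_WKL (hg : IsGenericSeq g) : ¬ (model g).Models WKL := by
  intro h
  have hmem : ∀ A : Set ℕ, ComputableIn {char (join g 0)} (fun n => n ∈ A) → Below g (char A) :=
    fun A hA => ⟨0, char_reducible_iff.2 hA⟩
  have hpre : code ⁻¹' (code '' dncTree) = dncTree :=
    Set.preimage_image_eq _ fun _ _ => code_inj.1
  have h := h (fun _ => 0) (fun _ => ∅) (fun _ => hmem _ (.const False))
  simp [WKL] at h
  have h₁ : ComputableIn {char (join g 0)} fun n => n ∈ code '' dncTree :=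
    (computableIn_dncTree.comp computableIn_seq).of_eq fun n => by
      obtain ⟨σ, rfl⟩ := code_surjective n
      simp
  have h₂ : ∀ m a, Nat.pair a m + 1 ∈ code '' dncTree → a = 0 ∨ a = 1 := by
    refine code_surjective.forall.2 fun σ a ha => ?_
    rw [pair_code_add_one, ← Set.mem_preimage, hpre] at ha
    simpa using (ha σ.length (by simp)).1
  -- Infinity of the tree means elements with arbitrarily large codes; a code is at least the length
  -- of its sequence, so the segment of `z` of length n + 1 has a code above `n`.
  obtain ⟨z, hz⟩ := exists_initSeg_mem_dncTree
  obtain ⟨y, hA, hy⟩ := h _ (hmem _ h₁) (hpre.symm ▸ isTree_dncTree) h₂ fun n =>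
    ⟨_, (Nat.lt_succ_self n).trans_le (by simpa using length_le_code (initSeg z (n + 1))),
      Set.mem_image_of_mem _ (hz _)⟩
  rw [hpre] at hy
  exact hg.not_isPA (hA.imp fun n => (reducible_char_pathSet y).trans) (isPA_of_mem_paths hy)

end Pointed

theorem mainTheorem3 :
    (¬ ∀ φ ∈ SOA.WKL0, SOA.Entails (SOA.RCA0 ∪ {SOA.MPT}) φ) ∧
    (∃ g, Pointed.IsGenericSeq g) ∧
    ∀ g, Pointed.IsGenericSeq g →
      (Pointed.model g).ModelsTheory SOA.RCA0 ∧
      (Pointed.model g).Models SOA.MPT ∧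
      ¬ (Pointed.model g).Models SOA.WKL ∧
      (∀ x : ℕ → ℕ, Pointed.Below g x → ¬ Pointed.IsPA x) ∧
      (∀ T : Set (List ℕ), Pointed.IsTree T → Pointed.Below g (Pointed.charSeq T) →
        (∀ x : ℕ → ℕ, Pointed.Below g x →
          ∃ y ∈ Pointed.paths T, Pointed.Below g y ∧ TuringReducible x y) →
        ∃ S : Set (List ℕ), S ⊆ T ∧ Pointed.IsPointed S ∧
          Pointed.Below g (Pointed.charSeq S)) := by
  refine ⟨fun h => ?_, Pointed.exists_isGenericSeq, fun g hg => ⟨Pointed.models_RCA0,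
    Pointed.models_MPT hg, Pointed.not_models_WKL hg, fun x hx => hg.not_isPA hx,
    fun T hT hTg hcof => hg.exists_isPointed hT hTg fun X hX => ?_⟩⟩
  · obtain ⟨g, hg⟩ := Pointed.exists_isGenericSeq
    refine Pointed.not_models_WKL hg (h SOA.WKL (.inr rfl) _ ?_)
    rintro φ (hφ | rfl)
    exacts [Pointed.models_RCA0 φ hφ, Pointed.models_MPT hg]
  · obtain ⟨x, hx⟩ := Pointed.exists_fun_char X
    rw [← hx] at hX ⊢
    exact hcof x hX
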